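/- **Setting.** Let $\mathcal H$ be the Euclidean or the hyperbolic plane. Let $M=(V,E)$ be an infinite, locally finite, $2$-connected, quasi-transitive, one-ended simple graph, drawn properly in $\mathcal H$ (every compact set meets finitely many vertices and edges, and distinct edges meet only at common endpoints). Assume the drawing is canonical: edges are geodesic segments, the dual graph is quasi-transitive, and some group of automorphisms acting quasi-transitively on $M$ (for instance all of $\mathrm{Aut}(M)$) extends to isometries of $\mathcal H$. Let $\mathcal F=F_1\cup F_2$ be a partition of the set of faces of $M$ (triangular faces are allocated arbitrarily), and let $G_i$ be obtained from $M$ by adding all diagonals to all faces in $F_i$. Assume that some subgroup of $\mathrm{Aut}(M)$ acts quasi-transitively by automorphisms on both $G_1$ and $G_2$; $(G_1,G_2)$ is a matching pair. Let $\widehat G_i=(V\cup\Phi_i,E\cup\eta_i)$ be obtained from $M$ by placing a facial site inside each face in $F_i$ and joining it, inside the face, by edges (simple piecewise-geodesic arcs) to all vertices on the boundary of the face; the drawing of $\widehat G_i$ is again plane and proper. Let $\widehat G_1^+=(V_1^+,E_1^+)$ be the dual graph of $\widehat G_1$, with edges $e^+$ in bijection with the edges $e$ of $\widehat G_1$. For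 $\omega\in\{0,1\}^V$, let $\omega_1$ (respectively $\omega_2$) be the extension of $\omega$ to $V\cup\Phi_1$ (respectively $V\cup\Phi_2$) that is open ($=1$) on $\Phi_1$ (respectively closed ($=0$) on $\Phi_2$). For an edge $e=\langle u,v\rangle$ of $\widehat G_1$ put $\beta(e)=1$ if $\omega_1(u)=\omega_1(v)=1$ and $\beta(e)=0$ otherwise, and put $\beta^+(e^+)=1-\beta(e)$. Let $\widehat G_1(\omega)$ be the subgraph of $\widehat G_1$ induced by the $\omega_1$-open vertices, and $\widehat G_2(\overline\omega)$ the subgraph of $\widehat G_2$ induced by the $\omega_2$-closed vertices. Similarly $G_1(\omega)$ and $G_2(\overline\omega)$ are the subgraphs of $G_1$ and $G_2$ induced by $\{\omega=1\}$ and $\{\omega=0\}$. For a bond configuration $b$ on $H$, let $H(b)$ be the graph with all vertices of $H$ and the edges open in $b$. Let $\beta_\omega$ be the bond configuration on $G_1$ in which $\langle u,v\rangle$ is open iff $\omega(u)=\omega(v)=1$. Let $N(H)$ be the number of infinite components of $H$. **Statement.** (0) If the states $\omega(v)$, $v\in V$, are independent and equal to $1$ with probability $p\in[0,1]$, then the law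 of $\beta$ is one-dependent: $(\beta(e))_{e\in A}$ and $(\beta(e))_{e\in B}$ are independent whenever no edge in $A$ shares an endpoint with an edge in $B$. For every $\omega\in\{0,1\}^V$: (a) If $C$ is a cycle (respectively doubly-infinite path) of $\widehat G_1(\omega)$, then the set of dual edges $e^+$, $e\in C$, is a finite (respectively infinite) cutset of $\widehat G_1^+$, that is, a minimal set of edges whose removal disconnects a component. For every face $F$ (bounded or unbounded) of $\widehat G_1(\omega)$: (b) The set of vertices of $\widehat G_1^+$ inside $F$ (faces of $\widehat G_1$ contained in $F$), together with the open edges of $\beta^+$ inside $F$ (those $e^+$ for which the arc $e$ without its endpoints lies in $F$), is a non-empty connected component $C_1(F)$ of $\widehat G_1^+(\beta^+)$. (c) The set $C_2(F)$ of vertices of $\widehat G_2$ inside $F$ is either empty or the vertex set of a connected component of $\widehat G_2(\overline\omega)$. (d) Either $F$ is bounded and $C_1(F)$ and $C_2(F)$ are finite, or $F$ is unbounded and $C_1(F)$ and $C_2(F)$ are infinite. Moreover $$N(\widehat G_1(\omega))=N(\widehat G_1(\beta)),\qquad N(\widehat G_2(\overline\omega))=N(\widehat G_1^+(\beta^+)),$$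 and hence $$N(G_1(\omega))=N(\widehat G_1(\beta))=N(G_1(\beta_\omega)),\qquad N(G_2(\overline\omega))=N(\widehat G_1^+(\beta^+)).$$ -/

import Mathlib

open MeasureTheory ProbabilityTheory
open scoped unitInterval

noncomputable section

/-! ### Graphs -/

/-- `N(H)`: the number of infinite connected components of the graph `H`. -/
def numInfComponents {W : Type*} (H : SimpleGraph W) : ℕ∞ :=
  Set.encard {c : H.ConnectedComponent | c.supp.Infinite}

/-- A group of automorphisms of `G` acts quasi-transitively if it has finitely many orbits
of vertices. -/
def ActsQuasiTransitively {W : Type*} {G : SimpleGraph W} (Γ : Subgroup (G ≃g G)) : Prop :=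
  ∃ S : Set W, S.Finite ∧ ∀ w, ∃ γ ∈ Γ, ∃ s ∈ S, γ s = w

/-- Infinite, locally finite, `2`-connected, quasi-transitive (simple) graphs.  Planarity is
witnessed separately, by a drawing in the plane. -/
structure IsQuasiTransitiveTwoConnected {W : Type*} (G : SimpleGraph W) : Prop where
  infinite : Infinite W
  locallyFinite : ∀ w, (G.neighborSet w).Finite
  connected : G.Connected
  twoConnected : ∀ w, (G.induce {w}ᶜ).Connected
  quasiTransitive : ActsQuasiTransitively (⊤ : Subgroup (G ≃g G))

/-- The number of ends of a connected graph: the supremum, over finite sets of vertices, of the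
number of infinite components that remain after the set is removed. -/
def numEnds {W : Type*} (G : SimpleGraph W) : ℕ∞ :=
  ⨆ K : Finset W, numInfComponents (G.induce ((K : Set W)ᶜ))

/-! ### Plane drawings -/

/-- The geodesic segment between two points; in the Euclidean and in the hyperbolic plane a point
lies on it exactly if the triangle inequality is an equality there. -/
def geodesicSegment {X : Type*} [MetricSpace X] (x y : X) : Set X :=
  {p | dist x p + dist p y = dist x y}

/-- `A` is a simple arc from `x` to `y` made of finitely many geodesic segments. -/
def IsPolygonalArc {X : Type*} [MetricSpace X] (x y : X) (A : Set X) : Prop :=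
  (∃ γ : I → X, Continuous γ ∧ Function.Injective γ ∧ γ 0 = x ∧ γ 1 = y ∧ Set.range γ = A) ∧
  ∃ S : Set (X × X), S.Finite ∧ A = ⋃ q ∈ S, geodesicSegment q.1 q.2

/-- A proper plane drawing of `G` in `X`: vertices are distinct points, edges are simple polygonal
arcs between their endpoints, which contain no other vertex and meet each other only at common
endpoints, and every compact set meets only finitely many vertices and edges. -/
structure PlaneDrawing {W : Type*} (G : SimpleGraph W) (X : Type*) [MetricSpace X] where
  pos : W → X
  pos_injective : Function.Injective pos
  arc : G.edgeSet → Set X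
  isPolygonalArc : ∀ (u v : W) (h : G.Adj u v),
    IsPolygonalArc (pos u) (pos v) (arc ⟨s(u, v), h⟩)
  mem_of_pos_mem_arc : ∀ (e : G.edgeSet) (w : W), pos w ∈ arc e → w ∈ (e : Sym2 W)
  arc_inter_arc : ∀ e e' : G.edgeSet, e ≠ e' →
    arc e ∩ arc e' ⊆ pos '' {w | w ∈ (e : Sym2 W) ∧ w ∈ (e' : Sym2 W)}
  proper : ∀ K : Set X, IsCompact K →
    {w | pos w ∈ K}.Finite ∧ {e | (arc e ∩ K).Nonempty}.Finite

namespace PlaneDrawing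

variable {W : Type*} {G : SimpleGraph W} {X : Type*} [MetricSpace X]

/-- The subset of the plane occupied by the subgraph of `G` induced by the vertex set `S`. -/
def drawn (D : PlaneDrawing G X) (S : Set W) : Set X :=
  D.pos '' S ∪ ⋃ e ∈ {e : G.edgeSet | ∀ w ∈ (e : Sym2 W), w ∈ S}, D.arc e

/-- The faces of the subgraph of `G` induced by `S`: the connected components of the complement
of its drawing. -/
def facesOf (D : PlaneDrawing G X) (S : Set W) : Set (Set X) :=
  {F | ∃ x ∈ (D.drawn S)ᶜ, F = connectedComponentIn (D.drawn S)ᶜ x}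

/-- The faces of the drawing of `G`. They are also the vertices of the dual graph. -/
abbrev Face (D : PlaneDrawing G X) : Type _ := {F : Set X // F ∈ D.facesOf Set.univ}

/-- The vertex `w` lies on the boundary of the face `f`. -/
def VertexOnBoundary (D : PlaneDrawing G X) (w : W) (f : D.Face) : Prop :=
  D.pos w ∈ frontier (f : Set X)

/-- The edge `e` lies on the boundary of the face `f`. -/
def Borders (D : PlaneDrawing G X) (e : G.edgeSet) (f : D.Face) : Prop :=
  D.arc e ⊆ frontier (f : Set X)

/-- The arc of `e` without its two endpoints. -/
def openArc (D : PlaneDrawing G X) (e : G.edgeSet) : Set X :=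
  D.arc e \ D.pos '' {w | w ∈ (e : Sym2 W)}

/-- The dual graph, whose edges `e⁺` are indexed by the edges `e` of `G`, restricted to the dual
edges `e⁺` with `e ∈ T`: two faces are adjacent if some `e ∈ T` is common to their boundaries. -/
def dualGraph (D : PlaneDrawing G X) (T : Set G.edgeSet) : SimpleGraph D.Face where
  Adj f g := f ≠ g ∧ ∃ e ∈ T, D.Borders e f ∧ D.Borders e g
  symm := ⟨fun _ _ ⟨hne, e, he, hf, hg⟩ => ⟨hne.symm, e, he, hg, hf⟩⟩
  loopless := ⟨fun _ h => h.1 rfl⟩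

/-- Removing the dual edges `e⁺`, `e ∈ T`, disconnects some connected component of the dual. -/
def DualSeparates (D : PlaneDrawing G X) (T : Set G.edgeSet) : Prop :=
  ∃ f g : D.Face, (D.dualGraph Set.univ).Reachable f g ∧ ¬ (D.dualGraph Tᶜ).Reachable f g

/-- The dual edges `e⁺`, `e ∈ T`, form a cutset of the dual graph. -/
def IsDualCutset (D : PlaneDrawing G X) (T : Set G.edgeSet) : Prop :=
  Minimal D.DualSeparates T

/-- The dual multigraph is quasi-transitive: its automorphisms, i.e. the permutations of the faces
that preserve the number of parallel dual edges, have finitely many orbits on faces. -/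
def DualQuasiTransitive (D : PlaneDrawing G X) : Prop :=
  ∃ S : Set D.Face, S.Finite ∧ ∀ f, ∃ τ : Equiv.Perm D.Face,
    (∀ g h, g ≠ h → {e | D.Borders e g ∧ D.Borders e h}.encard
      = {e | D.Borders e (τ g) ∧ D.Borders e (τ h)}.encard) ∧
    ∃ s ∈ S, τ s = f

/-- Canonical drawings: edges are geodesic segments, the dual is quasi-transitive, and the
automorphisms of `G` extend to isometries of the plane.  The last condition is only asked of some
group of automorphisms acting quasi-transitively; if `G` is quasi-transitive, then it holds in
particular when all automorphisms of `G` extend to isometries. -/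
structure IsCanonical (D : PlaneDrawing G X) : Prop where
  arc_eq : ∀ (u v : W) (h : G.Adj u v),
    D.arc ⟨s(u, v), h⟩ = geodesicSegment (D.pos u) (D.pos v)
  dual : D.DualQuasiTransitive
  isometries : ∃ Γ : Subgroup (G ≃g G), ActsQuasiTransitively Γ ∧
    ∀ γ ∈ Γ, ∃ τ : X ≃ᵢ X, ∀ w, τ (D.pos w) = D.pos (γ w)

/-! ### Matching pairs and facial sites -/

/-- The graph obtained from `G` by adding all diagonals to all faces in `Φ`.  (A face bounded by a
triangle has no diagonals.) -/
def addDiagonals (D : PlaneDrawing G X) (Φ : Set D.Face) : SimpleGraph W where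
  Adj u v := G.Adj u v ∨
    (u ≠ v ∧ ∃ f ∈ Φ, D.VertexOnBoundary u f ∧ D.VertexOnBoundary v f)
  symm := ⟨fun _ _ h => h.elim (fun h => Or.inl h.symm)
    (fun ⟨hne, f, hf, hu, hv⟩ => Or.inr ⟨hne.symm, f, hf, hv, hu⟩)⟩
  loopless := ⟨fun _ h => h.elim (fun h => G.loopless.irrefl _ h) (fun h => h.1 rfl)⟩

/-- The graphs obtained by adding the diagonals to the faces in `Φ₁`, respectively in `Φ₂`, form a
matching pair: `Φ₁`, `Φ₂` partition the faces (triangular faces being allocated arbitrarily), and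
some group of automorphisms of `G` acts quasi-transitively on both graphs. -/
def IsMatchingPair (D : PlaneDrawing G X) (Φ₁ Φ₂ : Set D.Face) : Prop :=
  IsCompl Φ₁ Φ₂ ∧ ∃ Γ : Subgroup (G ≃g G), ActsQuasiTransitively Γ ∧
    ∀ γ ∈ Γ, ∀ u v,
      ((D.addDiagonals Φ₁).Adj (γ u) (γ v) ↔ (D.addDiagonals Φ₁).Adj u v) ∧
      ((D.addDiagonals Φ₂).Adj (γ u) (γ v) ↔ (D.addDiagonals Φ₂).Adj u v)

/-- The graph obtained from `G` by adding a facial site for each face in `Φ`, joined to all vertices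
on the boundary of that face. -/
def facialGraph (D : PlaneDrawing G X) (Φ : Set D.Face) : SimpleGraph (W ⊕ Φ) where
  Adj
    | .inl u, .inl v => G.Adj u v
    | .inl u, .inr f => D.VertexOnBoundary u f
    | .inr f, .inl u => D.VertexOnBoundary u f
    | .inr _, .inr _ => False
  symm := ⟨by
    rintro (u | f) (v | g) h
    · exact G.symm.symm _ _ h
    all_goals exact h⟩
  loopless := ⟨by
    rintro (u | f) h
    · exact G.loopless.irrefl _ h
    · exact h⟩

/-- `D'` is a drawing of the facial graph that extends the drawing `D` of `G`, with each facial site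
and its incident edges placed inside the corresponding face. -/
structure IsFacialDrawing (D : PlaneDrawing G X) (Φ : Set D.Face)
    (D' : PlaneDrawing (D.facialGraph Φ) X) : Prop where
  pos_eq : ∀ w, D'.pos (.inl w) = D.pos w
  arc_eq : ∀ (u v : W) (h : G.Adj u v),
    D'.arc ⟨s(.inl u, .inl v), h⟩ = D.arc ⟨s(u, v), h⟩
  pos_mem : ∀ f : Φ, D'.pos (.inr f) ∈ (f.1 : Set X)
  arc_subset : ∀ (u : W) (f : Φ) (h : D.VertexOnBoundary u f),
    D'.arc ⟨s(.inl u, .inr f), h⟩ ⊆ insert (D.pos u) (f.1 : Set X)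

end PlaneDrawing

/-! ### Percolation -/

/-- The bond configuration of a site configuration: an edge is open (`true`) if and only if both of
its endpoints are. -/
def siteToBond {W : Type*} (H : SimpleGraph W) (ω : W → Bool) (e : H.edgeSet) : Bool :=
  Sym2.lift ⟨fun u v => ω u && ω v, fun _ _ => Bool.and_comm _ _⟩ (e : Sym2 W)

/-- The graph `H(β)` of all vertices of `H` and the edges that are open in `β`. -/
def bondGraph {W : Type*} (H : SimpleGraph W) (β : H.edgeSet → Bool) : SimpleGraph W where
  Adj u v := ∃ h : H.Adj u v, β ⟨s(u, v), h⟩ = true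
  symm := ⟨fun u v ⟨h, hb⟩ => ⟨h.symm, by
    have : (⟨s(v, u), h.symm⟩ : H.edgeSet) = ⟨s(u, v), h⟩ := Subtype.ext Sym2.eq_swap
    rw [this]; exact hb⟩⟩
  loopless := ⟨fun _ ⟨h, _⟩ => H.loopless.irrefl _ h⟩

/-- The dual configuration `β⁺(e⁺) = 1 - β(e)`, indexed by the primal edges `e`. -/
def dualConfig {E : Type*} (β : E → Bool) : E → Bool := fun e => !β e

/-- `ω₁` (for `b = true`) and `ω₂` (for `b = false`): the extension of `ω` that has the state `b`
at every facial site. -/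
def extendSites {V Φ : Type*} (ω : V → Bool) (b : Bool) : V ⊕ Φ → Bool :=
  Sum.elim ω (fun _ => b)

/-- The law `ℙ_p` of site percolation: states are independent, and open with probability `p`. -/
def sitePercolation (V : Type*) (p : I) : Measure (V → Bool) :=
  Measure.infinitePi (fun _ : V => bernoulliMeasure true false p)

/-- A law on bond configurations is one-dependent if the restrictions to any two sets of edges,
such that no edge of the one shares an endpoint with an edge of the other, are independent. -/
def IsOneDependent {W : Type*} (H : SimpleGraph W) (μ : Measure (H.edgeSet → Bool)) : Prop :=
  ∀ A B : Set H.edgeSet,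
    (∀ e ∈ A, ∀ e' ∈ B, ∀ w, w ∈ (e : Sym2 W) → w ∉ (e' : Sym2 W)) →
    IndepFun (fun (β : H.edgeSet → Bool) (e : A) => β e)
      (fun (β : H.edgeSet → Bool) (e : B) => β e) μ

end

/-! A dual edge is open exactly when its primal edge is not in the open subgraph, so crossing it
leads from face to face of `D₁` without leaving a face $F$ of that subgraph. Conversely, $F$ stays
connected when the vertices are deleted, so any two faces inside it are linked by such crossings
(`reachable_of_connIn`). This gives (b).

For (c), follow an open dual path inside $F$. Each crossed edge has a closed endpoint. It is a
vertex of $M$, because the facial sites of the first graph are open, and it lies on the boundary of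
both faces on the two sides. It remains to link the closed vertices on the boundary of a single face
$t$ of `D₁`. If $t$ lies in a face from $\Phi_2$, the closed facial site of that face links them. If
$t$ lies in a face from $\Phi_1$, then $t$ has at most two vertices of $M$ on its boundary and these
are adjacent (`not_three_vertices`, `adj_of_mem_closure`). This is where $2$-connectedness enters:
any two spokes of a face close up to a curve that avoids a given third vertex, so the spokes really
cut the face into sectors.

For (d), faces of `D₁` are bounded and the drawings are proper. A bounded $F$ therefore contains
finitely many faces and sites. An unbounded $F$ contains infinitely many faces, each of which sees a
site in $F$, and each site is seen from finitely many faces. Hence both counts of infinite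
components equal the number of unbounded $F$. Facial sites are traded for diagonals without changing
the number of infinite components, since vertices have finite degree.

The plane topology is derived from continuous logarithms. Nonvanishing functions have logarithms on
the plane, and on the punctured plane up to an integer degree. A Mayer–Vietoris argument turns this
into Janiszewski's theorem and a version of it with three points. Consequences: an arc does not
separate, nor does one attached at a single point, and an arc attached at both ends yields at most
two pieces. That it does yield two comes from the logarithm of $(z-q)/(z-p)$. For (a), a cycle
separates but becomes an arc when an edge is removed. A doubly-infinite path is treated as a cycle
closed up outside a large disc.

For (0), the states of edge sets without common endpoints are functions of disjoint families of
independent sites. -/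

/-! ### Points connected inside a set -/

/-- `a` and `b` lie in a common preconnected subset of `U`. -/
def ConnIn {Y : Type*} [TopologicalSpace Y] (U : Set Y) (a b : Y) : Prop :=
  ∃ C ⊆ U, IsPreconnected C ∧ a ∈ C ∧ b ∈ C

namespace ConnIn

variable {Y Z : Type*} [TopologicalSpace Y] [TopologicalSpace Z] {U U' : Set Y} {a b c : Y}

lemma left_mem (h : ConnIn U a b) : a ∈ U := by
  obtain ⟨C, hC, -, ha, -⟩ := h
  exact hC ha

lemma right_mem (h : ConnIn U a b) : b ∈ U := by
  obtain ⟨C, hC, -, -, hb⟩ := h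
  exact hC hb

lemma refl (h : a ∈ U) : ConnIn U a a :=
  ⟨{a}, by simpa using h, isPreconnected_singleton, rfl, rfl⟩

lemma symm (h : ConnIn U a b) : ConnIn U b a := by
  obtain ⟨C, hC, h, ha, hb⟩ := h
  exact ⟨C, hC, h, hb, ha⟩

lemma trans (h : ConnIn U a b) (h' : ConnIn U b c) : ConnIn U a c := by
  obtain ⟨C, hC, h, ha, hb⟩ := h
  obtain ⟨C', hC', h', hb', hc⟩ := h'
  exact ⟨C ∪ C', Set.union_subset hC hC', h.union b hb hb' h', Or.inl ha, Or.inr hc⟩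

lemma mono (h : ConnIn U a b) (hU : U ⊆ U') : ConnIn U' a b := by
  obtain ⟨C, hC, h, ha, hb⟩ := h
  exact ⟨C, hC.trans hU, h, ha, hb⟩

lemma map {V : Set Z} (h : ConnIn U a b) {f : Y → Z} (hf : ContinuousOn f U)
    (hV : Set.MapsTo f U V) : ConnIn V (f a) (f b) := by
  obtain ⟨C, hC, h, ha, hb⟩ := h
  exact ⟨f '' C, (Set.image_mono hC).trans hV.image_subset, h.image f (hf.mono hC),
    Set.mem_image_of_mem f ha, Set.mem_image_of_mem f hb⟩

lemma iff_mem (ha : a ∈ U) : ConnIn U a b ↔ b ∈ connectedComponentIn U a := by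
  constructor
  · rintro ⟨C, hC, h, ha', hb⟩
    exact h.subset_connectedComponentIn ha' hC hb
  · intro hb
    exact ⟨_, connectedComponentIn_subset U a, isPreconnected_connectedComponentIn,
      mem_connectedComponentIn ha, hb⟩

lemma of_isPreconnected (h : IsPreconnected U) (ha : a ∈ U) (hb : b ∈ U) : ConnIn U a b :=
  ⟨U, subset_rfl, h, ha, hb⟩

end ConnIn

/-- Intermediate values: between two different integers the real part would take a half-integer
value. Stated for complex functions because it is applied to differences of logarithms divided by
$2\pi i$. -/
lemma IsPreconnected.int_valued_eq {Y : Type*} [TopologicalSpace Y] {s : Set Y}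
    (hs : IsPreconnected s) {f : Y → ℂ} (hf : ContinuousOn f s)
    (h : ∀ x ∈ s, ∃ n : ℤ, f x = n) {a b : Y} (ha : a ∈ s) (hb : b ∈ s) : f a = f b := by
  have hre : ContinuousOn (fun x => (f x).re) s := Complex.continuous_re.comp_continuousOn hf
  have key : ∀ x ∈ s, ∀ y ∈ s, ¬ (f x).re < (f y).re := by
    intro x hx y hy hlt
    obtain ⟨m, hm⟩ := h x hx
    obtain ⟨n, hn⟩ := h y hy
    rw [hm, hn] at hlt
    simp only [Complex.intCast_re, Int.cast_lt] at hlt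
    have h1 : (m : ℝ) + 1 ≤ n := by exact_mod_cast hlt
    have := hs.intermediate_value hx hy hre
    obtain ⟨z, hz, hz'⟩ := this (show (m : ℝ) + 1 / 2 ∈ _ by
      rw [hm, hn]; simp only [Complex.intCast_re, Set.mem_Icc]; constructor <;> linarith)
    obtain ⟨k, hk⟩ := h z hz
    simp only [hk, Complex.intCast_re] at hz'
    have h2 : m < k := by
      have : (m : ℝ) < k := by linarith
      exact_mod_cast this
    have h3 : k < m + 1 := by
      have : (k : ℝ) < (m + 1 : ℤ) := by push_cast; linarith
      exact_mod_cast this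
    omega
  obtain ⟨m, hm⟩ := h a ha
  obtain ⟨n, hn⟩ := h b hb
  have h1 := key a ha b hb
  have h2 := key b hb a ha
  rw [hm, hn] at h1 h2 ⊢
  simp only [Complex.intCast_re, Int.cast_lt, not_lt] at h1 h2
  exact_mod_cast le_antisymm h2 h1

/-! ### Continuous logarithms -/

-- The function is lifted through the covering of the nonzero numbers by `exp`. The lift exists
-- because the space is simply connected and locally path connected.
open Complex in
lemma exists_continuous_log {Y : Type*} [TopologicalSpace Y] [SimplyConnectedSpace Y]
    [LocallyPathConnectedSpace Y] (f : C(Y, ℂ)) (hf : ∀ y, f y ≠ 0) :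
    ∃ g : C(Y, ℂ), ∀ y, Complex.exp (g y) = f y := by
  obtain ⟨y₀⟩ : Nonempty Y := inferInstance
  obtain ⟨F, ⟨-, hF⟩, -⟩ := Complex.isCoveringMapOn_exp.existsUnique_continuousMap_lifts f
    (a₀ := y₀) (e₀ := Complex.log (f y₀)) (Complex.exp_log (hf y₀)) hf
  exact ⟨F, fun y => congr_fun hF y⟩

open Complex in
/-- Up to a continuous logarithm, a nonvanishing function on the punctured plane is a power. -/
lemma exists_degree (f : C({z : ℂ // z ≠ 0}, ℂ)) (hf : ∀ z, f z ≠ 0) :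
    ∃ (m : ℤ) (g : C({z : ℂ // z ≠ 0}, ℂ)), ∀ z, f z = (z : ℂ) ^ m * exp (g z) := by
  let E : C(ℂ, {z : ℂ // z ≠ 0}) := ⟨fun z => ⟨exp z, exp_ne_zero z⟩, by fun_prop⟩
  obtain ⟨h, hh⟩ := exists_continuous_log (f.comp E) (fun y => hf _)
  have hE : ∀ w (n : ℤ), E (w + n * (2 * Real.pi * Complex.I)) = E w := by
    intro w n
    apply Subtype.ext
    simp [E, exp_add, exp_int_mul_two_pi_mul_I]
  have hpi : (2 * Real.pi * Complex.I : ℂ) ≠ 0 := two_pi_I_ne_zero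
  have hint : ∀ w, ∃ n : ℤ, (h (w + 2 * Real.pi * Complex.I) - h w) / (2 * Real.pi * Complex.I) = n := by
    intro w
    have : exp (h (w + 2 * Real.pi * Complex.I)) = exp (h w) := by
      rw [hh, hh]
      have := hE w 1
      simp only [Int.cast_one, one_mul] at this
      simp [this]
    obtain ⟨n, hn⟩ := exp_eq_exp_iff_exists_int.1 this
    exact ⟨n, by rw [hn]; field_simp; ring⟩
  obtain ⟨m, hm⟩ := hint 0
  have hconst : ∀ w, h (w + 2 * Real.pi * Complex.I) = h w + m * (2 * Real.pi * Complex.I) := by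
    intro w
    have := isPreconnected_univ.int_valued_eq
      (f := fun w => (h (w + 2 * Real.pi * Complex.I) - h w) / (2 * Real.pi * Complex.I)) (by fun_prop)
      (fun w _ => hint w) (Set.mem_univ w) (Set.mem_univ 0)
    simp only [hm] at this
    field_simp at this
    linear_combination this
  -- `h` grows by $2\pi i m$ along each period, so subtracting $mw$ leaves a periodic function,
  -- which descends through `exp`.
  let k : ℂ → ℂ := fun w => h w - m * w
  have hk1 : ∀ w, k (w + 2 * Real.pi * Complex.I) = k w := by
    intro w; simp only [k, hconst]; ring
  have hk2 : Function.Periodic k (2 * Real.pi * Complex.I) := hk1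
  have hk : ∀ w (n : ℤ), k (w + n * (2 * Real.pi * Complex.I)) = k w := fun w n => hk2.int_mul n w
  have hq : Topology.IsQuotientMap E := isAddQuotientCoveringMap_exp.toIsQuotientMap
  refine ⟨m, ⟨fun z => k (log z), ?_⟩, ?_⟩
  -- The branch cut of `log` is harmless: continuity is tested after composition with the quotient
  -- map `exp`, and there periodicity of `k` removes the choice of branch.
  · rw [hq.continuous_iff]
    have : (fun z : {z : ℂ // z ≠ 0} => k (log z)) ∘ E = k := by
      funext w
      obtain ⟨n, hn⟩ := exp_eq_exp_iff_exists_int.1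
        (show exp (log (exp w)) = exp w from exp_log (exp_ne_zero w))
      show k (log (exp w)) = k w
      rw [hn, hk]
    rw [this]
    fun_prop
  · intro z
    have h1 : E (log z) = z := Subtype.ext (exp_log z.2)
    have h2 := hh (log z)
    simp only [ContinuousMap.comp_apply, h1] at h2
    simp only [ContinuousMap.coe_mk, k]
    rw [← h2, exp_sub, exp_int_mul, exp_log z.2]
    have : (z : ℂ) ^ m ≠ 0 := zpow_ne_zero _ z.2
    field_simp

/-! ### A Mayer–Vietoris argument for two open sets -/

section MayerVietoris

open Filter Topology

variable {Y : Type*} [TopologicalSpace Y]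

/-- The cutoff has to be constant near the complements of the two sets, not only on them, so that a
product with an arbitrary function is continuous there. -/
lemma exists_cutoff [NormalSpace Y] {U₁ U₂ : Set Y} (h₁ : IsOpen U₁) (h₂ : IsOpen U₂)
    (hU : U₁ ∪ U₂ = Set.univ) : ∃ χ : C(Y, ℂ), (∀ y ∉ U₁, ∀ᶠ z in 𝓝 y, χ z = 1) ∧
      ∀ y ∉ U₂, ∀ᶠ z in 𝓝 y, χ z = 0 := by
  obtain ⟨f, hf0, hf1, -⟩ := exists_continuous_zero_one_of_isClosed h₂.isClosed_compl
    h₁.isClosed_compl (by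
      rw [Set.disjoint_compl_left_iff_subset]
      intro y hy
      have : y ∈ U₁ ∪ U₂ := hU ▸ Set.mem_univ y
      exact this.resolve_left hy)
  -- Clamping `3 * f - 1` to $[0,1]$ makes the Urysohn function constant where it exceeds $2/3$ and
  -- where it is below $1/3$.
  refine ⟨⟨fun y => ((max 0 (min 1 (3 * f y - 1)) : ℝ) : ℂ), by fun_prop⟩, ?_, ?_⟩
  · intro y hy
    have : f y = 1 := hf1 hy
    filter_upwards [(f.continuous.tendsto y).eventually (lt_mem_nhds (show 2 / 3 < f y by
      rw [this]; norm_num))] with z hz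
    have h1 : min 1 (3 * f z - 1) = 1 := min_eq_left (by linarith)
    simp [h1]
  · intro y hy
    have : f y = 0 := hf0 hy
    filter_upwards [(f.continuous.tendsto y).eventually (gt_mem_nhds (show f y < 1 / 3 by
      rw [this]; norm_num))] with z hz
    have h1 : max 0 (min 1 (3 * f z - 1)) = 0 :=
      max_eq_left ((min_le_right _ _).trans (by linarith))
    simp [h1]

variable {U₁ U₂ : Set Y} {N : Y → ℤ} {χ : C(Y, ℂ)}

/-- `N` is controlled only on the intersection. At the other points of `U₁` the cutoff vanishes
nearby and hides it. -/
lemma continuousAt_intCast_mul_cutoff (hN : ∀ y ∈ U₁ ∩ U₂, ∀ᶠ z in 𝓝 y, N z = N y)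
    (hχ₂ : ∀ y ∉ U₂, ∀ᶠ z in 𝓝 y, χ z = 0) {y : Y} (hy : y ∈ U₁) :
    ContinuousAt (fun z => (N z : ℂ) * χ z) y := by
  by_cases h : y ∈ U₂
  · have : ContinuousAt (fun z => (N y : ℂ) * χ z) y := by fun_prop
    exact this.congr ((hN y ⟨hy, h⟩).mono fun z hz => by simp only [hz])
  · exact (continuousAt_const (y := (0 : ℂ))).congr ((hχ₂ y h).mono fun z hz => by simp [hz])

lemma continuousAt_intCast_mul_one_sub_cutoff (hN : ∀ y ∈ U₁ ∩ U₂, ∀ᶠ z in 𝓝 y, N z = N y)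
    (hχ₁ : ∀ y ∉ U₁, ∀ᶠ z in 𝓝 y, χ z = 1) {y : Y} (hy : y ∈ U₂) :
    ContinuousAt (fun z => (N z : ℂ) * (1 - χ z)) y := by
  by_cases h : y ∈ U₁
  · have : ContinuousAt (fun z => (N y : ℂ) * (1 - χ z)) y := by fun_prop
    exact this.congr ((hN y ⟨h, hy⟩).mono fun z hz => by simp only [hz])
  · exact (continuousAt_const (y := (0 : ℂ))).congr ((hχ₁ y h).mono fun z hz => by simp [hz])

-- This is the connecting map of Mayer–Vietoris, from locally constant functions on the intersection
-- to nonvanishing functions on the whole space. On `U₁` the exponent is continuous. On `U₂` it may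
-- be replaced by $-N(1-\chi)$, which differs from it by the integer $N$.
open Complex in
lemma continuous_exp_cutoff (hU : U₁ ∪ U₂ = Set.univ)
    (hN : ∀ y ∈ U₁ ∩ U₂, ∀ᶠ z in 𝓝 y, N z = N y)
    (hχ₁ : ∀ y ∉ U₁, ∀ᶠ z in 𝓝 y, χ z = 1) (hχ₂ : ∀ y ∉ U₂, ∀ᶠ z in 𝓝 y, χ z = 0) :
    Continuous (fun y => exp ((N y * χ y) * (2 * Real.pi * Complex.I))) := by
  rw [continuous_iff_continuousAt]
  intro y
  by_cases h : y ∈ U₁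
  · have := continuousAt_intCast_mul_cutoff hN hχ₂ h
    fun_prop
  · have h2 : y ∈ U₂ := (show y ∈ U₁ ∪ U₂ from hU ▸ Set.mem_univ y).resolve_left h
    have h3 := continuousAt_intCast_mul_one_sub_cutoff hN hχ₁ h2
    have h4 : ContinuousAt (fun y => exp (-((N y * (1 - χ y)) * (2 * Real.pi * Complex.I)))) y := by
      fun_prop
    refine h4.congr (Eventually.of_forall fun z => ?_)
    rw [exp_eq_exp_iff_exists_int]
    exact ⟨-N z, by push_cast; ring⟩

-- Exactness: if the glued function has a logarithm `g`, then $g/(2\pi i)-N\chi$ is continuous and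
-- integer valued on `U₁`, and so is $g/(2\pi i)+N(1-\chi)$ on `U₂`. Each takes equal values at `a`
-- and `b`, and their difference is `N`.
open Complex in
lemma eq_of_exp_cutoff_eq (hN : ∀ y ∈ U₁ ∩ U₂, ∀ᶠ z in 𝓝 y, N z = N y)
    (hχ₁ : ∀ y ∉ U₁, ∀ᶠ z in 𝓝 y, χ z = 1) (hχ₂ : ∀ y ∉ U₂, ∀ᶠ z in 𝓝 y, χ z = 0)
    {g : Y → ℂ} (hgc : Continuous g)
    (hg : ∀ y, exp (g y) = exp ((N y * χ y) * (2 * Real.pi * Complex.I)))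
    {a b : Y} (h₁ : ConnIn U₁ a b) (h₂ : ConnIn U₂ a b) : N a = N b := by
  have hpi : (2 * Real.pi * Complex.I : ℂ) ≠ 0 := two_pi_I_ne_zero
  have hint : ∀ y, ∃ n : ℤ, g y / (2 * Real.pi * Complex.I) - N y * χ y = n := by
    intro y
    obtain ⟨n, hn⟩ := exp_eq_exp_iff_exists_int.1 (hg y)
    exact ⟨n, by rw [hn]; field_simp; ring⟩
  obtain ⟨C₁, hC₁, hc₁, ha₁, hb₁⟩ := h₁
  obtain ⟨C₂, hC₂, hc₂, ha₂, hb₂⟩ := h₂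
  have e₁ := hc₁.int_valued_eq (f := fun y => g y / (2 * Real.pi * Complex.I) - N y * χ y)
    (fun y hy => by
      have := continuousAt_intCast_mul_cutoff hN hχ₂ (hC₁ hy)
      have := hgc.continuousAt (x := y)
      exact ContinuousAt.continuousWithinAt (by fun_prop)) (fun y _ => hint y) ha₁ hb₁
  have e₂ := hc₂.int_valued_eq
    (f := fun y => g y / (2 * Real.pi * Complex.I) + N y * (1 - χ y))
    (fun y hy => by
      have := continuousAt_intCast_mul_one_sub_cutoff hN hχ₁ (hC₂ hy)
      have := hgc.continuousAt (x := y)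
      exact ContinuousAt.continuousWithinAt (by fun_prop))
    (fun y _ => by
      obtain ⟨n, hn⟩ := hint y
      exact ⟨n + N y, by push_cast; rw [← hn]; ring⟩) ha₂ hb₂
  have : (N a : ℂ) = N b := by
    linear_combination e₂ - e₁
  exact_mod_cast this

lemma eventually_connIn_iff [LocallyConnectedSpace Y] {U : Set Y} (hU : IsOpen U) (a : Y) {y : Y}
    (hy : y ∈ U) : ∀ᶠ z in 𝓝 y, (ConnIn U a z ↔ ConnIn U a y) := by
  have : connectedComponentIn U y ∈ 𝓝 y :=
    (hU.connectedComponentIn).mem_nhds (mem_connectedComponentIn hy)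
  filter_upwards [this] with z hz
  have h := (ConnIn.iff_mem hy).2 hz
  exact ⟨fun h' => h'.trans h.symm, fun h' => h'.trans h⟩

/-- Janiszewski's theorem, for open sets covering a space on which nonvanishing functions have
logarithms. -/
lemma ConnIn.inter_of_exists_log [NormalSpace Y] [LocallyConnectedSpace Y]
    (hlog : ∀ f : C(Y, ℂ), (∀ y, f y ≠ 0) → ∃ g : C(Y, ℂ), ∀ y, Complex.exp (g y) = f y)
    (o₁ : IsOpen U₁) (o₂ : IsOpen U₂) (hU : U₁ ∪ U₂ = Set.univ) {a b : Y}
    (h₁ : ConnIn U₁ a b) (h₂ : ConnIn U₂ a b) : ConnIn (U₁ ∩ U₂) a b := by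
  classical
  obtain ⟨χ, hχ₁, hχ₂⟩ := exists_cutoff o₁ o₂ hU
  -- The indicator of the component of `a` in the intersection; the conclusion is that it is also 1
  -- at `b`.
  let N : Y → ℤ := fun y => if ConnIn (U₁ ∩ U₂) a y then 1 else 0
  have hN : ∀ y ∈ U₁ ∩ U₂, ∀ᶠ z in 𝓝 y, N z = N y := fun y hy =>
    (eventually_connIn_iff (o₁.inter o₂) a hy).mono fun z hz => by simp only [N, hz]
  obtain ⟨g, hg⟩ := hlog (ContinuousMap.mk _ (continuous_exp_cutoff hU hN hχ₁ hχ₂))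
    (fun y => Complex.exp_ne_zero _)
  have := eq_of_exp_cutoff_eq hN hχ₁ hχ₂ g.continuous hg h₁ h₂
  have ha : N a = 1 := if_pos (ConnIn.refl (show a ∈ U₁ ∩ U₂ from ⟨h₁.left_mem, h₂.left_mem⟩))
  by_contra hcon
  have hb : N b = 0 := if_neg hcon
  omega

/-- Two open sets that cover the punctured plane: a component of the one and a component of the
other have at most two components of the intersection in common. -/
lemma ConnIn.inter_of_punctured {U₁ U₂ : Set {z : ℂ // z ≠ 0}}
    (o₁ : IsOpen U₁) (o₂ : IsOpen U₂) (hU : U₁ ∪ U₂ = Set.univ) {a b c : {z : ℂ // z ≠ 0}}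
    (h₁ : ConnIn U₁ a b) (h₂ : ConnIn U₂ a b) (h₁' : ConnIn U₁ a c) (h₂' : ConnIn U₂ a c) :
    ConnIn (U₁ ∩ U₂) a b ∨ ConnIn (U₁ ∩ U₂) a c ∨ ConnIn (U₁ ∩ U₂) b c := by
  classical
  have : LocallyConnectedSpace {z : ℂ // z ≠ 0} :=
    (isOpen_ne (x := (0 : ℂ))).locallyConnectedSpace
  obtain ⟨χ, hχ₁, hχ₂⟩ := exists_cutoff o₁ o₂ hU
  let N (x y : {z : ℂ // z ≠ 0}) : ℤ := if ConnIn (U₁ ∩ U₂) x y then 1 else 0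
  have hN (x) : ∀ y ∈ U₁ ∩ U₂, ∀ᶠ z in 𝓝 y, N x z = N x y := fun y hy =>
    (eventually_connIn_iff (o₁.inter o₂) x hy).mono fun z hz => by simp only [N, hz]
  have hd (x) := exists_degree (ContinuousMap.mk _ (continuous_exp_cutoff hU (hN x) hχ₁ hχ₂))
    (fun y => Complex.exp_ne_zero _)
  simp only [ContinuousMap.coe_mk] at hd
  obtain ⟨m, g, hg⟩ := hd a
  obtain ⟨m', g', hg'⟩ := hd b
  have hself (x) (hx₁ : x ∈ U₁) (hx₂ : x ∈ U₂) : N x x = 1 :=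
    if_pos (ConnIn.refl (show x ∈ U₁ ∩ U₂ from ⟨hx₁, hx₂⟩))
  have haa := hself a h₁.left_mem h₂.left_mem
  have hbb := hself b h₁.right_mem h₂.right_mem
  by_contra! hcon
  obtain ⟨hab, hac, hbc⟩ := hcon
  have hab' : N a b = 0 := if_neg hab
  have hba' : N b a = 0 := if_neg fun h => hab h.symm
  have hac' : N a c = 0 := if_neg hac
  have hbc' : N b c = 0 := if_neg hbc
  -- the combination of the two indicators that has degree zero
  let L (y : {z : ℂ // z ≠ 0}) : ℤ := m' * N a y - m * N b y
  have hL : ∀ y ∈ U₁ ∩ U₂, ∀ᶠ z in 𝓝 y, L z = L y := fun y hy => by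
    filter_upwards [hN a y hy, hN b y hy] with z hz hz'
    simp only [L, hz, hz']
  have hlogL : ∀ y, Complex.exp (m' * g y - m * g' y) =
      Complex.exp ((L y * χ y) * (2 * Real.pi * Complex.I)) := by
    intro y
    have e : ((L y * χ y) * (2 * Real.pi * Complex.I) : ℂ) =
        m' * ((N a y * χ y) * (2 * Real.pi * Complex.I)) -
        m * ((N b y * χ y) * (2 * Real.pi * Complex.I)) := by
      simp only [L]; push_cast; ring
    have hy : (y : ℂ) ≠ 0 := y.2
    rw [e, Complex.exp_sub, Complex.exp_sub, Complex.exp_int_mul, Complex.exp_int_mul,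
      Complex.exp_int_mul, Complex.exp_int_mul, hg, hg', mul_zpow, mul_zpow, ← zpow_mul,
      ← zpow_mul, mul_comm m' m]
    have : (y : ℂ) ^ (m * m') ≠ 0 := zpow_ne_zero _ hy
    field_simp
  have hLc : Continuous fun y => (m' * g y - m * g' y : ℂ) := by fun_prop
  have e1 := eq_of_exp_cutoff_eq hL hχ₁ hχ₂ hLc hlogL h₁ h₂
  have e2 := eq_of_exp_cutoff_eq hL hχ₁ hχ₂ hLc hlogL h₁' h₂'
  -- The values of `L` at `a`, `b`, `c` are $m'$, $-m$ and $0$. Since `L` has a logarithm they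
  -- agree.
  simp only [L, haa, hab', hba', hbb, hac', hbc'] at e1 e2
  have hm' : m' = 0 := by linarith
  -- then the indicator of the component of `b` has a logarithm
  have hlogb : ∀ y, Complex.exp (g' y) =
      Complex.exp ((N b y * χ y) * (2 * Real.pi * Complex.I)) := by
    intro y
    rw [hg', hm', zpow_zero, one_mul]
  have e3 := eq_of_exp_cutoff_eq (hN b) hχ₁ hχ₂ g'.continuous hlogb h₁ h₂
  omega

end MayerVietoris

/-! ### Separation by arcs in the complex plane -/

/-- `A` is a simple arc from `p` to `q`. -/
def IsArc {Y : Type*} [TopologicalSpace Y] (p q : Y) (A : Set Y) : Prop :=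
  ∃ γ : I → Y, Continuous γ ∧ Function.Injective γ ∧ γ 0 = p ∧ γ 1 = q ∧ Set.range γ = A

namespace IsArc

variable {Y : Type*} [TopologicalSpace Y] {p q : Y} {A : Set Y}

lemma isCompact (h : IsArc p q A) : IsCompact A := by
  obtain ⟨γ, hγ, -, -, -, rfl⟩ := h
  exact isCompact_range hγ

lemma left_mem (h : IsArc p q A) : p ∈ A := by
  obtain ⟨γ, hγ, -, rfl, -, rfl⟩ := h
  exact Set.mem_range_self 0

lemma ne (h : IsArc p q A) : p ≠ q := by
  obtain ⟨γ, hγ, hi, rfl, rfl, rfl⟩ := h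
  exact fun h => zero_ne_one (hi h)

lemma symm (h : IsArc p q A) : IsArc q p A := by
  obtain ⟨γ, hγ, hi, rfl, rfl, rfl⟩ := h
  refine ⟨γ ∘ unitInterval.symm, by fun_prop, hi.comp unitInterval.symm_bijective.injective,
    by simp, by simp, ?_⟩
  rw [Set.range_comp, unitInterval.symm_bijective.surjective.range_eq, Set.image_univ]

lemma right_mem (h : IsArc p q A) : q ∈ A := h.symm.left_mem

lemma joinedIn (h : IsArc p q A) : JoinedIn A p q := by
  obtain ⟨γ, hγ, -, rfl, rfl, rfl⟩ := h
  exact ⟨⟨⟨γ, hγ⟩, rfl, rfl⟩, fun t => Set.mem_range_self t⟩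

lemma image {Z : Type*} [TopologicalSpace Z] (h : IsArc p q A) (φ : Y ≃ₜ Z) :
    IsArc (φ p) (φ q) (φ '' A) := by
  obtain ⟨γ, hγ, hi, rfl, rfl, rfl⟩ := h
  exact ⟨φ ∘ γ, φ.continuous.comp hγ, φ.injective.comp hi, rfl, rfl, Set.range_comp _ _⟩

end IsArc

namespace ComplexPlane

open Filter Topology

lemma exists_log (f : C(ℂ, ℂ)) (hf : ∀ y, f y ≠ 0) : ∃ g : C(ℂ, ℂ), ∀ y, Complex.exp (g y) = f y :=
  exists_continuous_log f hf

/-- The inversion of the plane in `p`. -/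
noncomputable def inv (p z : ℂ) : ℂ := p + z⁻¹

lemma inv_inv_sub {p z : ℂ} : inv p (z - p)⁻¹ = z := by simp [inv]

lemma inv_ne {p w : ℂ} (hw : w ≠ 0) : inv p w ≠ p := by simpa [inv] using hw

lemma continuousOn_inv (p : ℂ) : ContinuousOn (inv p) {0}ᶜ := by
  unfold inv
  exact continuousOn_const.add (continuousOn_inv₀)

lemma isOpen_inv_preimage {p : ℂ} {K : Set ℂ} (hK : IsClosed K) :
    IsOpen {w : ℂ | w ≠ 0 ∧ inv p w ∉ K} :=
  (continuousOn_inv p).isOpen_inter_preimage isOpen_compl_singleton hK.isOpen_compl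

/-- The origin stands for the point at infinity. It is an interior point because `e` is bounded and
`inv p` sends small numbers far away. -/
lemma isOpen_insert_inv_preimage {p : ℂ} {e : Set ℂ} (he : IsCompact e) :
    IsOpen {w : ℂ | w = 0 ∨ inv p w ∉ e} := by
  obtain ⟨R, hR0, hR⟩ := he.isBounded.subset_closedBall_lt 0 p
  have : {w : ℂ | w = 0 ∨ inv p w ∉ e} =
      {w : ℂ | w ≠ 0 ∧ inv p w ∉ e} ∪ Metric.ball 0 R⁻¹ := by
    ext w
    simp only [Set.mem_ofPred_eq, Set.mem_union, Metric.mem_ball, dist_zero_right]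
    by_cases hw : w = 0
    · simp [hw, hR0]
    · simp only [hw, false_or, ne_eq, not_false_eq_true, true_and]
      refine ⟨Or.inl, fun h => h.elim id fun h h' => ?_⟩
      have := hR h'
      simp only [Metric.mem_closedBall, inv, dist_eq_norm, add_sub_cancel_left, norm_inv] at this
      have hw' : 0 < ‖w‖ := norm_pos_iff.2 hw
      rw [inv_le_comm₀ hw' hR0] at this
      exact absurd h (not_lt.2 this)
  rw [this]
  exact (isOpen_inv_preimage he.isClosed).union Metric.isOpen_ball

/-- A set that meets another one in at most one point separates no more when added to it. -/
lemma connIn_compl_union {K e : Set ℂ} (hK : IsClosed K) (he : IsCompact e) {p : ℂ}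
    (hp : K ∩ e ⊆ {p}) {a b : ℂ} (h₁ : ConnIn Kᶜ a b) (h₂ : ConnIn eᶜ a b) :
    ConnIn (K ∪ e)ᶜ a b := by
  rw [Set.compl_union]
  by_cases hpK : p ∈ K ∩ e
  · have hne {z : ℂ} (hz : z ∉ K) : z - p ≠ 0 := fun h => hz (sub_eq_zero.1 h ▸ hpK.1)
    have hne' {z : ℂ} (hz : z ∉ e) : z - p ≠ 0 := fun h => hz (sub_eq_zero.1 h ▸ hpK.2)
    have hcK : ContinuousOn (fun z => (z - p)⁻¹) Kᶜ :=
      ContinuousOn.inv₀ (by fun_prop) (fun z hz => hne hz)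
    have hce : ContinuousOn (fun z => (z - p)⁻¹) eᶜ :=
      ContinuousOn.inv₀ (by fun_prop) (fun z hz => hne' hz)
    -- In the coordinate $1/(z-p)$ the only common point of `K` and `e` is at infinity, so the two
    -- open sets cover the plane. The old point at infinity, now the origin, is given to the
    -- complement of `e`.
    have h := ConnIn.inter_of_exists_log exists_log (isOpen_inv_preimage (p := p) hK)
      (isOpen_insert_inv_preimage (p := p) he) ?_
      (h₁.map hcK fun z hz => ⟨inv_ne_zero (hne hz), by rwa [inv_inv_sub]⟩)
      (h₂.map hce fun z hz => Or.inr (by rwa [inv_inv_sub]))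
    · have := h.map (f := inv p) (V := Kᶜ ∩ eᶜ)
        ((continuousOn_inv p).mono fun w hw => hw.1.1)
        fun w hw => ⟨hw.1.2, hw.2.resolve_left hw.1.1⟩
      rwa [inv_inv_sub, inv_inv_sub] at this
    · refine Set.eq_univ_of_forall fun w => ?_
      by_cases hw : w = 0
      · exact Or.inr (Or.inl hw)
      by_cases hw' : inv p w ∈ K
      · exact Or.inr (Or.inr fun h => inv_ne hw (hp ⟨hw', h⟩))
      · exact Or.inl ⟨hw, hw'⟩
  · refine ConnIn.inter_of_exists_log exists_log hK.isOpen_compl he.isClosed.isOpen_compl ?_ h₁ h₂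
    rw [← Set.compl_inter, Set.compl_univ_iff]
    refine Set.eq_empty_of_forall_notMem fun z hz => hpK ?_
    have : z = p := hp hz
    rwa [← this]

lemma isPathConnected_compl_singleton (p : ℂ) : IsPathConnected ({p}ᶜ : Set ℂ) :=
  isPathConnected_compl_singleton_of_one_lt_rank (by simp) p

/-- An arc does not separate the plane. -/
lemma connIn_compl_arc {p q : ℂ} {A : Set ℂ} (hA : IsArc p q A) {a b : ℂ} (ha : a ∉ A)
    (hb : b ∉ A) : ConnIn Aᶜ a b := by
  obtain ⟨γ, hγ, hi, -, -, rfl⟩ := hA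
  -- A path from `a` to `b` that avoids one point of the arc also avoids a short piece of the arc
  -- around that point. By compactness finitely many such pieces make up the arc.
  have hpath : ∀ t : I, JoinedIn {γ t}ᶜ a b := fun t =>
    (isPathConnected_compl_singleton (γ t)).joinedIn a
      (fun h => ha ⟨t, (Set.mem_singleton_iff.1 h).symm⟩)
      b (fun h => hb ⟨t, (Set.mem_singleton_iff.1 h).symm⟩)
  choose c hc using hpath
  obtain ⟨t, t0, tmono, ⟨m, hm⟩, ht⟩ := exists_monotone_Icc_subset_open_cover_unitInterval
    (c := fun i : I => γ ⁻¹' (Set.range (c i))ᶜ)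
    (fun i => (isCompact_range (c i).continuous).isClosed.isOpen_compl.preimage hγ)
    (fun s _ => Set.mem_iUnion.2 ⟨s, fun ⟨r, hr⟩ => hc s r hr⟩)
  -- The pieces are put back one after the other. Each new piece meets the preceding ones in the
  -- single point `γ (t n)`, so `connIn_compl_union` applies.
  have key : ∀ n, ConnIn (γ '' Set.Icc 0 (t n))ᶜ a b := by
    intro n
    induction n with
    | zero =>
      rw [t0, Set.Icc_self, Set.image_singleton]
      exact ConnIn.of_isPreconnected (isPathConnected_compl_singleton _).isConnected.isPreconnected
        (fun h => ha ⟨0, h.symm⟩) (fun h => hb ⟨0, h.symm⟩)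
    | succ n ih =>
      obtain ⟨i, hi'⟩ := ht n
      have hU : Set.Icc 0 (t (n + 1)) = Set.Icc 0 (t n) ∪ Set.Icc (t n) (t (n + 1)) :=
        (Set.Icc_union_Icc_eq_Icc (t0 ▸ tmono (Nat.zero_le n)) (tmono n.le_succ)).symm
      rw [hU, Set.image_union]
      refine connIn_compl_union (isCompact_Icc.image hγ).isClosed (isCompact_Icc.image hγ)
        (p := γ (t n)) ?_ ih ?_
      · rw [← Set.image_inter hi]
        rintro _ ⟨s, ⟨h1, h2⟩, rfl⟩
        rw [le_antisymm h1.2 h2.1]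
        rfl
      · refine ⟨Set.range (c i), ?_, isPreconnected_range (c i).continuous,
          ⟨0, (c i).source⟩, ⟨1, (c i).target⟩⟩
        rintro _ ⟨r, rfl⟩ ⟨s, hs, hs'⟩
        exact hi' hs ⟨r, hs'.symm⟩
  have := key m
  rw [hm m le_rfl] at this
  convert this using 2
  rw [← Set.image_univ]
  congr 1
  ext s
  simp [unitInterval.le_one']

/-- An arc attached to a closed set at its endpoints divides a component of the complement into at
most two pieces. -/
lemma connIn_compl_union_arc_of_three {K e : Set ℂ} (hK : IsClosed K) {p q : ℂ} (he : IsArc p q e)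
    (hKe : K ∩ e ⊆ {p, q}) {a b c : ℂ} (ha : a ∉ e) (hb : b ∉ e) (hc : c ∉ e)
    (hab : ConnIn Kᶜ a b) (hac : ConnIn Kᶜ a c) :
    ConnIn (K ∪ e)ᶜ a b ∨ ConnIn (K ∪ e)ᶜ a c ∨ ConnIn (K ∪ e)ᶜ b c := by
  by_cases hp : p ∈ K
  swap
  · left
    refine connIn_compl_union hK he.isCompact (p := q) ?_ hab (connIn_compl_arc he ha hb)
    exact fun z hz => (hKe hz).resolve_left fun h => hp (h ▸ hz.1)
  by_cases hq : q ∈ K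
  swap
  · left
    refine connIn_compl_union hK he.isCompact (p := p) ?_ hab (connIn_compl_arc he ha hb)
    exact fun z hz => (hKe hz).resolve_right fun h => hq (h ▸ hz.1)
  have hpq : p ≠ q := he.ne
  -- move `q` to infinity and `p` to the origin
  let d : ℂ := (p - q)⁻¹
  have hd : inv q d = p := inv_inv_sub
  have hd0 : d ≠ 0 := inv_ne_zero (sub_ne_zero.2 hpq)
  let P := {z : ℂ // z ≠ 0}
  let F : P → ℂ := fun w => (w : ℂ) + d
  have hF : Continuous F := by fun_prop
  have hFd : ∀ w, F w ≠ d := fun w h => w.2 (by simpa [F] using h)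
  let U₁ : Set P := F ⁻¹' {w : ℂ | w ≠ 0 ∧ inv q w ∉ K}
  let U₂ : Set P := F ⁻¹' {w : ℂ | w = 0 ∨ inv q w ∉ e}
  have o₁ : IsOpen U₁ := (isOpen_inv_preimage hK).preimage hF
  have o₂ : IsOpen U₂ := (isOpen_insert_inv_preimage he.isCompact).preimage hF
  have hinj : ∀ w ≠ 0, inv q w = p → w = d := by
    intro w hw h
    rw [← hd] at h
    exact inv_injective (add_left_cancel h)
  -- The points `p` and `q`, the only ones where `K` and `e` can meet, have left the space. The zero
  -- of `F` is the old point at infinity and belongs to `U₂`.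
  have hU : U₁ ∪ U₂ = Set.univ := by
    refine Set.eq_univ_of_forall fun w => ?_
    by_cases hw : F w = 0
    · exact Or.inr (Or.inl hw)
    by_cases hw' : inv q (F w) ∈ K
    · refine Or.inr (Or.inr fun h => ?_)
      rcases hKe ⟨hw', h⟩ with h' | h'
      · exact hFd w (hinj _ hw h')
      · exact inv_ne hw h'
    · exact Or.inl ⟨hw, hw'⟩
  have hne {z : ℂ} (hzp : z ≠ p) : (z - q)⁻¹ - d ≠ 0 := fun h =>
    hzp (by simpa [d] using inv_injective (sub_eq_zero.1 h))
  -- The value at `p` is arbitrary; `p` lies in both `K` and `e`, and the map is used only on their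
  -- complements.
  let Gm : ℂ → P := fun z => if h : z ≠ p then ⟨(z - q)⁻¹ - d, hne h⟩ else ⟨1, one_ne_zero⟩
  have hG {z : ℂ} (hzp : z ≠ p) : F (Gm z) = (z - q)⁻¹ := by
    simp [F, Gm, hzp]
  have hGc : ContinuousOn Gm {p, q}ᶜ := by
    rw [continuousOn_iff_continuous_domRestrict, continuous_induced_rng]
    have : (Subtype.val ∘ Set.domRestrict ({p, q}ᶜ : Set ℂ) Gm) =
        fun z : ({p, q}ᶜ : Set ℂ) => ((z : ℂ) - q)⁻¹ - d := by
      funext z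
      have : (z : ℂ) ≠ p := fun h => z.2 (Or.inl h)
      exact congrArg Subtype.val (dif_pos this)
    rw [this]
    refine Continuous.sub (Continuous.inv₀ (by fun_prop) fun z => ?_) continuous_const
    exact sub_ne_zero.2 fun h => z.2 (Or.inr h)
  have hpK' : ∀ {z : ℂ}, z ∉ K → z ≠ p ∧ z ≠ q :=
    fun hz => ⟨fun h => hz (h ▸ hp), fun h => hz (h ▸ hq)⟩
  have hpe' : ∀ {z : ℂ}, z ∉ e → z ≠ p ∧ z ≠ q :=
    fun hz => ⟨fun h => hz (h ▸ he.left_mem), fun h => hz (h ▸ he.right_mem)⟩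
  have m₁ : Set.MapsTo Gm Kᶜ U₁ := fun z hz => by
    obtain ⟨h1, h2⟩ := hpK' hz
    simp only [U₁, Set.mem_preimage, hG h1, Set.mem_ofPred_eq, inv_inv_sub]
    exact ⟨inv_ne_zero (sub_ne_zero.2 h2), hz⟩
  have m₂ : Set.MapsTo Gm eᶜ U₂ := fun z hz => by
    obtain ⟨h1, h2⟩ := hpe' hz
    simp only [U₂, Set.mem_preimage, hG h1, Set.mem_ofPred_eq, inv_inv_sub]
    exact Or.inr hz
  have c₁ : ContinuousOn Gm Kᶜ := hGc.mono fun z hz h => by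
    rcases h with h | h
    exacts [(hpK' hz).1 h, (hpK' hz).2 h]
  have c₂ : ContinuousOn Gm eᶜ := hGc.mono fun z hz h => by
    rcases h with h | h
    exacts [(hpe' hz).1 h, (hpe' hz).2 h]
  have back {x y : ℂ} (hx : x ∉ K) (hy : y ∉ K) (h : ConnIn (U₁ ∩ U₂) (Gm x) (Gm y)) :
      ConnIn (K ∪ e)ᶜ x y := by
    have := h.map (f := fun w => inv q (F w)) (V := (K ∪ e)ᶜ)
      ((continuousOn_inv q).comp hF.continuousOn fun w hw => hw.1.1)
      (fun w hw => by
        rw [Set.compl_union]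
        exact ⟨hw.1.2, hw.2.resolve_left hw.1.1⟩)
    simpa only [hG (hpK' hx).1, hG (hpK' hy).1, inv_inv_sub] using this
  have ha' := hab.left_mem
  have hb' := hab.right_mem
  have hc' := hac.right_mem
  rcases ConnIn.inter_of_punctured o₁ o₂ hU (hab.map c₁ m₁)
    ((connIn_compl_arc he ha hb).map c₂ m₂) (hac.map c₁ m₁)
    ((connIn_compl_arc he ha hc).map c₂ m₂) with h | h | h
  · exact Or.inl (back ha' hb' h)
  · exact Or.inr (Or.inl (back ha' hc' h))
  · exact Or.inr (Or.inr (back hb' hc' h))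

end ComplexPlane

/-! ### Surfaces homeomorphic to the plane -/

open Filter Topology

/-- A space homeomorphic to the plane. -/
class IsPlane (X : Type*) [TopologicalSpace X] : Prop where
  nonempty_homeomorph : Nonempty (X ≃ₜ ℂ)

section Component

variable {Y : Type*} [TopologicalSpace Y] [LocallyConnectedSpace Y] {U C : Set Y} {x y : Y}

lemma closure_component_inter_subset (hU : IsOpen U) :
    closure (connectedComponentIn U x) ∩ U ⊆ connectedComponentIn U x := by
  rintro z ⟨hz, hzU⟩
  have h1 : connectedComponentIn U z ∈ 𝓝 z :=
    hU.connectedComponentIn.mem_nhds (mem_connectedComponentIn hzU)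
  obtain ⟨w, hw, hw'⟩ := mem_closure_iff_nhds.1 hz _ h1
  rw [connectedComponentIn_eq hw', ← connectedComponentIn_eq hw]
  exact mem_connectedComponentIn hzU

/-- A component of an open set is relatively closed in that set, so a connected set can leave it
only through a limit point of the component outside the open set. -/
lemma exists_mem_closure_component (hU : IsOpen U) (hC : IsPreconnected C)
    (hy : y ∈ C) (hyx : y ∈ connectedComponentIn U x) (hCx : ¬ C ⊆ connectedComponentIn U x) :
    ∃ z ∈ C, z ∈ closure (connectedComponentIn U x) ∧ z ∉ U := by
  by_contra! h
  refine hCx (hC.subset_of_closure_inter_subset hU.connectedComponentIn ⟨y, hy, hyx⟩ ?_)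
  rintro z ⟨hz, hzC⟩
  exact closure_component_inter_subset hU ⟨hz, h z hzC hz⟩

end Component

namespace IsPlane

variable {X : Type*} [TopologicalSpace X] [IsPlane X]

instance : LocallyConnectedSpace X :=
  (nonempty_homeomorph (X := X)).some.isOpenEmbedding.locallyConnectedSpace

instance : T2Space X := (nonempty_homeomorph (X := X)).some.isEmbedding.t2Space

lemma connIn_iff_of_homeomorph {Y Z : Type*} [TopologicalSpace Y] [TopologicalSpace Z] (φ : Y ≃ₜ Z)
    {U : Set Y} {a b : Y} : ConnIn (φ '' U) (φ a) (φ b) ↔ ConnIn U a b := by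
  constructor
  · intro h
    simpa using h.map φ.symm.continuous.continuousOn (V := U) (by rintro _ ⟨z, hz, rfl⟩; simpa)
  · intro h
    exact h.map φ.continuous.continuousOn (Set.mapsTo_image φ U)

/-- Small discs. -/
lemma exists_disc {x : X} {N : Set X} (hN : N ∈ 𝓝 x) :
    ∃ B ⊆ N, IsOpen B ∧ x ∈ B ∧ IsPreconnected B ∧ ∀ y, IsPreconnected (B \ {y}) := by
  obtain ⟨φ⟩ := nonempty_homeomorph (X := X)
  have h1 : φ '' N ∈ 𝓝 (φ x) := φ.isOpenMap.image_mem_nhds hN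
  obtain ⟨r, hr, hrN⟩ := Metric.mem_nhds_iff.1 h1
  -- The disc is parametrised by the whole plane, so that a disc minus a point is the image of a
  -- punctured plane.
  let u := OpenPartialHomeomorph.univBall (φ x) r
  have hu : u.target = Metric.ball (φ x) r := OpenPartialHomeomorph.univBall_target _ hr
  have hs : u.source = Set.univ := OpenPartialHomeomorph.univBall_source _ _
  let ψ : ℂ → X := fun z => φ.symm (u z)
  have hψ : Continuous ψ := φ.symm.continuous.comp
    (OpenPartialHomeomorph.continuous_univBall (φ x) r)
  have himg : φ.symm '' Metric.ball (φ x) r = Set.range ψ := by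
    rw [← hu, ← u.image_source_eq_target, hs, Set.image_univ, ← Set.range_comp]; rfl
  have hinj : Function.Injective ψ := φ.symm.injective.comp
    (Set.injOn_univ.1 (hs ▸ u.injOn))
  refine ⟨φ.symm '' Metric.ball (φ x) r, ?_, φ.symm.isOpenMap _ Metric.isOpen_ball,
    ⟨φ x, Metric.mem_ball_self hr, by simp⟩, ?_, fun y => ?_⟩
  · rintro _ ⟨z, hz, rfl⟩
    obtain ⟨w, hw, rfl⟩ := hrN hz
    simpa using hw
  · rw [himg]; exact isPreconnected_range hψ
  · rw [himg]
    by_cases hy : y ∈ Set.range ψ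
    · obtain ⟨z, rfl⟩ := hy
      have : Set.range ψ \ {ψ z} = ψ '' {z}ᶜ := by
        rw [Set.image_compl_eq_range_sdiff_image hinj, Set.image_singleton]
      rw [this]
      exact (ComplexPlane.isPathConnected_compl_singleton z).isConnected.isPreconnected.image _
        hψ.continuousOn
    · rw [Set.sdiff_singleton_eq_self hy]
      exact isPreconnected_range hψ

instance (x : X) : NeBot (𝓝[≠] x) := by
  obtain ⟨φ⟩ := nonempty_homeomorph (X := X)
  rw [← mem_closure_iff_nhdsWithin_neBot, ← φ.injective.mem_set_image,
    φ.image_closure, Set.image_compl_eq φ.bijective, Set.image_singleton,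
    (dense_compl_singleton (φ x)).closure_eq]
  exact Set.mem_univ _

/-- Removing a discrete closed set does not disconnect an open set. -/
lemma isPreconnected_diff {O S : Set X} (hO : IsOpen O) (hOc : IsPreconnected O)
    (hS : ∀ x, ∀ᶠ y in 𝓝[≠] x, y ∉ S) : IsPreconnected (O \ S) := by
  have hne : ∀ x, NeBot (𝓝[Sᶜ] x) := fun x => by
    have : 𝓝[≠] x ≤ 𝓝[Sᶜ] x := le_inf (nhdsWithin_le_nhds) (le_principal_iff.2 (hS x))
    exact NeBot.mono inferInstance this
  -- The relation speaks of points off `S` near `x` and `y`, so that a chain inside `O` may pass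
  -- through points of `S`.
  let P : X → X → Prop := fun x y => ∀ᶠ x' in 𝓝[Sᶜ] x, ∀ᶠ y' in 𝓝[Sᶜ] y, ConnIn (O \ S) x' y'
  have hdisc : ∀ x ∈ O, ∃ B : Set X, IsOpen B ∧ x ∈ B ∧
      ∀ y ∈ B \ S, ∀ z ∈ B \ S, ConnIn (O \ S) y z := by
    intro x hx
    have h1 : insert x Sᶜ ∈ 𝓝 x := insert_mem_nhds_iff.2 (hS x)
    obtain ⟨B, hBN, hBo, hxB, hBc, hBc'⟩ := exists_disc (inter_mem h1 (hO.mem_nhds hx))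
    refine ⟨B, hBo, hxB, fun y hy z hz => ?_⟩
    have hBS : B \ S ⊆ O \ S := fun w hw => ⟨(hBN hw.1).2, hw.2⟩
    refine ⟨B \ S, hBS, ?_, hy, hz⟩
    by_cases hxS : x ∈ S
    · convert hBc' x using 1
      ext w
      refine ⟨fun h => ⟨h.1, fun h' => h.2 (h' ▸ hxS)⟩, fun h => ⟨h.1, ?_⟩⟩
      exact (hBN h.1).1.resolve_left h.2
    · convert hBc using 1
      rw [sdiff_eq_left, Set.disjoint_left]
      intro w hw hwS
      rcases (hBN hw).1 with rfl | h
      exacts [hxS hwS, h hwS]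
  have key : ∀ x ∈ O \ S, ∀ y ∈ O \ S, ConnIn (O \ S) x y := by
    intro x hx y hy
    have : P x y := by
      refine hOc.induction₂' P (fun x hx => ?_) ?_ hx.1 hy.1
      · obtain ⟨B, hBo, hxB, hB⟩ := hdisc x hx
        filter_upwards [mem_nhdsWithin_of_mem_nhds (hBo.mem_nhds hxB)] with y hy
        have ex : ∀ᶠ x' in 𝓝[Sᶜ] x, x' ∈ B \ S := by
          filter_upwards [mem_nhdsWithin_of_mem_nhds (hBo.mem_nhds hxB), self_mem_nhdsWithin]
            with z h1 h2 using ⟨h1, h2⟩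
        have ey : ∀ᶠ x' in 𝓝[Sᶜ] y, x' ∈ B \ S := by
          filter_upwards [mem_nhdsWithin_of_mem_nhds (hBo.mem_nhds hy), self_mem_nhdsWithin]
            with z h1 h2 using ⟨h1, h2⟩
        exact ⟨ex.mono fun x' hx' => ey.mono fun y' hy' => hB _ hx' _ hy',
          ey.mono fun x' hx' => ex.mono fun y' hy' => hB _ hx' _ hy'⟩
      · intro x y z _ _ _ hxy hyz
        filter_upwards [hxy] with x' hx'
        obtain ⟨y', h1, h2⟩ := (hx'.and hyz).exists
        exact h2.mono fun z' hz' => h1.trans hz'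
    exact (this.self_of_nhdsWithin hx.2).self_of_nhdsWithin hy.2
  exact isPreconnected_of_forall_pair fun x hx y hy => by
    obtain ⟨C, hC, hc, h1, h2⟩ := key x hx y hy
    exact ⟨C, hC, h1, h2, hc⟩

/-- Removing a point disconnects an interval but not a disc. If a disc lay in the arc, its preimage
minus a parameter `t` would be order-connected, with points on both sides of `t`. -/
lemma interior_arc {p q : X} {e : Set X} (he : IsArc p q e) : interior e = ∅ := by
  obtain ⟨γ, hγ, hi, -, -, rfl⟩ := he
  by_contra hne
  obtain ⟨x, hx⟩ := Set.nonempty_iff_ne_empty.2 hne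
  obtain ⟨B, hB, hBo, hxB, hBc, hBc'⟩ := exists_disc (isOpen_interior.mem_nhds hx)
  have hemb : IsEmbedding γ := (hγ.isClosedEmbedding hi).isEmbedding
  have hBr : B ⊆ Set.range γ := hB.trans interior_subset
  have hJo : IsOpen (γ ⁻¹' B) := hBo.preimage hγ
  obtain ⟨t₀, rfl⟩ := hBr hxB
  have hd : Dense (Set.Ioo (0 : I) 1) := by
    rw [dense_iff_closure_eq, closure_Ioo zero_ne_one]
    exact Set.Icc_bot_top
  obtain ⟨t, htJ, ht0, ht1⟩ := hd.inter_open_nonempty _ hJo ⟨t₀, hxB⟩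
  obtain ⟨l, hl, hlt⟩ := exists_Ioc_subset_of_mem_nhds (hJo.mem_nhds htJ) ⟨0, ht0⟩
  obtain ⟨u, hu, htu⟩ := exists_Ico_subset_of_mem_nhds (hJo.mem_nhds htJ) ⟨1, ht1⟩
  obtain ⟨s, hs, hst⟩ := exists_between hl
  obtain ⟨r, hr, hru⟩ := exists_between hu
  have hpre : IsPreconnected (γ ⁻¹' (B \ {γ t})) := by
    rw [← hemb.isInducing.isPreconnected_image, Set.image_preimage_eq_of_subset
      (Set.sdiff_subset.trans hBr)]
    exact hBc' _
  have hmem : t ∈ γ ⁻¹' (B \ {γ t}) := hpre.ordConnected.out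
    (show s ∈ _ from ⟨hlt ⟨hs, hst.le⟩, fun h => hst.ne (hi h)⟩)
    (show r ∈ _ from ⟨htu ⟨hr.le, hru⟩, fun h => hr.ne (hi h).symm⟩) ⟨hst.le, hr.le⟩
  exact hmem.2 rfl

lemma connIn_compl_union {K e : Set X} (hK : IsClosed K) (he : IsCompact e) {p : X}
    (hp : K ∩ e ⊆ {p}) {a b : X} (h₁ : ConnIn Kᶜ a b) (h₂ : ConnIn eᶜ a b) :
    ConnIn (K ∪ e)ᶜ a b := by
  obtain ⟨φ⟩ := nonempty_homeomorph (X := X)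
  rw [← connIn_iff_of_homeomorph φ, Set.image_compl_eq φ.bijective] at h₁ h₂ ⊢
  rw [Set.image_union]
  refine ComplexPlane.connIn_compl_union (φ.isClosedMap _ hK) (he.image φ.continuous) (p := φ p)
    ?_ h₁ h₂
  rw [← Set.image_inter φ.injective, ← Set.image_singleton]
  exact Set.image_mono hp

lemma connIn_compl_arc {p q : X} {A : Set X} (hA : IsArc p q A) {a b : X} (ha : a ∉ A)
    (hb : b ∉ A) : ConnIn Aᶜ a b := by
  obtain ⟨φ⟩ := nonempty_homeomorph (X := X)
  rw [← connIn_iff_of_homeomorph φ, Set.image_compl_eq φ.bijective]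
  exact ComplexPlane.connIn_compl_arc (hA.image φ) (by simpa using ha) (by simpa using hb)

lemma connIn_compl_union_arc_of_three {K e : Set X} (hK : IsClosed K) {p q : X} (he : IsArc p q e)
    (hKe : K ∩ e ⊆ {p, q}) {a b c : X} (ha : a ∉ e) (hb : b ∉ e) (hc : c ∉ e)
    (hab : ConnIn Kᶜ a b) (hac : ConnIn Kᶜ a c) :
    ConnIn (K ∪ e)ᶜ a b ∨ ConnIn (K ∪ e)ᶜ a c ∨ ConnIn (K ∪ e)ᶜ b c := by
  obtain ⟨φ⟩ := nonempty_homeomorph (X := X)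
  simp only [← connIn_iff_of_homeomorph φ, Set.image_compl_eq φ.bijective] at hab hac ⊢
  simp only [Set.image_union]
  refine ComplexPlane.connIn_compl_union_arc_of_three (φ.isClosedMap _ hK) (he.image φ)
    ?_ (by simpa using ha) (by simpa using hb) (by simpa using hc) hab hac
  rw [← Set.image_inter φ.injective, ← Set.image_pair]
  exact Set.image_mono hKe

end IsPlane

/-! ### Components of the complement along an arc -/

section

open Filter Topology

namespace IsPlane

variable {X : Type*} [TopologicalSpace X] [IsPlane X]

/-- The boundary of a component of the complement contains, with an interior point of an arc, the
part of the arc that follows. -/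
lemma mem_closure_component_of_le {K : Set X} (hK : IsClosed K) {γ : I → X} (hγ : Continuous γ)
    (hi : Function.Injective γ) (hKγ : K ∩ Set.range γ ⊆ {γ 0, γ 1}) {w : X} {s : I} (hs0 : s ≠ 0)
    (hs : γ s ∈ closure (connectedComponentIn (K ∪ Set.range γ)ᶜ w)) {r : I}
    (hr : s ≤ r) : γ r ∈ closure (connectedComponentIn (K ∪ Set.range γ)ᶜ w) := by
  set W := connectedComponentIn (K ∪ Set.range γ)ᶜ w with hW
  have harc : IsArc (γ 0) (γ 1) (Set.range γ) := ⟨γ, hγ, hi, rfl, rfl, rfl⟩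
  have hUo : IsOpen (K ∪ Set.range γ)ᶜ := (hK.union (isCompact_range hγ).isClosed).isOpen_compl
  by_contra hrW
  have hcl : IsClosed {t : I | γ t ∈ closure W} := isClosed_closure.preimage hγ
  -- `s₀` is the last parameter in `[s, r]` at which the arc is in the closure of the component; the
  -- aim is to go past it.
  obtain ⟨s₀, ⟨⟨hss₀, hs₀r⟩, hs₀W⟩, hmax⟩ :=
    (isCompact_Icc.inter_right hcl : IsCompact (Set.Icc s r ∩ _)).exists_isGreatest
      ⟨s, ⟨le_rfl, hr⟩, hs⟩
  have hlt : s₀ < r := hs₀r.lt_of_ne fun h => hrW (h ▸ hs₀W)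
  obtain ⟨s₁, h01, h1r⟩ := exists_between hlt
  have hs₀0 : 0 < s₀ := (unitInterval.pos_iff_ne_zero.2 hs0).trans_le hss₀
  have hs₀1 : s₀ < 1 := hlt.trans_le unitInterval.le_one'
  have hafter : ∀ t, s₀ < t → t ≤ r → γ t ∉ closure W := fun t h1 h2 h3 =>
    not_lt.2 (hmax ⟨⟨hss₀.trans h1.le, h2⟩, h3⟩) h1
  -- The part of the arc between `s₁` and `r` is deleted. The two remaining parts can then meet only
  -- at `γ 0`, and nothing in the closure of `W` has been deleted.
  set K₁ := K ∪ γ '' Set.Icc r 1 with hK₁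
  have hK₁c : IsClosed K₁ := hK.union (isCompact_Icc.image hγ).isClosed
  set e₁ := γ '' Set.Icc 0 s₁ with he₁
  have he₁c : IsCompact e₁ := isCompact_Icc.image hγ
  have hnotK : γ s₀ ∉ K₁ := by
    rintro (h | ⟨t, ht, hts⟩)
    · rcases hKγ ⟨h, ⟨s₀, rfl⟩⟩ with h' | h'
      exacts [hs₀0.ne' (hi h'), hs₀1.ne (hi h')]
    · have := hi hts
      exact absurd (this ▸ ht.1) (not_le.2 hlt)
  obtain ⟨B, hBK, hBo, hB, hBc, -⟩ := exists_disc (hK₁c.isOpen_compl.mem_nhds hnotK)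
  obtain ⟨a, haB, haW⟩ := mem_closure_iff_nhds.1 hs₀W _ (hBo.mem_nhds hB)
  have haU : a ∈ (K ∪ Set.range γ)ᶜ := connectedComponentIn_subset _ _ haW
  -- Points of the disc off the arc are connected to `a` in the complement of the two parts. A
  -- connecting set that left `W` would meet its closure in the deleted part, which is impossible.
  have hBW : ∀ b ∈ B, b ∉ Set.range γ → b ∈ W := by
    intro b hbB hb
    have h1 : ConnIn K₁ᶜ a b := ⟨B, hBK, hBc, haB, hbB⟩
    have h2 : ConnIn e₁ᶜ a b :=
      (connIn_compl_arc harc (fun h => haU (Or.inr h)) hb).mono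
        (Set.compl_subset_compl.2 (Set.image_subset_range _ _))
    have h3 : K₁ ∩ e₁ ⊆ {γ 0} := by
      rintro _ ⟨h | ⟨t, ht, hts⟩, ⟨u, hu, rfl⟩⟩
      · rcases hKγ ⟨h, ⟨u, rfl⟩⟩ with h' | h'
        · exact h'
        · rw [hi h'] at hu
          exact absurd hu.2 (not_le.2 (h1r.trans_le unitInterval.le_one'))
      · rw [hi hts] at ht
        exact absurd (ht.1.trans hu.2) (not_le.2 h1r)
    obtain ⟨C, hC, hCc, haC, hbC⟩ := connIn_compl_union hK₁c he₁c h3 h1 h2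
    by_contra hbW
    obtain ⟨z, hzC, hzW, hzU⟩ := exists_mem_closure_component hUo hCc haC haW
      (fun h => hbW (h hbC))
    rw [Set.notMem_compl_iff] at hzU
    have hz := hC hzC
    rcases hzU with h | ⟨t, rfl⟩
    · exact hz (Or.inl (Or.inl h))
    · rcases le_or_gt t s₁ with ht | ht
      · exact hz (Or.inr ⟨t, ⟨unitInterval.nonneg', ht⟩, rfl⟩)
      · rcases le_or_gt r t with ht' | ht'
        · exact hz (Or.inl (Or.inr ⟨t, ⟨ht', unitInterval.le_one'⟩, rfl⟩))
        · exact hafter t (h01.trans ht) ht'.le hzW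
  have hBcl : B ⊆ closure W := by
    have hd : Dense (Set.range γ)ᶜ := interior_eq_empty_iff_dense_compl.1 (interior_arc harc)
    exact (hd.open_subset_closure_inter hBo).trans
      (closure_mono fun b hb => hBW b hb.1 hb.2)
  obtain ⟨u, hu, hsub⟩ := exists_Ico_subset_of_mem_nhds
    ((hBo.preimage hγ).mem_nhds (show s₀ ∈ γ ⁻¹' B from hB)) ⟨r, hlt⟩
  obtain ⟨t, ht1, ht2⟩ := exists_between (lt_min hu hlt)
  exact hafter t ht1 (ht2.le.trans (min_le_right _ _))
    (hBcl (hsub ⟨ht1.le, ht2.trans_le (min_le_left _ _)⟩))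

/-- If the closure of a component of the complement meets the interior of an arc of the boundary,
then it contains the arc. -/
lemma arc_subset_closure_component {K e : Set X} (hK : IsClosed K) {p q : X} (he : IsArc p q e)
    (hKe : K ∩ e ⊆ {p, q}) {w x : X} (hx : x ∈ e) (hxp : x ≠ p) (hxq : x ≠ q)
    (hcl : x ∈ closure (connectedComponentIn (K ∪ e)ᶜ w)) :
    e ⊆ closure (connectedComponentIn (K ∪ e)ᶜ w) := by
  obtain ⟨γ, hγ, hi, rfl, rfl, rfl⟩ := he
  obtain ⟨s, rfl⟩ := hx
  have hs0 : s ≠ 0 := fun h => hxp (h ▸ rfl)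
  have hs1 : s ≠ 1 := fun h => hxq (h ▸ rfl)
  rintro _ ⟨r, rfl⟩
  rcases le_total s r with h | h
  · exact mem_closure_component_of_le hK hγ hi hKe hs0 hcl h
  · have hrange : Set.range (γ ∘ unitInterval.symm) = Set.range γ := by
      rw [Set.range_comp, unitInterval.symm_bijective.surjective.range_eq, Set.image_univ]
    have := mem_closure_component_of_le hK (γ := γ ∘ unitInterval.symm) (by fun_prop)
      (hi.comp unitInterval.symm_bijective.injective)
      (by rw [hrange]; simpa [Set.pair_comm] using hKe)
      (w := w) (s := unitInterval.symm s) (r := unitInterval.symm r)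
      (fun h => hs1 (by simpa using congrArg unitInterval.symm h))
      (by simpa [hrange] using hcl)
      (unitInterval.strictAnti_symm.antitone h)
    simpa [hrange] using this

end IsPlane

namespace ComplexPlane

open Complex in
/-- If `p` and `q` are joined in a set, then there is a logarithm of `(z - q) / (z - p)` on the
complement of the set. -/
lemma exists_log_compl_of_joinedIn {S : Set ℂ} {p q : ℂ} (h : JoinedIn S p q) :
    ∃ f : ℂ → ℂ, ContinuousOn f Sᶜ ∧ ∀ z ∈ Sᶜ, exp (f z) = (z - q) / (z - p) := by
  obtain ⟨γ, hγ⟩ := h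
  have hne (t : I) (z : (Sᶜ : Set ℂ)) : (z : ℂ) - γ t ≠ 0 := fun h =>
    z.2 (sub_eq_zero.1 h ▸ hγ t)
  -- The homotopy $(z-\gamma(t))/(z-\gamma(0))$ starts at the constant 1, whose logarithm 0 is
  -- lifted along it.
  let H : C(I × (Sᶜ : Set ℂ), {z : ℂ // z ≠ 0}) :=
    ⟨fun x => ⟨(x.2 - γ x.1) / (x.2 - γ 0), div_ne_zero (hne _ _) (hne _ _)⟩, by
      refine Continuous.subtype_mk (Continuous.div (by fun_prop) (by fun_prop) ?_) _
      exact fun x => hne 0 x.2⟩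
  have H0 : ∀ a, H (0, a) = ⟨exp ((ContinuousMap.const _ 0 : C((Sᶜ : Set ℂ), ℂ)) a),
      exp_ne_zero _⟩ := fun a => Subtype.ext (by simp [H, div_self (by simpa using hne 0 a)])
  let L := isCoveringMap_exp.liftHomotopy H (ContinuousMap.const _ 0) H0
  have hL := isCoveringMap_exp.liftHomotopy_lifts H (ContinuousMap.const _ 0) H0
  classical
  refine ⟨fun z => if hz : z ∈ Sᶜ then L (1, ⟨z, hz⟩) else 0, ?_, fun z hz => ?_⟩
  · rw [continuousOn_iff_continuous_domRestrict]
    have : (Sᶜ : Set ℂ).domRestrict (fun z => if hz : z ∈ Sᶜ then L (1, ⟨z, hz⟩) else 0) =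
        fun z => L (1, z) := by
      funext z
      exact dif_pos z.2
    rw [this]
    fun_prop
  · simp only [dif_pos hz]
    have := congrArg Subtype.val (congr_fun hL (1, ⟨z, hz⟩))
    exact this.trans (by simp [H])

-- The function winds once, in the negative sense, around a circle about `p` that does not enclose
-- `q`. The radius is half the distance, so that $(z-q)/(p-q)$ stays in the slit plane.
open Complex in
lemma not_exists_log_punctured {p q : ℂ} (hpq : p ≠ q) {f : ℂ → ℂ}
    (hf : ContinuousOn f {p, q}ᶜ) (h : ∀ z ∈ ({p, q}ᶜ : Set ℂ), exp (f z) = (z - q) / (z - p)) :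
    False := by
  have hr : 0 < ‖p - q‖ := norm_pos_iff.2 (sub_ne_zero.2 hpq)
  set r : ℝ := ‖p - q‖ / 2 with hrdef
  have hr0 : 0 < r := by positivity
  have hrC : (r : ℂ) ≠ 0 := by exact_mod_cast hr0.ne'
  let c : ℝ → ℂ := fun t => p + r * exp (t * Complex.I)
  have hc : Continuous c := by fun_prop
  have hcp : ∀ t, c t - p = r * exp (t * Complex.I) := fun t => by simp [c]
  have hnorm : ∀ t, ‖c t - p‖ = r := fun t => by
    rw [hcp, norm_mul, norm_exp_ofReal_mul_I, mul_one, norm_real, Real.norm_of_nonneg hr0.le]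
  have hsl : ∀ t, (c t - q) / (p - q) ∈ slitPlane := fun t => by
    have : (c t - q) / (p - q) = 1 + (c t - p) / (p - q) := by
      have := sub_ne_zero.2 hpq
      field_simp; ring
    rw [this]
    refine mem_slitPlane_of_norm_lt_one ?_
    rw [norm_div, hnorm, hrdef, div_lt_one hr]
    linarith
  have hmem : ∀ t, c t ∈ ({p, q}ᶜ : Set ℂ) := by
    rintro t (h' | h')
    · have := hnorm t
      rw [h', sub_self, norm_zero] at this
      exact hr0.ne this
    · have := hsl t
      rw [h', sub_self, zero_div] at this
      exact slitPlane_ne_zero this rfl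
  have hpi : (2 * Real.pi * Complex.I : ℂ) ≠ 0 := two_pi_I_ne_zero
  -- The exponential of `φ` is constant, so `φ` is constant. Yet after one turn the first two terms
  -- return and the last has changed by $2\pi i$.
  let φ : ℝ → ℂ := fun t => log ((c t - q) / (p - q)) - f (c t) - t * Complex.I
  have hφ : Continuous φ := by
    have h1 : Continuous fun t : ℝ => log ((c t - q) / (p - q)) :=
      Continuous.clog (by fun_prop) hsl
    have h2 : Continuous fun t : ℝ => f (c t) := hf.comp_continuous hc hmem
    show Continuous fun t : ℝ => log ((c t - q) / (p - q)) - f (c t) - t * Complex.I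
    have h3 : Continuous fun t : ℝ => (t : ℂ) * Complex.I := by fun_prop
    exact (h1.sub h2).sub h3
  have hexp : ∀ t, exp (φ t) = r / (p - q) := by
    intro t
    have h1 : c t - q ≠ 0 := fun h' => hmem t (Or.inr (sub_eq_zero.1 h'))
    have h2 : p - q ≠ 0 := sub_ne_zero.2 hpq
    have h3 : exp (t * Complex.I) ≠ 0 := exp_ne_zero _
    simp only [φ, exp_sub]
    rw [exp_log (slitPlane_ne_zero (hsl t)), h _ (hmem t), hcp]
    field_simp
  have := isPreconnected_univ.int_valued_eq
    (f := fun t => (φ t - φ 0) / (2 * Real.pi * Complex.I)) (by fun_prop) (fun t _ => by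
      obtain ⟨n, hn⟩ := exp_eq_exp_iff_exists_int.1 ((hexp t).trans (hexp 0).symm)
      exact ⟨n, by rw [hn]; field_simp; ring⟩) (Set.mem_univ (2 * Real.pi)) (Set.mem_univ 0)
  have hcper : c (2 * Real.pi) = c 0 := by
    simp only [c]
    push_cast
    rw [exp_two_pi_mul_I]
    simp
  simp only [sub_self, zero_div, div_eq_zero_iff, hpi, or_false, φ, hcper] at this
  push_cast at this
  apply hpi
  linear_combination -this

/-- An arc whose endpoints are joined in a closed set that it meets only there has different
components of the complement along it. -/
lemma exists_components_along_arc {K e : Set ℂ} (hK : IsClosed K) {p q : ℂ} (he : IsArc p q e)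
    (hKe : K ∩ e ⊆ {p, q}) (hj : JoinedIn K p q) :
    ∃ a ∈ (K ∪ e)ᶜ, ∃ b ∈ (K ∪ e)ᶜ, ∃ x ∈ e \ {p, q}, ∃ y ∈ e \ {p, q},
      x ∈ closure (connectedComponentIn (K ∪ e)ᶜ a) ∧
      y ∈ closure (connectedComponentIn (K ∪ e)ᶜ b) ∧ ¬ ConnIn (K ∪ e)ᶜ a b := by
  classical
  by_contra! hcon
  obtain ⟨f, hf, hfe⟩ := exists_log_compl_of_joinedIn hj
  obtain ⟨g, hg, hge⟩ := exists_log_compl_of_joinedIn he.joinedIn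
  have hpi : (2 * Real.pi * Complex.I : ℂ) ≠ 0 := Complex.two_pi_I_ne_zero
  have hdiff : ∀ z ∈ (K ∪ e)ᶜ, ∃ n : ℤ, f z = g z + n * (2 * Real.pi * Complex.I) := fun z hz =>
    Complex.exp_eq_exp_iff_exists_int.1 ((hfe z fun h => hz (Or.inl h)).trans
      (hge z fun h => hz (Or.inr h)).symm)
  have hUo : IsOpen (K ∪ e)ᶜ := (hK.union he.isCompact.isClosed).isOpen_compl
  have hconst : ∀ a b, ConnIn (K ∪ e)ᶜ a b → f a - g a = f b - g b := by
    rintro a b ⟨C, hC, hCc, ha, hb⟩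
    have := hCc.int_valued_eq (f := fun z => (f z - g z) / (2 * Real.pi * Complex.I))
      (ContinuousOn.div_const ((hf.mono fun z hz h => hC hz (Or.inl h)).sub
        (hg.mono fun z hz h => hC hz (Or.inr h))) _) (fun z hz => by
        obtain ⟨n, hn⟩ := hdiff z (hC hz)
        exact ⟨n, by rw [hn]; field_simp; ring⟩) ha hb
    field_simp at this
    exact this
  let adj : ℂ → Prop := fun a => a ∈ (K ∪ e)ᶜ ∧
    ∃ x ∈ e \ {p, q}, x ∈ closure (connectedComponentIn (K ∪ e)ᶜ a)
  obtain ⟨n, hn⟩ : ∃ n : ℤ, ∀ a, adj a → f a - g a = n * (2 * Real.pi * Complex.I) := by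
    by_cases h : ∃ a, adj a
    · obtain ⟨a, haU, x, hx, hxa⟩ := h
      obtain ⟨n, hn⟩ := hdiff a haU
      refine ⟨n, fun b ⟨hbU, y, hy, hyb⟩ => ?_⟩
      rw [← hconst a b (hcon a haU b hbU x hx y hy hxa hyb), hn]
      ring
    · exact ⟨0, fun a ha => absurd ⟨a, ha⟩ h⟩
  -- If all components along the interior of the arc coincide, the two logarithms differ there by
  -- one multiple of $2\pi i$. Glued across the arc they would give a logarithm off `{p, q}`.
  let H : ℂ → ℂ := fun z => if z ∈ e then f z else g z + n * (2 * Real.pi * Complex.I)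
  refine not_exists_log_punctured he.ne (f := H) ?_ ?_
  · intro z hz
    refine ContinuousAt.continuousWithinAt ?_
    by_cases hze : z ∈ e
    · have hzK : z ∉ K := fun h => hz (hKe ⟨h, hze⟩)
      obtain ⟨r, hr, hB⟩ := Metric.isOpen_iff.1 hK.isOpen_compl z hzK
      have hfc : ContinuousAt f z := hf.continuousAt (hK.isOpen_compl.mem_nhds hzK)
      refine hfc.congr ?_
      filter_upwards [Metric.ball_mem_nhds z hr] with y hy
      by_cases hye : y ∈ e
      · exact (if_pos hye).symm
      have hyU : y ∈ (K ∪ e)ᶜ := fun h => h.elim (hB hy) hye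
      obtain ⟨x, hxB, hx, hxU⟩ := exists_mem_closure_component hUo
        (Metric.isPreconnected_ball (x := z) (r := r)) hy
        (mem_connectedComponentIn hyU)
        (fun h => connectedComponentIn_subset _ _ (h (Metric.mem_ball_self hr)) (Or.inr hze))
      have hxe : x ∈ e := (Set.notMem_compl_iff.1 hxU).resolve_left (hB hxB)
      have hxpq : x ∉ ({p, q} : Set ℂ) := by
        rintro (rfl | rfl)
        exacts [hB hxB hj.source_mem, hB hxB hj.target_mem]
      have := hn y ⟨hyU, x, ⟨hxe, hxpq⟩, hx⟩
      simp only [H, if_neg hye]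
      linear_combination this
    · have hgc : ContinuousAt g z := hg.continuousAt (he.isCompact.isClosed.isOpen_compl.mem_nhds hze)
      have : ContinuousAt (fun z => g z + n * (2 * Real.pi * Complex.I)) z := by fun_prop
      refine this.congr ?_
      filter_upwards [he.isCompact.isClosed.isOpen_compl.mem_nhds hze] with y hy
      exact (if_neg hy).symm
  · intro z hz
    by_cases hze : z ∈ e
    · simp only [H, if_pos hze]
      exact hfe z fun h => hz (hKe ⟨h, hze⟩)
    · simp only [H, if_neg hze]
      rw [Complex.exp_add, Complex.exp_int_mul_two_pi_mul_I, mul_one]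
      exact hge z hze

end ComplexPlane

namespace IsPlane

variable {X : Type*} [TopologicalSpace X] [IsPlane X]

/-- The version for the complex plane finds one boundary point for each component. By
`arc_subset_closure_component` the whole arc then lies on both boundaries. -/
lemma exists_components_along_arc {K e : Set X} (hK : IsClosed K) {p q : X} (he : IsArc p q e)
    (hKe : K ∩ e ⊆ {p, q}) (hj : JoinedIn K p q) :
    ∃ a ∈ (K ∪ e)ᶜ, ∃ b ∈ (K ∪ e)ᶜ, e ⊆ closure (connectedComponentIn (K ∪ e)ᶜ a) ∧
      e ⊆ closure (connectedComponentIn (K ∪ e)ᶜ b) ∧ ¬ ConnIn (K ∪ e)ᶜ a b := by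
  obtain ⟨φ⟩ := nonempty_homeomorph (X := X)
  obtain ⟨a, ha, b, hb, x, hx, y, hy, hxa, hyb, hab⟩ := ComplexPlane.exists_components_along_arc
    (φ.isClosedMap _ hK) (he.image φ)
    (by rw [← Set.image_inter φ.injective, ← Set.image_pair]; exact Set.image_mono hKe)
    (by
      obtain ⟨γ, hγ⟩ := hj
      exact ⟨γ.map φ.continuous, fun t => ⟨γ t, hγ t, rfl⟩⟩)
  obtain ⟨a, rfl⟩ := φ.surjective a
  obtain ⟨b, rfl⟩ := φ.surjective b
  obtain ⟨x, rfl⟩ := φ.surjective x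
  obtain ⟨y, rfl⟩ := φ.surjective y
  rw [← Set.image_union, ← Set.image_compl_eq φ.bijective] at ha hb hxa hyb hab
  rw [φ.injective.mem_set_image] at ha hb
  rw [← Set.image_pair, ← Set.image_sdiff φ.injective, φ.injective.mem_set_image] at hx hy
  rw [connIn_iff_of_homeomorph] at hab
  rw [← φ.image_connectedComponentIn ha, ← φ.image_closure, φ.injective.mem_set_image] at hxa
  rw [← φ.image_connectedComponentIn hb, ← φ.image_closure, φ.injective.mem_set_image] at hyb
  exact ⟨a, ha, b, hb,
    arc_subset_closure_component hK he hKe hx.1 (fun h => hx.2 (Or.inl h))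
      (fun h => hx.2 (Or.inr h)) hxa,
    arc_subset_closure_component hK he hKe hy.1 (fun h => hy.2 (Or.inl h))
      (fun h => hy.2 (Or.inr h)) hyb, hab⟩

end IsPlane

end

section

open Filter Topology

/-! ### Regions of plane drawings -/

namespace PlaneDrawing

variable {W : Type*} {G : SimpleGraph W} {X : Type*} [MetricSpace X]

/-- The subset of the plane occupied by the vertices in `P` and the edges in `T`. -/
def occupied (D : PlaneDrawing G X) (P : Set W) (T : Set G.edgeSet) : Set X :=
  D.pos '' P ∪ ⋃ e ∈ T, D.arc e

/-- The component of `x` in the complement of the vertices in `P` and the edges in `T`. -/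
def region (D : PlaneDrawing G X) (P : Set W) (T : Set G.edgeSet) (x : X) : Set X :=
  connectedComponentIn (D.occupied P T)ᶜ x

section Basic

variable (D : PlaneDrawing G X)

lemma drawn_univ : D.drawn Set.univ = D.occupied Set.univ Set.univ := by
  simp [drawn, occupied]

lemma occupied_mono {P P' : Set W} {T T' : Set G.edgeSet} (hP : P ⊆ P') (hT : T ⊆ T') :
    D.occupied P T ⊆ D.occupied P' T' :=
  Set.union_subset_union (Set.image_mono hP) (Set.biUnion_mono hT fun _ _ => subset_rfl)

lemma arc_subset_occupied {P : Set W} {T : Set G.edgeSet} {e : G.edgeSet} (he : e ∈ T) :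
    D.arc e ⊆ D.occupied P T :=
  fun _ hx => Or.inr (Set.mem_biUnion he hx)

lemma pos_mem_occupied {P : Set W} {T : Set G.edgeSet} {w : W} (hw : w ∈ P) :
    D.pos w ∈ D.occupied P T := Or.inl (Set.mem_image_of_mem _ hw)

lemma isArc {u v : W} (h : G.Adj u v) : IsArc (D.pos u) (D.pos v) (D.arc ⟨s(u, v), h⟩) :=
  (D.isPolygonalArc u v h).1

lemma exists_isArc (e : G.edgeSet) : ∃ (u v : W) (h : G.Adj u v), e = ⟨s(u, v), h⟩ := by
  obtain ⟨e, he⟩ := e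
  induction e with
  | h u v => exact ⟨u, v, he, rfl⟩

lemma pos_mem_arc_iff {e : G.edgeSet} {w : W} : D.pos w ∈ D.arc e ↔ w ∈ (e : Sym2 W) := by
  refine ⟨D.mem_of_pos_mem_arc e w, fun hw => ?_⟩
  obtain ⟨u, v, h, rfl⟩ := exists_isArc e
  rcases Sym2.mem_iff.1 hw with rfl | rfl
  exacts [(D.isArc h).left_mem, (D.isArc h).right_mem]

lemma mem_openArc {e : G.edgeSet} {x : X} :
    x ∈ D.openArc e ↔ x ∈ D.arc e ∧ ∀ w, D.pos w ≠ x := by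
  refine ⟨fun h => ⟨h.1, fun w hw => h.2 ⟨w, ?_, hw⟩⟩, fun h => ⟨h.1, fun ⟨w, _, hw⟩ => h.2 w hw⟩⟩
  exact D.mem_of_pos_mem_arc e w (hw ▸ h.1)

lemma openArc_eq {u v : W} (h : G.Adj u v) :
    D.openArc ⟨s(u, v), h⟩ = D.arc ⟨s(u, v), h⟩ \ {D.pos u, D.pos v} := by
  have : {w : W | w ∈ s(u, v)} = {u, v} := by
    ext w; simp
  rw [openArc, this, Set.image_pair]

lemma eq_of_mem_openArc {e e' : G.edgeSet} {x : X} (h : x ∈ D.openArc e) (h' : x ∈ D.arc e') :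
    e' = e := by
  by_contra hne
  obtain ⟨w, -, hw⟩ := D.arc_inter_arc e e' (Ne.symm hne) ⟨h.1, h'⟩
  exact (D.mem_openArc.1 h).2 w hw

lemma openArc_disjoint_occupied {P : Set W} {T : Set G.edgeSet} {e : G.edgeSet} (he : e ∉ T) :
    Disjoint (D.openArc e) (D.occupied P T) := by
  rw [Set.disjoint_left]
  rintro x hx (⟨w, -, hw⟩ | hx')
  · exact (D.mem_openArc.1 hx).2 w hw
  · obtain ⟨e', he', hx'⟩ := Set.mem_iUnion₂.1 hx'
    exact he (D.eq_of_mem_openArc hx hx' ▸ he')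

lemma isConnected_openArc (e : G.edgeSet) : IsConnected (D.openArc e) := by
  obtain ⟨u, v, h, rfl⟩ := exists_isArc e
  rw [D.openArc_eq]
  obtain ⟨γ, hγ, hi, h0, h1, hr⟩ := D.isArc h
  have : D.arc ⟨s(u, v), h⟩ \ {D.pos u, D.pos v} = γ '' Set.Ioo 0 1 := by
    rw [← hr, ← h0, ← h1]
    ext x
    constructor
    · rintro ⟨⟨t, rfl⟩, ht⟩
      refine ⟨t, ⟨unitInterval.pos_iff_ne_zero.2 fun h => ht (Or.inl (by rw [h])),
        unitInterval.lt_one_iff_ne_one.2 fun h => ht (Or.inr (by rw [h]; rfl))⟩, rfl⟩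
    · rintro ⟨t, ht, rfl⟩
      refine ⟨⟨t, rfl⟩, ?_⟩
      rintro (h | h)
      exacts [ht.1.ne' (hi h), ht.2.ne (hi h)]
  rw [this]
  exact (isConnected_Ioo zero_lt_one).image γ hγ.continuousOn

lemma arc_subset_closure_openArc (e : G.edgeSet) : D.arc e ⊆ closure (D.openArc e) := by
  obtain ⟨u, v, h, rfl⟩ := exists_isArc e
  rw [D.openArc_eq]
  obtain ⟨γ, hγ, hi, h0, h1, hr⟩ := D.isArc h
  rw [← hr, ← h0, ← h1]
  have hsub : γ '' Set.Ioo 0 1 ⊆ Set.range γ \ {γ 0, γ 1} := by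
    rintro _ ⟨t, ht, rfl⟩
    refine ⟨⟨t, rfl⟩, ?_⟩
    rintro (h | h)
    exacts [ht.1.ne' (hi h), ht.2.ne (hi h)]
  refine Set.Subset.trans ?_ (closure_mono hsub)
  rintro _ ⟨t, rfl⟩
  have : t ∈ closure (Set.Ioo (0 : I) 1) := by
    rw [closure_Ioo zero_ne_one]
    exact ⟨unitInterval.nonneg', unitInterval.le_one'⟩
  exact image_closure_subset_closure_image hγ ⟨t, this, rfl⟩

lemma occupied_eq_union {P : Set W} {T : Set G.edgeSet} {e : G.edgeSet} (he : e ∈ T) :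
    D.occupied P T = D.occupied P (T \ {e}) ∪ D.arc e := by
  apply subset_antisymm
  · rintro x (hx | hx)
    · exact Or.inl (Or.inl hx)
    · obtain ⟨e', he', hx⟩ := Set.mem_iUnion₂.1 hx
      by_cases h : e' = e
      · exact Or.inr (h ▸ hx)
      · exact Or.inl (D.arc_subset_occupied (T := T \ {e}) ⟨he', h⟩ hx)
  · exact Set.union_subset (D.occupied_mono subset_rfl Set.sdiff_subset) (D.arc_subset_occupied he)

lemma occupied_inter_arc_subset {P : Set W} {T : Set G.edgeSet} {u v : W} (h : G.Adj u v) :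
    D.occupied P (T \ {(⟨s(u, v), h⟩ : G.edgeSet)}) ∩ D.arc ⟨s(u, v), h⟩ ⊆ {D.pos u, D.pos v} := by
  rintro x ⟨hx, hxe⟩
  by_contra hcon
  have h1 : x ∈ D.openArc ⟨s(u, v), h⟩ := by rw [openArc_eq]; exact ⟨hxe, hcon⟩
  exact (D.openArc_disjoint_occupied (fun h => h.2 rfl)).notMem_of_mem_left h1 hx

variable [ProperSpace X]

/-- Properness makes the union of points and arcs locally finite, since closed balls are compact. -/
lemma isClosed_occupied (P : Set W) (T : Set G.edgeSet) : IsClosed (D.occupied P T) := by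
  refine IsClosed.union ?_ ?_
  · rw [← Set.biUnion_of_singleton (D.pos '' P), Set.biUnion_image, Set.biUnion_eq_iUnion]
    refine LocallyFinite.isClosed_iUnion (fun x => ?_) (fun _ => isClosed_singleton)
    refine ⟨Metric.closedBall x 1, Metric.closedBall_mem_nhds x one_pos, ?_⟩
    refine Set.Finite.of_injOn (f := Subtype.val) ?_ Subtype.val_injective.injOn
      (D.proper _ (isCompact_closedBall x 1)).1
    rintro w ⟨y, hy, hy'⟩
    have hy : y = D.pos w := hy
    exact (hy ▸ hy' : D.pos w ∈ _)
  · rw [Set.biUnion_eq_iUnion]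
    refine LocallyFinite.isClosed_iUnion (fun x => ?_) (fun e => ?_)
    · refine ⟨Metric.closedBall x 1, Metric.closedBall_mem_nhds x one_pos, ?_⟩
      exact Set.Finite.of_injOn (f := Subtype.val) (fun e he => he) Subtype.val_injective.injOn
        (D.proper _ (isCompact_closedBall x 1)).2
    · obtain ⟨u, v, h, he⟩ := exists_isArc (e : G.edgeSet)
      rw [he]
      exact (D.isArc h).isCompact.isClosed

lemma isOpen_compl_occupied (P : Set W) (T : Set G.edgeSet) : IsOpen (D.occupied P T)ᶜ :=
  (D.isClosed_occupied P T).isOpen_compl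

lemma vertices_discrete (P : Set W) (x : X) : ∀ᶠ y in 𝓝[≠] x, y ∉ D.pos '' P := by
  have h := D.isClosed_occupied (P \ {w | D.pos w = x}) ∅
  have hx : x ∉ D.occupied (P \ {w | D.pos w = x}) ∅ := by
    rintro (⟨w, hw, hwx⟩ | hx)
    · exact hw.2 hwx
    · simp at hx
  filter_upwards [mem_nhdsWithin_of_mem_nhds (h.isOpen_compl.mem_nhds hx), self_mem_nhdsWithin]
    with y hy hyx
  rintro ⟨w, hw, rfl⟩
  exact hy (D.pos_mem_occupied ⟨hw, hyx⟩)

variable [IsPlane X] {D} {P P' : Set W} {T T' : Set G.edgeSet}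

lemma isOpen_region (x : X) : IsOpen (D.region P T x) :=
  (D.isOpen_compl_occupied P T).connectedComponentIn

omit [ProperSpace X] [IsPlane X] in
lemma mem_region_self {x : X} (hx : x ∉ D.occupied P T) : x ∈ D.region P T x :=
  mem_connectedComponentIn hx

omit [ProperSpace X] [IsPlane X] in
lemma region_subset (x : X) : D.region P T x ⊆ (D.occupied P T)ᶜ :=
  connectedComponentIn_subset _ _

omit [ProperSpace X] [IsPlane X] in
lemma isPreconnected_region (x : X) : IsPreconnected (D.region P T x) :=
  isPreconnected_connectedComponentIn

omit [ProperSpace X] [IsPlane X] in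
lemma region_eq_of_mem {x y : X} (h : y ∈ D.region P T x) : D.region P T y = D.region P T x :=
  (connectedComponentIn_eq h).symm

omit [ProperSpace X] [IsPlane X] in
lemma mem_region_iff {x y : X} (hx : x ∉ D.occupied P T) :
    y ∈ D.region P T x ↔ ConnIn (D.occupied P T)ᶜ x y := (ConnIn.iff_mem hx).symm

omit [ProperSpace X] [IsPlane X] in
lemma region_mono (hP : P ⊆ P') (hT : T ⊆ T') (x : X) : D.region P' T' x ⊆ D.region P T x :=
  connectedComponentIn_mono x (Set.compl_subset_compl.2 (D.occupied_mono hP hT))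

omit [ProperSpace X] [IsPlane X] in
lemma subset_region {x : X} {C : Set X} (hC : IsPreconnected C) (hx : x ∈ C)
    (h : Disjoint C (D.occupied P T)) : C ⊆ D.region P T x :=
  hC.subset_connectedComponentIn hx h.subset_compl_right

omit [ProperSpace X] [IsPlane X] in
lemma subset_region_of_inter {x y : X} {C : Set X} (hC : IsPreconnected C) (hy : y ∈ C)
    (hyx : y ∈ D.region P T x) (h : Disjoint C (D.occupied P T)) : C ⊆ D.region P T x := by
  rw [← region_eq_of_mem hyx]
  exact subset_region hC hy h

omit [ProperSpace X] [IsPlane X] in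
/-- A set in the closure of a region that avoids the drawing lies in the region. -/
lemma subset_region_of_closure {x y : X} {C : Set X} (hC : IsPreconnected C) (hy : y ∈ C)
    (hyx : y ∈ closure (D.region P T x)) (hCo : Disjoint C (D.occupied P T)) :
    C ⊆ D.region P T x := by
  have hyU : y ∈ (D.occupied P T)ᶜ := fun h => hCo.le_bot ⟨hy, h⟩
  have hins : IsPreconnected (insert y (D.region P T x)) :=
    (isPreconnected_region x).subset_closure (Set.subset_insert _ _)
      (Set.insert_subset hyx subset_closure)
  by_cases hne : (D.region P T x).Nonempty
  · obtain ⟨z, hz⟩ := hne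
    have h2 : insert y (D.region P T x) ⊆ D.region P T x := by
      refine subset_region_of_inter hins (Or.inr hz) hz ?_
      rw [Set.disjoint_left]
      rintro w (rfl | hw)
      exacts [hyU, region_subset x hw]
    exact subset_region_of_inter hC hy (h2 (Or.inl rfl)) hCo
  · rw [Set.not_nonempty_iff_eq_empty.1 hne] at hyx
    simp at hyx

/-- The region is determined by the part of the drawing on its boundary. -/
lemma region_eq_of_closure_inter {a : X} (ha : a ∉ D.occupied P T) (hP : P' ⊆ P) (hT : T' ⊆ T)
    (h : closure (D.region P T a) ∩ D.occupied P T ⊆ D.occupied P' T') :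
    D.region P T a = D.region P' T' a := by
  refine (region_mono hP hT a).antisymm ?_
  by_contra hcon
  have ha' : a ∉ D.occupied P' T' := fun h' => ha (D.occupied_mono hP hT h')
  obtain ⟨z, hz, hz1, hz2⟩ := exists_mem_closure_component (D.isOpen_compl_occupied P T)
    (isPreconnected_region (P := P') (T := T') a) (mem_region_self ha') (mem_region_self ha) hcon
  exact region_subset a hz (h ⟨hz1, Set.notMem_compl_iff.1 hz2⟩)

lemma arc_subset_closure_region {e : G.edgeSet} (he : e ∈ T) {a x : X} (hx : x ∈ D.openArc e)
    (hxa : x ∈ closure (D.region P T a)) : D.arc e ⊆ closure (D.region P T a) := by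
  obtain ⟨u, v, h, rfl⟩ := exists_isArc e
  rw [region, D.occupied_eq_union he] at hxa ⊢
  rw [openArc_eq] at hx
  exact IsPlane.arc_subset_closure_component (D.isClosed_occupied _ _) (D.isArc h)
    (D.occupied_inter_arc_subset h) hx.1 (fun h => hx.2 (Or.inl h)) (fun h => hx.2 (Or.inr h)) hxa

/-- At most two regions lie along an edge. -/
lemma connIn_of_three_regions {e : G.edgeSet} (he : e ∈ T) {a b c : X}
    (ha : a ∉ D.occupied P T) (hb : b ∉ D.occupied P T) (hc : c ∉ D.occupied P T)
    (hae : D.arc e ⊆ closure (D.region P T a)) (hbe : D.arc e ⊆ closure (D.region P T b))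
    (hce : D.arc e ⊆ closure (D.region P T c)) :
    ConnIn (D.occupied P T)ᶜ a b ∨ ConnIn (D.occupied P T)ᶜ a c ∨
      ConnIn (D.occupied P T)ᶜ b c := by
  obtain ⟨x, hx⟩ := (D.isConnected_openArc e).nonempty
  have hxK : x ∉ D.occupied P (T \ {e}) :=
    (D.openArc_disjoint_occupied (fun h => h.2 rfl)).notMem_of_mem_left hx
  -- All three regions reach this disc, which avoids the rest of the drawing. Their representatives
  -- in it are thus connected as soon as `e` is erased.
  obtain ⟨B, hBK, hBo, hxB, hBc, -⟩ :=
    IsPlane.exists_disc ((D.isOpen_compl_occupied P (T \ {e})).mem_nhds hxK)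
  have pick {y : X} (hy : D.arc e ⊆ closure (D.region P T y)) : ∃ z ∈ B, z ∈ D.region P T y :=
    mem_closure_iff.1 (hy hx.1) B hBo hxB
  obtain ⟨a', ha'B, ha'⟩ := pick hae
  obtain ⟨b', hb'B, hb'⟩ := pick hbe
  obtain ⟨c', hc'B, hc'⟩ := pick hce
  have hnot {y z : X} (hz : z ∈ D.region P T y) : z ∉ D.arc e :=
    fun h => region_subset y hz (D.arc_subset_occupied he h)
  have haa := (mem_region_iff ha).1 ha'
  have hbb := (mem_region_iff hb).1 hb'
  have hcc := (mem_region_iff hc).1 hc'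
  have hBab : ConnIn (D.occupied P (T \ {e}))ᶜ a' b' := ⟨B, hBK, hBc, ha'B, hb'B⟩
  have hBac : ConnIn (D.occupied P (T \ {e}))ᶜ a' c' := ⟨B, hBK, hBc, ha'B, hc'B⟩
  have key : ConnIn (D.occupied P T)ᶜ a' b' ∨ ConnIn (D.occupied P T)ᶜ a' c' ∨
      ConnIn (D.occupied P T)ᶜ b' c' := by
    obtain ⟨u, v, h, rfl⟩ := exists_isArc e
    rw [D.occupied_eq_union he]
    exact IsPlane.connIn_compl_union_arc_of_three (D.isClosed_occupied _ _) (D.isArc h)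
      (D.occupied_inter_arc_subset h) (hnot ha') (hnot hb') (hnot hc') hBab hBac
  rcases key with h | h | h
  · exact Or.inl ((haa.trans h).trans hbb.symm)
  · exact Or.inr (Or.inl ((haa.trans h).trans hcc.symm))
  · exact Or.inr (Or.inr ((hbb.trans h).trans hcc.symm))

/-- The source of all separation results for drawings: an edge whose endpoints are joined by the
rest has different regions along it. -/
lemma exists_regions_along {u v : W} {h : G.Adj u v} (he : (⟨s(u, v), h⟩ : G.edgeSet) ∈ T)
    (hj : JoinedIn (D.occupied P (T \ {(⟨s(u, v), h⟩ : G.edgeSet)})) (D.pos u) (D.pos v)) :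
    ∃ a ∉ D.occupied P T, ∃ b ∉ D.occupied P T,
      D.arc ⟨s(u, v), h⟩ ⊆ closure (D.region P T a) ∧
      D.arc ⟨s(u, v), h⟩ ⊆ closure (D.region P T b) ∧ ¬ ConnIn (D.occupied P T)ᶜ a b := by
  have := IsPlane.exists_components_along_arc (D.isClosed_occupied P (T \ {(⟨s(u, v), h⟩ : G.edgeSet)}))
    (D.isArc h) (D.occupied_inter_arc_subset h) hj
  simp only [region, D.occupied_eq_union he]
  exact this

omit [ProperSpace X] [IsPlane X] in
lemma joinedIn_of_walk {u v : W} (p : G.Walk u v)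
    (hp : ∀ e : G.edgeSet, (e : Sym2 W) ∈ p.edges → e ∈ T) (hu : D.pos u ∈ D.occupied P T) :
    JoinedIn (D.occupied P T) (D.pos u) (D.pos v) := by
  induction p with
  | nil => exact JoinedIn.refl hu
  | cons h p ih =>
    have h1 := hp ⟨_, G.mem_edgeSet.2 h⟩ (by simp)
    have hsub := D.arc_subset_occupied (P := P) h1
    have h2 := ((D.isArc h).joinedIn).mono hsub
    exact h2.trans (ih (fun e he => hp e (by simp [he])) h2.target_mem)

/-- Near a point of the drawing that is on the boundary of a region, an edge of the drawing at that
point is on the boundary. -/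
lemma exists_arc_subset_closure_of_pos {w : W} {e₀ : G.edgeSet} (he₀ : e₀ ∈ T)
    (hw : w ∈ (e₀ : Sym2 W)) {a : X} (hwa : D.pos w ∈ closure (D.region P T a)) :
    ∃ e ∈ T, w ∈ (e : Sym2 W) ∧ D.arc e ⊆ closure (D.region P T a) := by
  have hnot : D.pos w ∉ D.occupied (P \ {w}) {e | e ∈ T ∧ w ∉ (e : Sym2 W)} := by
    rintro (⟨w', hw', h⟩ | h)
    · exact hw'.2 (D.pos_injective h)
    · obtain ⟨e, he, h⟩ := Set.mem_iUnion₂.1 h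
      exact he.2 (D.mem_of_pos_mem_arc e w h)
  -- The disc meets only edges at `w` and no other vertex. Punctured at `w` it is connected and
  -- meets both the region and `e₀`, so it contains a boundary point of the region, interior to an
  -- edge at `w`.
  obtain ⟨B, hBN, hBo, hwB, -, hBc⟩ := IsPlane.exists_disc (inter_mem
    ((D.isOpen_compl_occupied _ _).mem_nhds hnot)
    (mem_nhdsWithin_iff_eventually.1 (D.vertices_discrete Set.univ (D.pos w))))
  obtain ⟨y, hyB, hya⟩ := mem_closure_iff.1 hwa B hBo hwB
  have hyU := region_subset a hya
  have hyw : y ≠ D.pos w := by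
    rintro rfl
    exact hyU (D.arc_subset_occupied he₀ (D.pos_mem_arc_iff.2 hw))
  obtain ⟨y₀, hy₀B, hy₀⟩ := mem_closure_iff.1
    (D.arc_subset_closure_openArc e₀ (D.pos_mem_arc_iff.2 hw)) B hBo hwB
  obtain ⟨z, hz, hza, hzU⟩ := exists_mem_closure_component (x := a) (y := y)
    (D.isOpen_compl_occupied P T) (hBc (D.pos w)) ⟨hyB, hyw⟩ hya (fun h =>
      region_subset a (h ⟨hy₀B, fun h' => (D.mem_openArc.1 hy₀).2 w h'.symm⟩)
        (D.arc_subset_occupied he₀ hy₀.1))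
  rw [Set.notMem_compl_iff] at hzU
  have hzP : ∀ w', D.pos w' ≠ z := fun w' h => (hBN hz.1).2 hz.2 ⟨w', Set.mem_univ _, h⟩
  rcases hzU with ⟨w', -, h⟩ | h
  · exact absurd h (hzP w')
  obtain ⟨e, he, hze⟩ := Set.mem_iUnion₂.1 h
  refine ⟨e, he, ?_, arc_subset_closure_region he (D.mem_openArc.2 ⟨hze, hzP⟩) hza⟩
  by_contra hwe
  exact (hBN hz.1).1 (D.arc_subset_occupied (T := {e | e ∈ T ∧ w ∉ (e : Sym2 W)}) ⟨he, hwe⟩ hze)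

/-- The regions that meet a small neighbourhood of a point of an open arc are along the edge. -/
lemma arc_subset_closure_region_of_near {e : G.edgeSet} (he : e ∈ T) {x : X}
    (hx : x ∈ D.openArc e) {B : Set X} (hB : IsPreconnected B) (hxB : x ∈ B)
    (hBe : Disjoint B (D.occupied Set.univ (T \ {e}))) {y a : X} (hyB : y ∈ B)
    (hya : y ∈ D.region P T a) : D.arc e ⊆ closure (D.region P T a) := by
  obtain ⟨z, hz, hza, hzU⟩ := exists_mem_closure_component (x := a)
    (D.isOpen_compl_occupied P T) hB hyB hya
    (fun h => region_subset a (h hxB) (D.arc_subset_occupied he hx.1))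
  rw [Set.notMem_compl_iff] at hzU
  have hzK : z ∉ D.occupied Set.univ (T \ {e}) := hBe.notMem_of_mem_left hz
  have hze : z ∈ D.arc e := by
    rw [D.occupied_eq_union he] at hzU
    exact hzU.resolve_left fun h => hzK (D.occupied_mono (Set.subset_univ P) subset_rfl h)
  exact arc_subset_closure_region he (D.mem_openArc.2 ⟨hze, fun w hw =>
    hzK (hw ▸ D.pos_mem_occupied (Set.mem_univ w))⟩) hza

end Basic

end PlaneDrawing

end

section

open Filter Topology

/-! ### Faces and the dual graph -/

namespace PlaneDrawing

variable {W : Type*} {G : SimpleGraph W} {X : Type*} [MetricSpace X] [ProperSpace X] [IsPlane X]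
  {D : PlaneDrawing G X} {P P' : Set W} {T T' : Set G.edgeSet}

omit [ProperSpace X] in
lemma dense_compl_arc (e : G.edgeSet) : Dense (D.arc e)ᶜ := by
  obtain ⟨u, v, h, rfl⟩ := exists_isArc e
  exact interior_eq_empty_iff_dense_compl.1 (IsPlane.interior_arc (D.isArc h))

/-- Near a point there are finitely many vertices and arcs, all closed and without interior. -/
lemma dense_compl_occupied : Dense (D.occupied P T)ᶜ := by
  intro x
  rw [mem_closure_iff]
  intro O hO hxO
  obtain ⟨r, hr, hrO⟩ := Metric.isOpen_iff.1 hO x hxO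
  obtain ⟨hfV, hfE⟩ := D.proper _ (isCompact_closedBall x r)
  have hd1 : Dense (⋂ w ∈ {w | D.pos w ∈ Metric.closedBall x r}, ({D.pos w}ᶜ : Set X)) :=
    dense_biInter_of_isOpen (fun w _ => isOpen_compl_singleton) hfV.countable
      (fun w _ => dense_compl_singleton _)
  have hd2 : Dense (⋂ e ∈ {e | (D.arc e ∩ Metric.closedBall x r).Nonempty}, (D.arc e)ᶜ) := by
    refine dense_biInter_of_isOpen (fun e _ => ?_) hfE.countable (fun e _ => dense_compl_arc e)
    obtain ⟨u, v, h, rfl⟩ := exists_isArc e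
    exact (D.isArc h).isCompact.isClosed.isOpen_compl
  have hd := hd1.inter_of_isOpen_left hd2 (by
    exact hfV.isOpen_biInter fun w _ => isOpen_compl_singleton)
  obtain ⟨y, hy, hy1, hy2⟩ := hd.inter_open_nonempty _ Metric.isOpen_ball
    ⟨x, Metric.mem_ball_self hr⟩
  have hyc := Metric.ball_subset_closedBall hy
  refine ⟨y, hrO hy, ?_⟩
  rintro (⟨w, -, hw⟩ | h)
  · exact Set.mem_iInter₂.1 hy1 w (show D.pos w ∈ _ from hw ▸ hyc) hw.symm
  · obtain ⟨e, -, he⟩ := Set.mem_iUnion₂.1 h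
    exact Set.mem_iInter₂.1 hy2 e ⟨y, he, hyc⟩ he

omit [ProperSpace X] [IsPlane X] in
lemma Face.eq_region (f : D.Face) {x : X} (hx : x ∈ f.1) :
    f.1 = D.region Set.univ Set.univ x := by
  obtain ⟨y, -, hF⟩ := f.2
  rw [hF, drawn_univ] at hx
  rw [hF, drawn_univ]
  exact connectedComponentIn_eq hx

omit [ProperSpace X] [IsPlane X] in
lemma Face.disjoint_occupied (f : D.Face) : Disjoint f.1 (D.occupied P T) := by
  rw [Set.disjoint_left]
  intro x hx hx'
  rw [f.eq_region hx] at hx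
  exact region_subset x hx (D.occupied_mono (Set.subset_univ _) (Set.subset_univ _) hx')

omit [ProperSpace X] [IsPlane X] in
lemma Face.nonempty (f : D.Face) : f.1.Nonempty := by
  obtain ⟨F, y, hy, rfl⟩ := f
  exact ⟨y, mem_connectedComponentIn hy⟩

omit [ProperSpace X] [IsPlane X] in
lemma Face.isPreconnected (f : D.Face) : IsPreconnected f.1 := by
  obtain ⟨F, y, hy, rfl⟩ := f
  exact isPreconnected_connectedComponentIn

lemma Face.isOpen (f : D.Face) : IsOpen f.1 := by
  obtain ⟨x, hx⟩ := f.nonempty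
  rw [f.eq_region hx]
  exact isOpen_region x

variable (D) in
/-- The face of the drawing that contains a given point. -/
def faceOf (x : X) (hx : x ∉ D.occupied Set.univ Set.univ) : D.Face :=
  ⟨D.region Set.univ Set.univ x, x, by rwa [drawn_univ], by rw [drawn_univ]; rfl⟩

omit [ProperSpace X] [IsPlane X] in
lemma mem_faceOf {x : X} (hx : x ∉ D.occupied Set.univ Set.univ) : x ∈ (D.faceOf x hx).1 :=
  mem_region_self hx

omit [ProperSpace X] [IsPlane X] in
lemma Face.eq_of_mem {f g : D.Face} {x : X} (hf : x ∈ f.1) (hg : x ∈ g.1) : f = g :=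
  Subtype.ext ((f.eq_region hf).trans (g.eq_region hg).symm)

omit [ProperSpace X] [IsPlane X] in
/-- A face that meets a region lies in it. -/
lemma Face.subset_region (f : D.Face) {x y : X} (hy : y ∈ f.1) (hyx : y ∈ D.region P T x) :
    f.1 ⊆ D.region P T x :=
  subset_region_of_inter f.isPreconnected hy hyx f.disjoint_occupied

lemma borders_iff {e : G.edgeSet} {f : D.Face} : D.Borders e f ↔ D.arc e ⊆ closure f.1 := by
  refine ⟨fun h => h.trans frontier_subset_closure, fun h x hx => ?_⟩
  rw [f.isOpen.frontier_eq]
  exact ⟨h hx, fun h' => (f.disjoint_occupied (P := Set.univ) (T := Set.univ)).le_bot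
    ⟨h', D.arc_subset_occupied (Set.mem_univ e) hx⟩⟩

lemma vertexOnBoundary_iff {w : W} {f : D.Face} :
    D.VertexOnBoundary w f ↔ D.pos w ∈ closure f.1 := by
  refine ⟨fun h => frontier_subset_closure h, fun h => ?_⟩
  rw [VertexOnBoundary, f.isOpen.frontier_eq]
  exact ⟨h, fun h' => (f.disjoint_occupied (P := Set.univ) (T := Set.univ)).le_bot
    ⟨h', D.pos_mem_occupied (Set.mem_univ w)⟩⟩

lemma borders_of_mem_openArc {e : G.edgeSet} {f : D.Face} {x : X} (hx : x ∈ D.openArc e)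
    (h : x ∈ closure f.1) : D.Borders e f := by
  obtain ⟨y, hy⟩ := f.nonempty
  rw [borders_iff, f.eq_region hy]
  rw [f.eq_region hy] at h
  exact arc_subset_closure_region (Set.mem_univ e) hx h

/-- Around an interior point of an edge, all faces border the edge. -/
lemma exists_disc_borders {e : G.edgeSet} {x : X} (hx : x ∈ D.openArc e) {N : Set X}
    (hN : N ∈ 𝓝 x) : ∃ B ⊆ N, IsOpen B ∧ x ∈ B ∧ IsPreconnected B ∧
      Disjoint B (D.occupied Set.univ (Set.univ \ {e})) ∧
      ∀ f : D.Face, (f.1 ∩ B).Nonempty → D.Borders e f := by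
  have hxK : x ∉ D.occupied Set.univ (Set.univ \ {e}) :=
    (D.openArc_disjoint_occupied (fun h => h.2 rfl)).notMem_of_mem_left hx
  obtain ⟨B, hBN, hBo, hxB, hBc, -⟩ := IsPlane.exists_disc
    (inter_mem hN ((D.isOpen_compl_occupied _ _).mem_nhds hxK))
  have hd : Disjoint B (D.occupied Set.univ (Set.univ \ {e})) :=
    Set.disjoint_left.2 fun y hy => (hBN hy).2
  refine ⟨B, fun y hy => (hBN hy).1, hBo, hxB, hBc, hd, ?_⟩
  rintro f ⟨y, hyf, hyB⟩
  rw [borders_iff, f.eq_region hyf]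
  exact arc_subset_closure_region_of_near (Set.mem_univ e) hx hBc hxB hd hyB
    (f.eq_region hyf ▸ hyf)

lemma exists_face_inter {O : Set X} (hO : IsOpen O) (hne : O.Nonempty) :
    ∃ f : D.Face, (f.1 ∩ O).Nonempty := by
  obtain ⟨y, hyO, hy⟩ := dense_compl_occupied.inter_open_nonempty (s := (D.occupied Set.univ
    Set.univ)ᶜ) O hO hne
  exact ⟨D.faceOf y hy, y, mem_faceOf hy, hyO⟩

lemma exists_borders_inter {e : G.edgeSet} {x : X} (hx : x ∈ D.openArc e) {N : Set X}
    (hN : N ∈ 𝓝 x) : ∃ f : D.Face, D.Borders e f ∧ (f.1 ∩ N).Nonempty := by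
  obtain ⟨B, hBN, hBo, hxB, -, -, hB⟩ := exists_disc_borders hx hN
  obtain ⟨f, hf⟩ := exists_face_inter (D := D) hBo ⟨x, hxB⟩
  exact ⟨f, hB f hf, hf.mono (Set.inter_subset_inter_right _ hBN)⟩

lemma exists_borders (e : G.edgeSet) : ∃ f : D.Face, D.Borders e f := by
  obtain ⟨x, hx⟩ := (D.isConnected_openArc e).nonempty
  obtain ⟨f, hf, -⟩ := exists_borders_inter hx univ_mem
  exact ⟨f, hf⟩

/-- Every point that is not a vertex is in the closure of a face. -/
lemma exists_mem_closure_face {x : X} (hx : ∀ w, D.pos w ≠ x) : ∃ f : D.Face, x ∈ closure f.1 := by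
  by_cases h : x ∈ D.occupied Set.univ Set.univ
  · rcases h with ⟨w, -, hw⟩ | h
    · exact absurd hw (hx w)
    · obtain ⟨e, -, he⟩ := Set.mem_iUnion₂.1 h
      obtain ⟨f, hf⟩ := exists_borders (D := D) e
      exact ⟨f, borders_iff.1 hf he⟩
  · exact ⟨D.faceOf x h, subset_closure (mem_faceOf h)⟩

/-- At most two faces lie along an edge. -/
lemma borders_three {e : G.edgeSet} {f g h : D.Face} (hf : D.Borders e f) (hg : D.Borders e g)
    (hh : D.Borders e h) : f = g ∨ f = h ∨ g = h := by
  obtain ⟨x, hx⟩ := f.nonempty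
  obtain ⟨y, hy⟩ := g.nonempty
  obtain ⟨z, hz⟩ := h.nonempty
  have hxU := (f.disjoint_occupied (P := Set.univ) (T := Set.univ)).notMem_of_mem_left hx
  have hyU := (g.disjoint_occupied (P := Set.univ) (T := Set.univ)).notMem_of_mem_left hy
  have hzU := (h.disjoint_occupied (P := Set.univ) (T := Set.univ)).notMem_of_mem_left hz
  rw [borders_iff] at hf hg hh
  rw [f.eq_region hx] at hf
  rw [g.eq_region hy] at hg
  rw [h.eq_region hz] at hh
  rcases connIn_of_three_regions (Set.mem_univ e) hxU hyU hzU hf hg hh with h' | h' | h'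
  · exact Or.inl (Face.eq_of_mem (x := y) (f.eq_region hx ▸ (mem_region_iff hxU).2 h') hy)
  · exact Or.inr (Or.inl (Face.eq_of_mem (x := z) (f.eq_region hx ▸ (mem_region_iff hxU).2 h') hz))
  · exact Or.inr (Or.inr (Face.eq_of_mem (x := z) (g.eq_region hy ▸ (mem_region_iff hyU).2 h') hz))

lemma finite_borders (e : G.edgeSet) : {f : D.Face | D.Borders e f}.Finite := by
  by_cases h : ∃ f g : D.Face, D.Borders e f ∧ D.Borders e g ∧ f ≠ g
  · obtain ⟨f, g, hf, hg, hne⟩ := h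
    refine (Set.toFinite {f, g}).subset fun k hk => ?_
    rcases borders_three hf hg hk with h | h | h
    exacts [absurd h hne, Or.inl h.symm, Or.inr h.symm]
  · push Not at h
    exact Set.Subsingleton.finite fun f hf g hg => h f g hf hg

lemma openArc_subset_region_of_borders {e : G.edgeSet} (he : e ∉ T) {f : D.Face} (hf : D.Borders e f)
    {x y : X} (hx : x ∈ f.1) (hxy : x ∈ D.region P T y) : D.openArc e ⊆ D.region P T y := by
  obtain ⟨z, hz⟩ := (D.isConnected_openArc e).nonempty
  exact subset_region_of_closure (D.isConnected_openArc e).isPreconnected hz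
    (closure_mono (f.subset_region hx hxy) (borders_iff.1 hf hz.1))
    (D.openArc_disjoint_occupied he)

lemma subset_region_of_dualGraph_adj {f g : D.Face} (h : (D.dualGraph Tᶜ).Adj f g) {x : X}
    (hf : f.1 ⊆ D.region P T x) : g.1 ⊆ D.region P T x := by
  obtain ⟨-, e, he, hef, heg⟩ := h
  obtain ⟨y, hy⟩ := f.nonempty
  have h1 := openArc_subset_region_of_borders he hef hy (hf hy)
  obtain ⟨z, hz⟩ := (D.isConnected_openArc e).nonempty
  obtain ⟨y', hy'1, hy'2⟩ := mem_closure_iff.1 (borders_iff.1 heg hz.1) _ (isOpen_region x) (h1 hz)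
  exact g.subset_region hy'2 hy'1

/-- Faces connected in the dual by edges outside `T` lie in the same region. -/
lemma subset_region_of_reachable {f g : D.Face} (h : (D.dualGraph Tᶜ).Reachable f g) {x : X}
    (hf : f.1 ⊆ D.region P T x) : g.1 ⊆ D.region P T x := by
  obtain ⟨p⟩ := h
  induction p with
  | nil => exact hf
  | cons h p ih => exact ih (subset_region_of_dualGraph_adj h hf)

/-- Faces in the same region are connected in the dual by edges outside `T`. -/
lemma reachable_of_connIn {f g : D.Face} {x y : X} (hx : x ∈ f.1) (hy : y ∈ g.1)
    (h : ConnIn (D.occupied P T)ᶜ x y) : (D.dualGraph Tᶜ).Reachable f g := by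
  have hxU := h.left_mem
  set O := D.region P T x with hO
  have hyO : y ∈ O := (mem_region_iff hxU).2 h
  -- Vertices are deleted because several faces can meet at one without sharing an edge. Off the
  -- vertices the faces near a point are either one face or border a common edge.
  set O' := O \ D.pos '' Set.univ with hO'
  have hO'c : IsPreconnected O' := IsPlane.isPreconnected_diff (isOpen_region x)
    (isPreconnected_region x) (D.vertices_discrete Set.univ)
  have hnot {f : D.Face} {z : X} (hz : z ∈ f.1) : z ∉ D.pos '' Set.univ := fun hz' =>
    (f.disjoint_occupied (P := Set.univ) (T := ∅)).notMem_of_mem_left hz (Or.inl hz')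
  -- Quantifying over all faces with `a` or `b` in their closure makes the relation meaningful on
  -- edges too. It composes because each intermediate point is in the closure of some face.
  let R : X → X → Prop := fun a b => ∀ f g : D.Face, a ∈ closure f.1 → b ∈ closure g.1 →
    (D.dualGraph Tᶜ).Reachable f g
  have hnear : ∀ a ∈ O', ∀ᶠ b in 𝓝[O'] a, R a b ∧ R b a := by
    intro a ha
    by_cases haU : a ∈ D.occupied Set.univ Set.univ
    · have haA : a ∈ ⋃ e ∈ Set.univ, D.arc e := haU.resolve_left ha.2
      obtain ⟨e, -, hae⟩ := Set.mem_iUnion₂.1 haA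
      have hao : a ∈ D.openArc e :=
        D.mem_openArc.2 ⟨hae, fun w hw => ha.2 ⟨w, Set.mem_univ w, hw⟩⟩
      have heT : e ∉ T := fun heT => region_subset x ha.1 (D.arc_subset_occupied heT hae)
      obtain ⟨B, -, hBo, haB, -, -, hB⟩ := exists_disc_borders hao univ_mem
      have hR : ∀ b ∈ B, ∀ c ∈ B, R b c := by
        intro b hb c hc f g hf hg
        by_cases hfg : f = g
        · rw [hfg]
        have hf' : D.Borders e f := hB f (by
          obtain ⟨z, h1, h2⟩ := mem_closure_iff.1 hf B hBo hb
          exact ⟨z, h2, h1⟩)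
        have hg' : D.Borders e g := hB g (by
          obtain ⟨z, h1, h2⟩ := mem_closure_iff.1 hg B hBo hc
          exact ⟨z, h2, h1⟩)
        exact SimpleGraph.Adj.reachable ⟨hfg, e, heT, hf', hg'⟩
      filter_upwards [mem_nhdsWithin_of_mem_nhds (hBo.mem_nhds haB)] with b hb
      exact ⟨hR a haB b hb, hR b hb a haB⟩
    · have key : ∀ b ∈ (D.faceOf a haU).1, ∀ f : D.Face, b ∈ closure f.1 → f = D.faceOf a haU := by
        intro b hb f hf
        obtain ⟨z, h1, h2⟩ := mem_closure_iff.1 hf _ (D.faceOf a haU).isOpen hb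
        exact Face.eq_of_mem h2 h1
      filter_upwards [mem_nhdsWithin_of_mem_nhds ((D.faceOf a haU).isOpen.mem_nhds
        (mem_faceOf haU))] with b hb
      constructor <;> intro f g hf hg
      · rw [key a (mem_faceOf haU) f hf, key b hb g hg]
      · rw [key b hb f hf, key a (mem_faceOf haU) g hg]
  have hR : R x y := hO'c.induction₂' R hnear (fun a b c _ hb _ hab hbc f g hf hg => by
    obtain ⟨k, hk⟩ := exists_mem_closure_face (D := D) (x := b)
      (fun w hw => hb.2 ⟨w, Set.mem_univ w, hw⟩)
    exact (hab f k hf hk).trans (hbc k g hk hg)) ⟨mem_region_self hxU, hnot hx⟩ ⟨hyO, hnot hy⟩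
  exact hR f g (subset_closure hx) (subset_closure hy)

end PlaneDrawing

end

section

open Filter Topology

/-! ### Cutsets of the dual graph -/

namespace IsPlane

variable {X : Type*} [TopologicalSpace X] [IsPlane X]

instance : LocallyPathConnectedSpace X :=
  (nonempty_homeomorph (X := X)).some.isOpenEmbedding.locallyPathConnectedSpace

instance : PathConnectedSpace X :=
  (nonempty_homeomorph (X := X)).some.symm.surjective.pathConnectedSpace
    (nonempty_homeomorph (X := X)).some.symm.continuous

lemma joinedIn_of_connIn {U : Set X} (hU : IsOpen U) {a b : X} (h : ConnIn U a b) :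
    JoinedIn U a b := by
  have ha := h.left_mem
  have hc : IsPathConnected (connectedComponentIn U a) :=
    hU.connectedComponentIn.isConnected_iff_isPathConnected.1
      (isConnected_connectedComponentIn_iff.2 ha)
  exact (hc.joinedIn a (mem_connectedComponentIn ha) b ((ConnIn.iff_mem ha).1 h)).mono
    (connectedComponentIn_subset _ _)

variable (X) in
/-- An exhaustion of the plane by open sets with compact closure and connected complement. -/
lemma exists_exhaustion : ∃ O : ℕ → Set X, Monotone O ∧ (∀ n, IsOpen (O n)) ∧
    (∀ n, ∃ K, IsCompact K ∧ O n ⊆ K) ∧ (∀ n, IsPathConnected (O n)ᶜ) ∧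
    ∀ K, IsCompact K → ∃ n, K ⊆ O n := by
  obtain ⟨φ⟩ := nonempty_homeomorph (X := X)
  refine ⟨fun n => φ ⁻¹' Metric.ball 0 n, fun m n h => Set.preimage_mono
    (Metric.ball_subset_ball (by exact_mod_cast h)), fun n => Metric.isOpen_ball.preimage
    φ.continuous, fun n => ⟨φ ⁻¹' Metric.closedBall 0 n, ?_, Set.preimage_mono
    Metric.ball_subset_closedBall⟩, fun n => ?_, fun K hK => ?_⟩
  · exact φ.isCompact_preimage.2 (isCompact_closedBall 0 _)
  · rw [← Set.preimage_compl, ← φ.image_symm]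
    have : (Metric.ball (0 : ℂ) n)ᶜ =
        (fun x : ℝ × ℝ => (x.1 : ℂ) * Complex.exp (x.2 * Complex.I)) ''
          (Set.Ici (n : ℝ) ×ˢ Set.univ) := by
      ext z
      simp only [Set.mem_compl_iff, Metric.mem_ball, dist_zero_right, not_lt, Set.mem_image,
        Prod.exists, Set.mem_prod, Set.mem_Ici, Set.mem_univ, and_true]
      constructor
      · intro h
        exact ⟨‖z‖, z.arg, h, Complex.norm_mul_exp_arg_mul_I z⟩
      · rintro ⟨r, t, hr, rfl⟩
        rw [norm_mul, Complex.norm_exp_ofReal_mul_I, mul_one, Complex.norm_real]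
        exact hr.trans (le_abs_self r)
    rw [this]
    refine IsPathConnected.image (IsPathConnected.image ?_ (by fun_prop)) φ.symm.continuous
    exact ((convex_Ici _).prod convex_univ).isPathConnected ⟨(n, 0), by simp⟩
  · obtain ⟨r, hr⟩ := (hK.image φ.continuous).isBounded.subset_ball 0
    obtain ⟨n, hn⟩ := exists_nat_ge r
    exact ⟨n, fun x hx => Metric.ball_subset_ball hn (hr ⟨x, hx, rfl⟩)⟩

end IsPlane

namespace SimpleGraph.Walk

variable {W : Type*} {G : SimpleGraph W}

/-- A cycle that is opened at an edge through its base point. -/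
lemma IsCycle.exists_cons_of_mem_edges {x y : W} {C : G.Walk x x} (hC : C.IsCycle)
    (he : s(x, y) ∈ C.edges) : ∃ (_ : G.Adj x y) (p : G.Walk y x), p.IsPath ∧
      s(x, y) ∉ p.edges ∧ ∀ e, e ∈ C.edges ↔ e = s(x, y) ∨ e ∈ p.edges := by
  have head {D : G.Walk x x} (hD : D.IsCycle) (hDe : ∃ (h : G.Adj x y) (p : G.Walk y x),
      D = cons h p) : ∃ (_ : G.Adj x y) (p : G.Walk y x), p.IsPath ∧
      s(x, y) ∉ p.edges ∧ ∀ e, e ∈ D.edges ↔ e = s(x, y) ∨ e ∈ p.edges := by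
    obtain ⟨h, p, rfl⟩ := hDe
    rw [cons_isCycle_iff] at hD
    exact ⟨h, p, hD.1, hD.2, fun e => by simp⟩
  cases C with
  | nil => simp at he
  | @cons _ v _ h p =>
    by_cases hv : v = y
    · subst hv
      exact head hC ⟨h, p, rfl⟩
    have hp := ((cons_isCycle_iff p h).1 hC).1
    -- If the edge is not the first of the cycle, it is the last: it contains the base point, and
    -- the tail is a path. The reversed cycle then starts with it.
    have hep : s(x, y) ∈ p.reverse.edges := by
      rw [edges_cons, List.mem_cons] at he
      rw [edges_reverse, List.mem_reverse]
      refine he.resolve_left fun h' => hv ?_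
      rw [Sym2.eq_iff] at h'
      rcases h' with h' | h'
      · exact h'.2.symm
      · exact absurd h'.1 h.ne
    have hrev : ∃ (h' : G.Adj x y) (q : G.Walk y v), p.reverse = cons h' q := by
      have hpr := hp.reverse
      revert hep hpr
      cases p.reverse with
      | nil => simp
      | @cons _ z _ h' q =>
        intro hep hpr
        rw [edges_cons, List.mem_cons] at hep
        rcases hep with hep | hep
        · have : y = z := by
            rw [Sym2.eq_iff] at hep
            rcases hep with h'' | h''
            · exact h''.2
            · exact absurd h''.1 h'.ne
          subst this
          exact ⟨h', q, rfl⟩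
        · exact absurd (q.fst_mem_support_of_mem_edges hep) ((cons_isPath_iff h' q).1 hpr).2
    obtain ⟨h', q, hq⟩ := hrev
    obtain ⟨k, r, h1, h2, h3⟩ := head hC.reverse ⟨h', q.append (cons h.symm nil), by
      rw [reverse_cons, hq, cons_append]⟩
    refine ⟨k, r, h1, h2, fun e => ?_⟩
    rw [← h3, edges_reverse, List.mem_reverse]

end SimpleGraph.Walk

end

/-! ### Paths, cycles and doubly-infinite paths as dual cutsets -/

section

open Filter Topology

namespace PlaneDrawing

variable {W : Type*} {G : SimpleGraph W} {X : Type*} [MetricSpace X] [ProperSpace X] [IsPlane X]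
  {D : PlaneDrawing G X} {P P' : Set W} {T T' : Set G.edgeSet}

/-- A pendant edge does not separate. -/
lemma connIn_insert_edge {u v : W} {h : G.Adj u v}
    (hu : D.pos u ∉ D.occupied P T) {a b : X} (hab : ConnIn (D.occupied P T)ᶜ a b)
    (ha : a ∉ D.arc ⟨s(u, v), h⟩) (hb : b ∉ D.arc ⟨s(u, v), h⟩) :
    ConnIn (D.occupied P (insert ⟨s(u, v), h⟩ T))ᶜ a b := by
  have he : (⟨s(u, v), h⟩ : G.edgeSet) ∉ T := fun he =>
    hu (D.arc_subset_occupied he (D.isArc h).left_mem)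
  rw [D.occupied_eq_union (Set.mem_insert _ _), Set.insert_sdiff_of_mem _ (Set.mem_singleton _),
    Set.sdiff_singleton_eq_self he]
  refine IsPlane.connIn_compl_union (D.isClosed_occupied P T) (D.isArc h).isCompact
    (p := D.pos v) ?_ hab (IsPlane.connIn_compl_arc (D.isArc h) ha hb)
  rintro x ⟨hx, hxe⟩
  have := D.occupied_inter_arc_subset (P := P) (T := T) h
  rw [Set.sdiff_singleton_eq_self he] at this
  rcases this ⟨hx, hxe⟩ with rfl | h
  exacts [absurd hx hu, h]

/-- The set of edges of a walk. -/
def walkEdges {u v : W} (p : G.Walk u v) : Set G.edgeSet := {e | (e : Sym2 W) ∈ p.edges}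

/-- A path does not separate. -/
lemma connIn_compl_path {u v : W} (p : G.Walk u v) (hp : p.IsPath) {a b : X}
    (ha : a ∉ D.occupied ∅ (walkEdges p))
    (hb : b ∉ D.occupied ∅ (walkEdges p)) :
    ConnIn (D.occupied ∅ (walkEdges p))ᶜ a b := by
  induction p with
  | @nil u =>
    have : D.occupied ∅ (walkEdges (.nil : G.Walk u u)) = ∅ := by
      simp [occupied, walkEdges]
    rw [this, Set.compl_empty]
    exact ConnIn.of_isPreconnected isPreconnected_univ (Set.mem_univ a) (Set.mem_univ b)
  | @cons u v w h p ih =>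
    rw [SimpleGraph.Walk.cons_isPath_iff] at hp
    have hT : walkEdges (.cons h p) =
        insert ⟨s(u, v), h⟩ (walkEdges p) := by
      ext e
      simp [walkEdges, Subtype.ext_iff]
    rw [hT] at ha hb ⊢
    have hsub := D.occupied_mono (P := ∅) subset_rfl
      (Set.subset_insert (⟨s(u, v), h⟩ : G.edgeSet) (walkEdges p))
    refine connIn_insert_edge ?_ (ih hp.1 (fun h => ha (hsub h)) (fun h => hb (hsub h)))
      (fun h' => ha (D.arc_subset_occupied (Set.mem_insert _ _) h'))
      (fun h' => hb (D.arc_subset_occupied (Set.mem_insert _ _) h'))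
    rintro (⟨_, h', -⟩ | h')
    · exact h'
    · obtain ⟨⟨e, heG⟩, he, hu⟩ := Set.mem_iUnion₂.1 h'
      have hue := D.mem_of_pos_mem_arc _ _ hu
      obtain ⟨z, rfl⟩ := Sym2.mem_iff_exists.1 hue
      exact hp.2 (p.fst_mem_support_of_mem_edges he)

/-- Reachability in the dual without `T` is connectedness of the complement of the edges in `T`.
Minimality follows because a subset of `T` that misses `e` separates no more than `T \ {e}`. -/
lemma isDualCutset_of_connIn (h₁ : ∃ a ∉ D.occupied ∅ T, ∃ b ∉ D.occupied ∅ T,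
      ¬ ConnIn (D.occupied ∅ T)ᶜ a b)
    (h₂ : ∀ e ∈ T, ∀ a ∉ D.occupied ∅ (T \ {e}), ∀ b ∉ D.occupied ∅ (T \ {e}),
      ConnIn (D.occupied ∅ (T \ {e}))ᶜ a b) : D.IsDualCutset T := by
  constructor
  · obtain ⟨a, ha, b, hb, hab⟩ := h₁
    obtain ⟨f, x, hxf, hx⟩ := exists_face_inter (D := D) (isOpen_region (D := D) (P := ∅) (T := T) a)
      ⟨a, mem_region_self ha⟩
    obtain ⟨g, y, hyg, hy⟩ := exists_face_inter (D := D) (isOpen_region (D := D) (P := ∅) (T := T) b)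
      ⟨b, mem_region_self hb⟩
    refine ⟨f, g, ?_, fun h => hab ?_⟩
    · rw [← Set.compl_empty]
      refine reachable_of_connIn (P := ∅) hxf hyg ?_
      have : D.occupied ∅ ∅ = ∅ := by simp [occupied]
      rw [this, Set.compl_empty]
      exact ConnIn.of_isPreconnected isPreconnected_univ (Set.mem_univ _) (Set.mem_univ _)
    · have := subset_region_of_reachable h (f.subset_region hxf hx) hyg
      exact ((mem_region_iff ha).1 this).trans ((mem_region_iff hb).1 hy).symm
  · rintro T' ⟨f, g, -, hfg⟩ hT' e he
    by_contra heT'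
    refine hfg ?_
    obtain ⟨x, hx⟩ := f.nonempty
    obtain ⟨y, hy⟩ := g.nonempty
    refine reachable_of_connIn (P := ∅) hx hy ?_
    refine (h₂ e he x (f.disjoint_occupied.notMem_of_mem_left hx) y
      (g.disjoint_occupied.notMem_of_mem_left hy)).mono ?_
    exact Set.compl_subset_compl.2 (D.occupied_mono subset_rfl
      fun e' he' => ⟨hT' he', fun h => heT' (h ▸ he')⟩)

/-- The edges of a cycle form a cutset of the dual. -/
lemma isDualCutset_of_isCycle {x : W} {C : G.Walk x x} (hC : C.IsCycle) :
    D.IsDualCutset (walkEdges C) := by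
  classical
  -- Every edge can be taken as the closing edge of the cycle. The path that is left joins its
  -- endpoints, which gives separation, and does not itself separate, which gives minimality.
  have key : ∀ e : G.edgeSet, (e : Sym2 W) ∈ C.edges → ∃ (u v : W) (h : G.Adj u v) (p : G.Walk v u),
      e = ⟨s(u, v), h⟩ ∧ p.IsPath ∧ ¬ p.Nil ∧
      walkEdges C \ ({e} : Set G.edgeSet) = walkEdges p := by
    intro e he
    obtain ⟨u, v, h, rfl⟩ := exists_isArc e
    have hu := C.fst_mem_support_of_mem_edges he
    obtain ⟨-, p, hp, h1, h2⟩ := (hC.rotate hu).exists_cons_of_mem_edges (y := v)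
      ((C.rotate_edges u hu).mem_iff.2 he)
    refine ⟨u, v, h, p, rfl, hp, ?_, ?_⟩
    · intro hn
      exact h.ne hn.eq.symm
    · ext e
      simp only [walkEdges, Set.mem_sdiff, Set.mem_ofPred_eq, Set.mem_singleton_iff, Subtype.ext_iff]
      rw [← (C.rotate_edges u hu).mem_iff, h2]
      constructor
      · rintro ⟨h3 | h3, h4⟩
        exacts [absurd h3 h4, h3]
      · intro h3
        exact ⟨Or.inr h3, fun h4 => h1 (h4 ▸ h3)⟩
  refine isDualCutset_of_connIn ?_ ?_
  · obtain ⟨e, he⟩ : ∃ e : G.edgeSet, (e : Sym2 W) ∈ C.edges := by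
      cases C with
      | nil => exact absurd rfl hC.ne_nil
      | cons h p => exact ⟨⟨_, G.mem_edgeSet.2 h⟩, by simp⟩
    obtain ⟨u, v, h, p, rfl, hp, hn, hpe⟩ := key e he
    have hj : JoinedIn (D.occupied ∅ (walkEdges C \ {(⟨s(u, v), h⟩ : G.edgeSet)}))
        (D.pos u) (D.pos v) := by
      rw [hpe]
      refine (joinedIn_of_walk p (fun e he => he) ?_).symm
      cases p with
      | nil => simp at hn
      | cons h' q =>
        have : (⟨_, G.mem_edgeSet.2 h'⟩ : G.edgeSet) ∈ walkEdges (.cons h' q) := by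
          simp [walkEdges]
        exact D.arc_subset_occupied this
          (D.isArc h').left_mem
    obtain ⟨a, ha, b, hb, -, -, hab⟩ := exists_regions_along he hj
    exact ⟨a, ha, b, hb, hab⟩
  · intro e he a ha b hb
    obtain ⟨u, v, h, p, rfl, hp, hn, hpe⟩ := key e he
    rw [hpe] at ha hb ⊢
    exact connIn_compl_path p hp ha hb

section Line

variable {c : ℤ → W} (hc : Function.Injective c) (hadj : ∀ i, G.Adj (c i) (c (i + 1)))

/-- The `i`-th edge of a doubly-infinite path. -/
def lineEdge (hadj : ∀ i, G.Adj (c i) (c (i + 1))) (i : ℤ) : G.edgeSet :=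
  ⟨s(c i, c (i + 1)), hadj i⟩

include hc in
lemma lineEdge_injective : Function.Injective (lineEdge hadj) := by
  intro i j h
  have h' : s(c i, c (i + 1)) = s(c j, c (j + 1)) := congrArg Subtype.val h
  rw [Sym2.eq_iff] at h'
  rcases h' with h' | h'
  · exact hc h'.1
  · have h1 := hc h'.1
    have h2 := hc h'.2
    omega

include hc in
omit [ProperSpace X] [IsPlane X] in
lemma pos_notMem_lineEdges {S : Set ℤ} {i : ℤ} (h₁ : i ∉ S) (h₂ : i - 1 ∉ S) :
    D.pos (c i) ∉ D.occupied ∅ (lineEdge hadj '' S) := by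
  rintro (⟨_, h', -⟩ | h')
  · exact h'
  · obtain ⟨_, ⟨j, hj, rfl⟩, h'⟩ := Set.mem_iUnion₂.1 h'
    rcases Sym2.mem_iff.1 (D.mem_of_pos_mem_arc _ _ h') with h | h
    · exact h₁ (hc h ▸ hj)
    · have := hc h
      exact h₂ (by rwa [this, add_sub_cancel_right])

include hc in
omit [ProperSpace X] [IsPlane X] in
/-- Far edges of a doubly-infinite path avoid a given compact set. -/
lemma exists_lineEdge_bound {K : Set X} (hK : IsCompact K) :
    ∃ N : ℤ, 0 ≤ N ∧ ∀ i, (D.arc (lineEdge hadj i) ∩ K).Nonempty → -N < i ∧ i < N := by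
  have hfin : {i : ℤ | (D.arc (lineEdge hadj i) ∩ K).Nonempty}.Finite :=
    Set.Finite.preimage (f := lineEdge hadj) (lineEdge_injective hc hadj).injOn (D.proper K hK).2
  obtain ⟨u, hu⟩ := hfin.bddAbove
  obtain ⟨l, hl⟩ := hfin.bddBelow
  refine ⟨max (|u| + 1) (|l| + 1), by positivity, fun i hi => ?_⟩
  have h1 := hu hi
  have h2 := hl hi
  have h3 := le_abs_self u
  have h4 := neg_abs_le l
  have h5 := le_max_left (|u| + 1) (|l| + 1)
  have h6 := le_max_right (|u| + 1) (|l| + 1)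
  constructor <;> linarith

include hc in
/-- A doubly-infinite path from which an edge is removed does not separate. -/
lemma connIn_compl_line_diff (k : ℤ) {a b : X}
    (ha : a ∉ D.occupied ∅ (lineEdge hadj '' {k}ᶜ))
    (hb : b ∉ D.occupied ∅ (lineEdge hadj '' {k}ᶜ)) :
    ConnIn (D.occupied ∅ (lineEdge hadj '' {k}ᶜ))ᶜ a b := by
  have hna {j : ℤ} (hj : j ≠ k) : a ∉ D.arc (lineEdge hadj j) := fun h =>
    ha (D.arc_subset_occupied (Set.mem_image_of_mem _ hj) h)
  have hnb {j : ℤ} (hj : j ≠ k) : b ∉ D.arc (lineEdge hadj j) := fun h =>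
    hb (D.arc_subset_occupied (Set.mem_image_of_mem _ hj) h)
  obtain ⟨γ⟩ := PathConnectedSpace.joined (X := X) a b
  obtain ⟨N, hN0, hN⟩ := exists_lineEdge_bound (D := D) hc hadj (isCompact_range γ.continuous)
  -- Large enough that the edges beyond `R` on either side avoid the path from `a` to `b`, and that
  -- `k` lies strictly between `-R` and `R`.
  set R : ℤ := N + |k| + 1 with hR
  have hk1 := le_abs_self k
  have hk2 := neg_abs_le k
  -- The two far rays are prolonged edge by edge towards the gap at `k`. Each new edge is pendant,
  -- since its inner endpoint is not yet covered.
  let good (l r : ℤ) : Prop := ConnIn (D.occupied ∅ (lineEdge hadj '' {i | i < l ∨ r ≤ i}))ᶜ a b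
  have base : good (-R) R := by
    refine ⟨Set.range γ, ?_, isPreconnected_range γ.continuous, ⟨0, γ.source⟩, ⟨1, γ.target⟩⟩
    rintro x hx (⟨_, h', -⟩ | h')
    · exact h'
    · obtain ⟨_, ⟨j, hj, rfl⟩, h'⟩ := Set.mem_iUnion₂.1 h'
      have := hN j ⟨x, h', hx⟩
      have := abs_nonneg k
      rcases hj with hj | hj <;> linarith
  have left : ∀ l, -R ≤ l → l ≤ k → good l R := by
    intro l hl
    induction l, hl using Int.leInduction with
    | base => exact fun _ => base
    | succ l hl ih =>
      intro hlk
      have hu : D.pos (c (l + 1)) ∉ D.occupied ∅ (lineEdge hadj '' {i | i < l ∨ R ≤ i}) := by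
        apply pos_notMem_lineEdges hc hadj <;> simp only [Set.mem_ofPred_eq] <;> omega
      have he : lineEdge hadj l = ⟨s(c (l + 1), c l), (hadj l).symm⟩ := Subtype.ext Sym2.eq_swap
      have := connIn_insert_edge (h := (hadj l).symm) hu (ih (by omega))
        (he ▸ hna (by omega)) (he ▸ hnb (by omega))
      rw [← he, ← Set.image_insert_eq] at this
      refine this.mono (Set.compl_subset_compl.2 (D.occupied_mono subset_rfl (Set.image_mono ?_)))
      intro i hi
      simp only [Set.mem_insert_iff, Set.mem_ofPred_eq] at hi ⊢
      omega
  have right : ∀ r, r ≤ R → k + 1 ≤ r → good k r := by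
    intro r hr
    induction r, hr using Int.leInductionDown with
    | base => exact fun _ => left k (by omega) le_rfl
    | pred r hr ih =>
      intro hrk
      have hu : D.pos (c (r - 1)) ∉ D.occupied ∅ (lineEdge hadj '' {i | i < k ∨ r ≤ i}) := by
        apply pos_notMem_lineEdges hc hadj <;> simp only [Set.mem_ofPred_eq] <;> omega
      have := connIn_insert_edge (h := hadj (r - 1)) hu (ih (by omega))
        (hna (by omega)) (hnb (by omega))
      change ConnIn (D.occupied ∅ (insert (lineEdge hadj (r - 1)) _))ᶜ a b at this
      rw [← Set.image_insert_eq] at this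
      refine this.mono (Set.compl_subset_compl.2 (D.occupied_mono subset_rfl (Set.image_mono ?_)))
      intro i hi
      simp only [Set.mem_insert_iff, Set.mem_ofPred_eq] at hi ⊢
      omega
  refine (right (k + 1) (by omega) le_rfl).mono
    (Set.compl_subset_compl.2 (D.occupied_mono subset_rfl (Set.image_mono ?_)))
  intro i (hi : i ≠ k)
  simp only [Set.mem_ofPred_eq]
  omega

omit [ProperSpace X] [IsPlane X] in
lemma isArc_lineEdge {i j : ℤ} (h : j = i + 1) :
    IsArc (D.pos (c i)) (D.pos (c j)) (D.arc (lineEdge hadj i)) := by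
  subst h
  exact D.isArc (hadj i)

omit [ProperSpace X] [IsPlane X] in
lemma arc_lineEdge_subset {i : ℤ} (hi : i ≠ 0) :
    D.arc (lineEdge hadj i) ⊆ D.occupied ∅ (lineEdge hadj '' {0}ᶜ) :=
  D.arc_subset_occupied (Set.mem_image_of_mem _ hi)

omit [ProperSpace X] [IsPlane X] in
lemma joinedIn_line_right (m : ℕ) : JoinedIn (D.occupied ∅ (lineEdge hadj '' {0}ᶜ))
    (D.pos (c 1)) (D.pos (c (1 + m))) := by
  induction m with
  | zero =>
    simp only [Nat.cast_zero, add_zero]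
    exact JoinedIn.refl (arc_lineEdge_subset hadj one_ne_zero (isArc_lineEdge hadj rfl).left_mem)
  | succ m ih =>
    exact ih.trans ((isArc_lineEdge hadj (by push_cast; ring)).joinedIn.mono
      (arc_lineEdge_subset hadj (by omega)))

omit [ProperSpace X] [IsPlane X] in
lemma joinedIn_line_left (m : ℕ) : JoinedIn (D.occupied ∅ (lineEdge hadj '' {0}ᶜ))
    (D.pos (c 0)) (D.pos (c (-m))) := by
  induction m with
  | zero =>
    simp only [Nat.cast_zero, neg_zero]
    exact JoinedIn.refl (arc_lineEdge_subset hadj (i := -1) (by omega)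
      (isArc_lineEdge hadj (by omega)).right_mem)
  | succ m ih =>
    exact ih.trans ((isArc_lineEdge hadj (by push_cast; ring)).joinedIn.symm.mono
      (arc_lineEdge_subset hadj (by omega)))

include hc in
omit [ProperSpace X] [IsPlane X] in
lemma exists_pos_line_notMem {K : Set X} (hK : IsCompact K) (g : ℕ → ℤ)
    (hg : Function.Injective g) : ∃ m : ℕ, D.pos (c (g m)) ∉ K := by
  by_contra! h
  refine Set.infinite_univ (α := ℕ) ?_
  refine (Set.Finite.preimage (f := fun m => c (g m)) (hc.comp hg).injOn (D.proper K hK).1).subset ?_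
  exact fun m _ => h m

include hc in
/-- A doubly-infinite path separates. -/
lemma exists_not_connIn_compl_line : ∃ a ∉ D.occupied ∅ (Set.range (lineEdge hadj)),
    ∃ b ∉ D.occupied ∅ (Set.range (lineEdge hadj)),
      ¬ ConnIn (D.occupied ∅ (Set.range (lineEdge hadj)))ᶜ a b := by
  obtain ⟨O, hOm, hOo, hOc, hOp, hOK⟩ := IsPlane.exists_exhaustion X
  set e := D.arc (lineEdge hadj 0) with he
  set L := D.occupied ∅ (lineEdge hadj '' {0}ᶜ) with hL
  have harc : IsArc (D.pos (c 0)) (D.pos (c 1)) e :=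
    isArc_lineEdge hadj (by norm_num)
  have hrange : Set.range (lineEdge hadj) \ {lineEdge hadj 0} = lineEdge hadj '' {0}ᶜ := by
    rw [← Set.image_univ, ← Set.image_singleton, ← Set.image_sdiff (lineEdge_injective hc hadj),
      Set.compl_eq_univ_sdiff]
  have hLe : D.occupied ∅ (Set.range (lineEdge hadj)) = L ∪ e := by
    rw [D.occupied_eq_union (Set.mem_range_self 0), hrange]
  have hLe' : L ∩ e ⊆ {D.pos (c 0), D.pos (c 1)} := by
    have := D.occupied_inter_arc_subset (P := ∅) (T := Set.range (lineEdge hadj)) (hadj 0)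
    change D.occupied ∅ (Set.range (lineEdge hadj) \ {lineEdge hadj 0}) ∩ e ⊆ _ at this
    rw [hrange] at this
    simpa using this
  obtain ⟨n₀, hn₀⟩ := hOK e harc.isCompact
  -- Outside the large disc the two ends of the path are linked, so the zeroth edge closes a curve.
  have hjoin : ∀ n, JoinedIn (L ∪ (O n)ᶜ) (D.pos (c 0)) (D.pos (c 1)) := by
    intro n
    obtain ⟨K, hK, hOnK⟩ := hOc n
    obtain ⟨m, hm⟩ := exists_pos_line_notMem (D := D) hc hK (fun m : ℕ => 1 + (m : ℤ))
      (fun m n h => by simpa using h)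
    obtain ⟨m', hm'⟩ := exists_pos_line_notMem (D := D) hc hK (fun m : ℕ => -(m : ℤ))
      (fun m n h => by simpa using h)
    refine ((joinedIn_line_left (D := D) hadj m').mono Set.subset_union_left).trans
      (JoinedIn.trans ?_ ((joinedIn_line_right (D := D) hadj m).symm.mono Set.subset_union_left))
    exact ((hOp n).joinedIn _ (fun h => hm' (hOnK h)) _ (fun h => hm (hOnK h))).mono
      Set.subset_union_right
  have hKe : ∀ n ≥ n₀, (L ∪ (O n)ᶜ) ∩ e ⊆ {D.pos (c 0), D.pos (c 1)} := by
    rintro n hn x ⟨hx | hx, hxe⟩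
    exacts [hLe' ⟨hx, hxe⟩, absurd (hOm hn (hn₀ hxe)) hx]
  have hKc : ∀ n, IsClosed (L ∪ (O n)ᶜ) := fun n =>
    (D.isClosed_occupied _ _).union (hOo n).isClosed_compl
  obtain ⟨x, hx⟩ := (D.isConnected_openArc (lineEdge hadj 0)).nonempty
  have hxe : x ∈ e := hx.1
  have hxK : x ∉ L ∪ (O n₀)ᶜ := by
    rintro (h | h)
    · refine (D.openArc_disjoint_occupied (e := lineEdge hadj 0) ?_).notMem_of_mem_left hx h
      rintro ⟨i, hi, h⟩
      exact hi (lineEdge_injective hc hadj h)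
    · exact h (hn₀ hxe)
  obtain ⟨B, hBK, hBo, hxB, hB, -⟩ := IsPlane.exists_disc ((hKc n₀).isOpen_compl.mem_nhds hxK)
  have hanti : ∀ n ≥ n₀, L ∪ (O n)ᶜ ⊆ L ∪ (O n₀)ᶜ := fun n hn =>
    Set.union_subset_union_right _ (Set.compl_subset_compl.2 (hOm hn))
  -- The separated points are taken in one disc `B` that does not depend on `n`, so that different
  -- levels can be compared.
  have key : ∀ n ≥ n₀, ∃ a ∈ B, ∃ b ∈ B, a ∉ e ∧ b ∉ e ∧ ¬ ConnIn ((L ∪ (O n)ᶜ) ∪ e)ᶜ a b := by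
    intro n hn
    obtain ⟨a, ha, b, hb, hae, hbe, hab⟩ :=
      IsPlane.exists_components_along_arc (hKc n) harc (hKe n hn) (hjoin n)
    obtain ⟨a', haB, ha'⟩ := mem_closure_iff.1 (hae hxe) B hBo hxB
    obtain ⟨b', hbB, hb'⟩ := mem_closure_iff.1 (hbe hxe) B hBo hxB
    refine ⟨a', haB, b', hbB, fun h => connectedComponentIn_subset _ _ ha' (Or.inr h),
      fun h => connectedComponentIn_subset _ _ hb' (Or.inr h), fun h => hab ?_⟩
    exact (((ConnIn.iff_mem ha).2 ha').trans h).trans ((ConnIn.iff_mem hb).2 hb').symm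
  -- At level `n₀` the points of `B` off the edge form at most two classes, those of `a₀` and `b₀`.
  have three : ∀ a ∈ B, ∀ b ∈ B, ∀ d ∈ B, a ∉ e → b ∉ e → d ∉ e →
      ConnIn ((L ∪ (O n₀)ᶜ) ∪ e)ᶜ a b ∨ ConnIn ((L ∪ (O n₀)ᶜ) ∪ e)ᶜ a d ∨
        ConnIn ((L ∪ (O n₀)ᶜ) ∪ e)ᶜ b d := by
    intro a ha b hb d hd hae hbe hde
    exact IsPlane.connIn_compl_union_arc_of_three (hKc n₀) harc (hKe n₀ le_rfl) hae hbe hde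
      ⟨B, hBK, hB, ha, hb⟩ ⟨B, hBK, hB, ha, hd⟩
  obtain ⟨a₀, ha₀, b₀, hb₀, hae₀, hbe₀, hab₀⟩ := key n₀ le_rfl
  have hBL : ∀ y ∈ B, y ∉ e → y ∉ D.occupied ∅ (Set.range (lineEdge hadj)) := by
    intro y hy hye h
    rw [hLe] at h
    exact h.elim (fun h => hBK hy (Or.inl h)) hye
  refine ⟨a₀, hBL _ ha₀ hae₀, b₀, hBL _ hb₀ hbe₀, fun hcon => ?_⟩
  obtain ⟨γ, hγ⟩ := IsPlane.joinedIn_of_connIn (D.isOpen_compl_occupied _ _) hcon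
  obtain ⟨n₁, hn₁⟩ := hOK _ (isCompact_range γ.continuous)
  -- A path joining `a₀` to `b₀` off the line lies in `O n`, so at level `n` the two classes merge.
  -- That contradicts the separation inside `B` at that level.
  set n := max n₀ n₁
  have hn : n ≥ n₀ := le_max_left _ _
  have hab : ConnIn ((L ∪ (O n)ᶜ) ∪ e)ᶜ a₀ b₀ := by
    refine ⟨Set.range γ, ?_, isPreconnected_range γ.continuous, ⟨0, γ.source⟩, ⟨1, γ.target⟩⟩
    rintro _ ⟨t, rfl⟩ ((h | h) | h)
    · exact hγ t (hLe ▸ Or.inl h)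
    · exact h (hOm (le_max_right n₀ n₁) (hn₁ ⟨t, rfl⟩))
    · exact hγ t (hLe ▸ Or.inr h)
  obtain ⟨a, ha, b, hb, hae, hbe, hab'⟩ := key n hn
  have hmono : ∀ y z, ConnIn ((L ∪ (O n₀)ᶜ) ∪ e)ᶜ y z → ConnIn ((L ∪ (O n)ᶜ) ∪ e)ᶜ y z :=
    fun y z h => h.mono (Set.compl_subset_compl.2 (Set.union_subset_union_left _ (hanti n hn)))
  have h1 := three a₀ ha₀ a ha b hb hae₀ hae hbe
  have h2 := three b₀ hb₀ a ha b hb hbe₀ hae hbe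
  rcases h1 with h1 | h1 | h1
  · rcases h2 with h2 | h2 | h2
    · exact hab₀ (h1.trans h2.symm)
    · exact hab' (((hmono _ _ h1).symm.trans hab).trans (hmono _ _ h2))
    · exact hab' (hmono _ _ h2)
  · rcases h2 with h2 | h2 | h2
    · exact hab' (((hmono _ _ h2).symm.trans hab.symm).trans (hmono _ _ h1))
    · exact hab₀ (h1.trans h2.symm)
    · exact hab' (hmono _ _ h2)
  · exact hab' (hmono _ _ h1)

include hc in
/-- The edges of a doubly-infinite path form a cutset of the dual. -/
lemma isDualCutset_line : D.IsDualCutset (Set.range (lineEdge hadj)) := by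
  refine isDualCutset_of_connIn (exists_not_connIn_compl_line hc hadj) ?_
  rintro _ ⟨k, rfl⟩
  have hrange : Set.range (lineEdge hadj) \ {lineEdge hadj k} = lineEdge hadj '' {k}ᶜ := by
    rw [← Set.image_univ, ← Set.image_singleton, ← Set.image_sdiff (lineEdge_injective hc hadj),
      Set.compl_eq_univ_sdiff]
  rw [hrange]
  exact fun a ha b hb => connIn_compl_line_diff hc hadj k ha hb

end Line

end PlaneDrawing

end

section

open Filter Topology

/-! ### The Euclidean and the hyperbolic plane -/

/-- The upper half-plane is homeomorphic to the plane. -/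
noncomputable def UpperHalfPlane.homeomorphComplex : UpperHalfPlane ≃ₜ ℂ where
  toFun z := ⟨z.re, Real.log z.im⟩
  invFun w := ⟨⟨w.re, Real.exp w.im⟩, Real.exp_pos _⟩
  left_inv z := by
    apply UpperHalfPlane.ext
    apply Complex.ext
    · rfl
    · exact Real.exp_log z.im_pos
  right_inv w := Complex.ext rfl (Real.log_exp _)
  continuous_toFun := by
    have h1 : Continuous fun z : UpperHalfPlane => Real.log z.im :=
      UpperHalfPlane.continuous_im.log fun z => z.im_pos.ne'
    have h2 : Continuous fun z : UpperHalfPlane => z.re := UpperHalfPlane.continuous_re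
    exact Complex.equivRealProdCLM.symm.continuous.comp (h2.prodMk h1)
  continuous_invFun := by
    rw [UpperHalfPlane.isEmbedding_coe.continuous_iff]
    exact Complex.equivRealProdCLM.symm.continuous.comp
      (Complex.continuous_re.prodMk (Real.continuous_exp.comp Complex.continuous_im))

/-- The plane enters the later arguments through its topology and through compactness of closed
balls. -/
lemma isPlane_of_isometryEquiv {X : Type*} [MetricSpace X]
    (hX : Nonempty (X ≃ᵢ EuclideanSpace ℝ (Fin 2)) ∨ Nonempty (X ≃ᵢ UpperHalfPlane)) :
    ProperSpace X ∧ IsPlane X := by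
  rcases hX with ⟨⟨φ⟩⟩ | ⟨⟨φ⟩⟩
  · exact ⟨φ.symm.isometry.antilipschitz.properSpace φ.symm.continuous φ.symm.surjective,
      ⟨⟨φ.toHomeomorph.trans
      Complex.orthonormalBasisOneI.repr.symm.toHomeomorph⟩⟩⟩
  · exact ⟨φ.symm.isometry.antilipschitz.properSpace φ.symm.continuous φ.symm.surjective,
      ⟨⟨φ.toHomeomorph.trans UpperHalfPlane.homeomorphComplex⟩⟩⟩

instance {X : Type*} [TopologicalSpace X] [IsPlane X] : NoncompactSpace X := by
  obtain ⟨φ⟩ := IsPlane.nonempty_homeomorph (X := X)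
  exact φ.symm.isClosedEmbedding.noncompactSpace

namespace IsPlane

variable {X : Type*} [MetricSpace X] [ProperSpace X] [IsPlane X]

lemma not_isBounded_univ : ¬ Bornology.IsBounded (Set.univ : Set X) := fun h =>
  noncompact_univ X (by simpa using h.isCompact_closure)

lemma frontier_nonempty {f : Set X} (hf : f.Nonempty) (hb : Bornology.IsBounded f) :
    (frontier f).Nonempty := by
  by_contra h
  rw [Set.not_nonempty_iff_eq_empty, ← isClopen_iff_frontier_eq_empty, isClopen_iff] at h
  rcases h with rfl | rfl
  exacts [Set.not_nonempty_empty hf, not_isBounded_univ hb]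

/-- An unbounded open set with bounded frontier contains the complement of a compact set. -/
lemma exists_compact_compl_subset {f : Set X} (hf : IsOpen f)
    (hb : ¬ Bornology.IsBounded f)
    (hfr : Bornology.IsBounded (frontier f)) : ∃ K, IsCompact K ∧ Kᶜ ⊆ f := by
  obtain ⟨O, -, -, hOc, hOp, hOK⟩ := IsPlane.exists_exhaustion X
  obtain ⟨n, hn⟩ := hOK _ hfr.isCompact_closure
  obtain ⟨K, hK, hOnK⟩ := hOc n
  refine ⟨K, hK, (Set.compl_subset_compl.2 hOnK).trans ?_⟩
  have h1 : ((O n)ᶜ ∩ f).Nonempty := by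
    by_contra h
    rw [Set.not_nonempty_iff_eq_empty, ← Set.disjoint_iff_inter_eq_empty,
      Set.disjoint_compl_left_iff_subset] at h
    exact hb (hK.isBounded.subset (h.trans hOnK))
  by_contra h2
  have h3 : ((O n)ᶜ ∩ fᶜ).Nonempty := by
    obtain ⟨x, hx, hxf⟩ := Set.not_subset.1 h2
    exact ⟨x, hx, hxf⟩
  have h4 : ∀ x ∈ (O n)ᶜ, x ∉ f → x ∉ closure f := fun x hx hxf hxc =>
    hx (hn (subset_closure (hf.frontier_eq ▸ ⟨hxc, hxf⟩)))
  obtain ⟨x, hx, hxf, hxc⟩ := (hOp n).isConnected.isPreconnected f (closure f)ᶜ hf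
    isClosed_closure.isOpen_compl
    (fun x hx => (em (x ∈ f)).imp id (h4 x hx)) h1
    (h3.mono fun x hx => ⟨hx.1, h4 x hx.1 hx.2⟩)
  exact hxc (subset_closure hxf)

end IsPlane

/-! ### Bounded faces, and faces of induced subgraphs -/

namespace PlaneDrawing

variable {W : Type*} {G : SimpleGraph W} {X : Type*} [MetricSpace X] [ProperSpace X] [IsPlane X]
  {D : PlaneDrawing G X}

omit [ProperSpace X] [IsPlane X] in
lemma pos_or_openArc_of_mem_occupied {P : Set W} {T : Set G.edgeSet} {x : X}
    (hx : x ∈ D.occupied P T) : (∃ w, D.pos w = x) ∨ ∃ e ∈ T, x ∈ D.openArc e := by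
  by_cases h : ∃ w, D.pos w = x
  · exact Or.inl h
  · push Not at h
    rcases hx with ⟨w, -, hw⟩ | hx
    · exact absurd hw (h w)
    · obtain ⟨e, he, hxe⟩ := Set.mem_iUnion₂.1 hx
      exact Or.inr ⟨e, he, D.mem_openArc.2 ⟨hxe, h⟩⟩

lemma Face.frontier_subset (f : D.Face) : frontier f.1 ⊆ D.occupied Set.univ Set.univ := by
  intro x hx
  by_contra h
  have h1 := (D.faceOf x h).isOpen
  have h2 := mem_faceOf (D := D) h
  obtain ⟨y, hy1, hy2⟩ := mem_closure_iff.1 (frontier_subset_closure hx) _ h1 h2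
  rw [Face.eq_of_mem hy1 hy2] at h2
  rw [f.isOpen.frontier_eq] at hx
  exact hx.2 h2

lemma exists_borders_of_isBounded (hinc : ∀ w, ∃ w', G.Adj w w') {f : D.Face}
    (hf : Bornology.IsBounded f.1) : ∃ e, D.Borders e f := by
  obtain ⟨x, hx⟩ := IsPlane.frontier_nonempty f.nonempty hf
  have hxc := frontier_subset_closure hx
  rcases pos_or_openArc_of_mem_occupied (f.frontier_subset hx) with ⟨w, rfl⟩ | ⟨e, -, he⟩
  · obtain ⟨w', hw'⟩ := hinc w
    obtain ⟨y, hy⟩ := f.nonempty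
    rw [f.eq_region hy] at hxc
    obtain ⟨e, -, -, he⟩ := exists_arc_subset_closure_of_pos (Set.mem_univ ⟨s(w, w'), hw'⟩)
      (Sym2.mem_mk_left w w') hxc
    exact ⟨e, borders_iff.2 (by rwa [f.eq_region hy])⟩
  · exact ⟨e, borders_of_mem_openArc he hxc⟩

omit [ProperSpace X] [IsPlane X] in
lemma finite_incident (D : PlaneDrawing G X) (w : W) : {e : G.edgeSet | w ∈ (e : Sym2 W)}.Finite :=
  (D.proper {D.pos w} isCompact_singleton).2.subset fun _ he => ⟨D.pos w, D.pos_mem_arc_iff.2 he, rfl⟩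

lemma finite_faces_at (hinc : ∀ w, ∃ w', G.Adj w w') (w : W) :
    {f : D.Face | D.pos w ∈ closure f.1}.Finite := by
  refine ((D.finite_incident w).biUnion fun e _ => finite_borders (D := D) e).subset ?_
  intro f hf
  obtain ⟨w', hw'⟩ := hinc w
  obtain ⟨y, hy⟩ := f.nonempty
  have hf' : D.pos w ∈ closure f.1 := hf
  rw [f.eq_region hy] at hf'
  obtain ⟨e, -, hwe, he⟩ := exists_arc_subset_closure_of_pos (Set.mem_univ ⟨s(w, w'), hw'⟩)
    (Sym2.mem_mk_left w w') hf'
  exact Set.mem_biUnion hwe (borders_iff.2 (by rwa [f.eq_region hy]))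

/-- A face with finitely many vertices on its boundary is bounded. -/
lemma Face.isBounded [Infinite W] (f : D.Face) (hf : {w | D.VertexOnBoundary w f}.Finite) :
    Bornology.IsBounded f.1 := by
  have hE : {e : G.edgeSet | D.Borders e f}.Finite := by
    refine (hf.biUnion fun w _ => D.finite_incident w).subset fun e he => ?_
    obtain ⟨u, v, h, rfl⟩ := exists_isArc e
    refine Set.mem_biUnion (x := u) ?_ (Sym2.mem_mk_left u v)
    exact vertexOnBoundary_iff.2 (borders_iff.1 he (D.isArc h).left_mem)
  have hfr : Bornology.IsBounded (frontier f.1) := by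
    have hK : IsCompact (D.pos '' {w | D.VertexOnBoundary w f} ∪
        ⋃ e ∈ {e : G.edgeSet | D.Borders e f}, D.arc e) := by
      refine (hf.image _).isCompact.union (hE.isCompact_biUnion fun e _ => ?_)
      obtain ⟨u, v, h, rfl⟩ := exists_isArc e
      exact (D.isArc h).isCompact
    refine hK.isBounded.subset fun x hx => ?_
    rcases pos_or_openArc_of_mem_occupied (f.frontier_subset hx) with ⟨w, rfl⟩ | ⟨e, -, he⟩
    · exact Or.inl ⟨w, hx, rfl⟩
    · exact Or.inr (Set.mem_biUnion (borders_of_mem_openArc he (frontier_subset_closure hx)) he.1)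
  -- An unbounded face with bounded frontier would contain the complement of a compact set, leaving
  -- room for only finitely many vertices.
  by_contra hb
  obtain ⟨K, hK, hKf⟩ := IsPlane.exists_compact_compl_subset f.isOpen hb hfr
  refine Set.infinite_univ ((D.proper K hK).1.subset fun w _ => ?_)
  by_contra h
  exact (f.disjoint_occupied (P := Set.univ) (T := Set.univ)).le_bot
    ⟨hKf h, D.pos_mem_occupied (Set.mem_univ w)⟩

section FacesOfSubgraph

variable {S : Set W} {F : Set X} (hF : F ∈ D.facesOf S)

/-- The edges of the subgraph induced by `S`. -/
abbrev inducedEdges (G : SimpleGraph W) (S : Set W) : Set G.edgeSet :=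
  {e | ∀ w ∈ (e : Sym2 W), w ∈ S}

include hF

omit [ProperSpace X] [IsPlane X] in
lemma facesOf.eq_region {x : X} (hx : x ∈ F) :
    F = D.region S (inducedEdges G S) x ∧ x ∉ D.occupied S (inducedEdges G S) := by
  obtain ⟨y, hy, rfl⟩ := hF
  exact ⟨connectedComponentIn_eq hx, connectedComponentIn_subset _ _ hx⟩

omit [ProperSpace X] [IsPlane X] in
lemma facesOf.nonempty : F.Nonempty := by
  obtain ⟨y, hy, rfl⟩ := hF
  exact ⟨y, mem_connectedComponentIn hy⟩

lemma facesOf.isOpen : IsOpen F := by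
  obtain ⟨x, hx⟩ := facesOf.nonempty hF
  rw [(facesOf.eq_region hF hx).1]
  exact isOpen_region x

lemma facesOf.exists_face : ∃ f : D.Face, f.1 ⊆ F := by
  obtain ⟨x, hx⟩ := facesOf.nonempty hF
  obtain ⟨f, y, hyf, hyF⟩ := exists_face_inter (D := D) (facesOf.isOpen hF) ⟨x, hx⟩
  refine ⟨f, ?_⟩
  rw [(facesOf.eq_region hF hyF).1]
  exact f.subset_region hyf (mem_region_self (facesOf.eq_region hF hyF).2)

omit [ProperSpace X] [IsPlane X] in
lemma facesOf.subset_of_inter {C : Set X} (hC : IsPreconnected C) (h : (C ∩ F).Nonempty)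
    (hd : Disjoint C (D.occupied S (inducedEdges G S))) : C ⊆ F := by
  obtain ⟨x, hxC, hxF⟩ := h
  rw [(facesOf.eq_region hF hxF).1]
  exact subset_region hC hxC hd

omit [ProperSpace X] [IsPlane X] in
lemma facesOf.subset_of_closure_inter {C : Set X} (hC : IsPreconnected C)
    (h : (C ∩ closure F).Nonempty)
    (hd : Disjoint C (D.occupied S (inducedEdges G S))) : C ⊆ F := by
  obtain ⟨x, hxC, hxF⟩ := h
  obtain ⟨y, hy⟩ := facesOf.nonempty hF
  rw [(facesOf.eq_region hF hy).1] at hxF ⊢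
  exact subset_region_of_closure hC hxC hxF hd

omit [ProperSpace X] [IsPlane X] in
lemma facesOf.face_subset {f : D.Face} (h : (f.1 ∩ F).Nonempty) : f.1 ⊆ F :=
  facesOf.subset_of_inter hF f.isPreconnected h f.disjoint_occupied

lemma facesOf.reachable {f g : D.Face} (hf : f.1 ⊆ F) (hg : g.1 ⊆ F) :
    (D.dualGraph (inducedEdges G S)ᶜ).Reachable f g := by
  obtain ⟨x, hx⟩ := f.nonempty
  obtain ⟨y, hy⟩ := g.nonempty
  obtain ⟨h1, h2⟩ := facesOf.eq_region hF (hf hx)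
  exact reachable_of_connIn hx hy ((mem_region_iff h2).1 (h1 ▸ hg hy))

/-- The faces of the drawing inside a face of a subgraph form a component of the open dual. -/
lemma facesOf.exists_component :
    ∃ c : (D.dualGraph (inducedEdges G S)ᶜ).ConnectedComponent,
      c.supp = {f : D.Face | f.1 ⊆ F} ∧
        ∀ e ∉ inducedEdges G S, (∃ f ∈ c.supp, D.Borders e f) ↔ D.openArc e ⊆ F := by
  obtain ⟨f₀, hf₀⟩ := facesOf.exists_face hF
  obtain ⟨x, hx⟩ := f₀.nonempty
  have hFx := (facesOf.eq_region hF (hf₀ hx)).1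
  have hsupp : ((D.dualGraph (inducedEdges G S)ᶜ).connectedComponentMk f₀).supp =
      {f : D.Face | f.1 ⊆ F} := by
    ext f
    rw [SimpleGraph.ConnectedComponent.mem_supp_iff, SimpleGraph.ConnectedComponent.eq]
    refine ⟨fun h => ?_, fun h => facesOf.reachable hF h hf₀⟩
    have := subset_region_of_reachable (P := S) h.symm (x := x) (by rwa [← hFx])
    rwa [← hFx] at this
  refine ⟨_, hsupp, fun e he => ?_⟩
  rw [hsupp]
  constructor
  · rintro ⟨f, hf, hef⟩
    obtain ⟨y, hy⟩ := f.nonempty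
    have hFy := (facesOf.eq_region hF (hf hy)).1
    rw [hFy]
    exact openArc_subset_region_of_borders he hef hy (hFy ▸ hf hy)
  · intro h
    obtain ⟨z, hz⟩ := (D.isConnected_openArc e).nonempty
    obtain ⟨f, hf, hfF⟩ := exists_borders_inter hz ((facesOf.isOpen hF).mem_nhds (h hz))
    exact ⟨f, facesOf.face_subset hF hfF, hf⟩

-- Each such face borders an edge that meets the compact closure of `F`. There are finitely many of
-- these edges, each bordered by at most two faces.
omit hF in
lemma facesOf.finite_faces (hinc : ∀ w, ∃ w', G.Adj w w') (hb : Bornology.IsBounded F) :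
    {f : D.Face | f.1 ⊆ F}.Finite := by
  refine ((D.proper _ hb.isCompact_closure).2.biUnion
    fun e _ => finite_borders (D := D) e).subset fun f hf => ?_
  obtain ⟨e, he⟩ := exists_borders_of_isBounded hinc (hb.subset hf)
  obtain ⟨z, hz⟩ := (D.isConnected_openArc e).nonempty
  exact Set.mem_biUnion (x := e) ⟨z, hz.1, closure_mono hf (borders_iff.1 he hz.1)⟩ he

/-- The faces inside `F` are dense in it, so finitely many bounded ones would make `F` bounded. -/
lemma facesOf.infinite_faces (hfb : ∀ f : D.Face, Bornology.IsBounded f.1)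
    (hb : ¬ Bornology.IsBounded F) : {f : D.Face | f.1 ⊆ F}.Infinite := by
  intro hfin
  refine hb ?_
  have h1 : Bornology.IsBounded (⋃ f ∈ {f : D.Face | f.1 ⊆ F}, f.1) :=
    (Bornology.isBounded_biUnion hfin).2 fun f _ => hfb f
  refine h1.closure.subset fun x hx => ?_
  rw [mem_closure_iff]
  intro O hO hxO
  obtain ⟨f, y, hyf, hy⟩ := exists_face_inter (D := D) (hO.inter (facesOf.isOpen hF)) ⟨x, hxO, hx⟩
  exact ⟨y, hy.1, Set.mem_biUnion (x := f) (facesOf.face_subset hF ⟨y, hyf, hy.2⟩) hyf⟩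

/-- A face of the drawing whose boundary vertices all belong to `S` is a face of the subgraph. -/
lemma facesOf.eq_face {f : D.Face} (hf : f.1 ⊆ F) (hv : ∀ w, D.pos w ∈ closure f.1 → w ∈ S) :
    f.1 = F := by
  obtain ⟨x, hx⟩ := f.nonempty
  rw [(facesOf.eq_region hF (hf hx)).1, f.eq_region hx]
  refine region_eq_of_closure_inter (f.disjoint_occupied.notMem_of_mem_left hx)
    (Set.subset_univ _) (Set.subset_univ _) ?_
  rw [← f.eq_region hx]
  rintro y ⟨hyc, hy⟩
  rcases pos_or_openArc_of_mem_occupied hy with ⟨w, rfl⟩ | ⟨e, -, he⟩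
  · exact D.pos_mem_occupied (hv w hyc)
  · refine D.arc_subset_occupied (T := inducedEdges G S) (fun w hw => hv w ?_) he.1
    exact borders_iff.1 (borders_of_mem_openArc he hyc) (D.pos_mem_arc_iff.2 hw)

end FacesOfSubgraph

end PlaneDrawing

end

/-! ### Spokes: how the edges at a facial site cut a face -/

section

open Filter Topology

namespace PlaneDrawing

namespace IsFacialDrawing

variable {V : Type*} {M : SimpleGraph V} {X : Type*} [MetricSpace X]
  {D : PlaneDrawing M X} {Φ : Set D.Face} {D' : PlaneDrawing (D.facialGraph Φ) X}

/-- The edge from a facial site to a vertex on the boundary of the face. -/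
def spoke (f : Φ) {w : V} (hw : D.VertexOnBoundary w f) : (D.facialGraph Φ).edgeSet :=
  ⟨s(.inl w, .inr f), hw⟩

lemma edge_cases (e : (D.facialGraph Φ).edgeSet) :
    (∃ (u v : V) (huv : M.Adj u v), e = ⟨s(.inl u, .inl v), huv⟩) ∨
      ∃ (f : Φ) (w : V) (hw : D.VertexOnBoundary w f), e = spoke f hw := by
  obtain ⟨u | f, v | g, huv, rfl⟩ := exists_isArc e
  · exact Or.inl ⟨u, v, huv, rfl⟩
  · exact Or.inr ⟨g, u, huv, rfl⟩
  · exact Or.inr ⟨f, v, huv, Subtype.ext Sym2.eq_swap⟩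
  · exact huv.elim

/-- The edges of the facial graph that belong to the graph itself. -/
abbrev baseEdges (D : PlaneDrawing M X) (Φ : Set D.Face) (S : Set V) :
    Set (D.facialGraph Φ).edgeSet :=
  inducedEdges _ (Sum.inl '' S)

lemma mem_baseEdges {S : Set V} {u v : V} (huv : M.Adj u v) :
    (⟨s(.inl u, .inl v), huv⟩ : (D.facialGraph Φ).edgeSet) ∈ baseEdges D Φ S ↔ u ∈ S ∧ v ∈ S := by
  simp [baseEdges, inducedEdges]

lemma spoke_notMem_baseEdges {S : Set V} {f : Φ} {w : V} (hw : D.VertexOnBoundary w f) :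
    spoke f hw ∉ baseEdges D Φ S := by
  intro h
  obtain ⟨v, -, h⟩ := h (.inr f) (Sym2.mem_mk_right _ _)
  exact Sum.inl_ne_inr h

variable (h : D.IsFacialDrawing Φ D')

include h

lemma occupied_eq : D'.occupied (Sum.inl '' Set.univ) (baseEdges D Φ Set.univ) =
    D.occupied Set.univ Set.univ := by
  apply subset_antisymm
  · rintro x (⟨_, ⟨w, -, rfl⟩, rfl⟩ | hx)
    · rw [h.pos_eq]
      exact D.pos_mem_occupied (Set.mem_univ w)
    · obtain ⟨e, he, hx⟩ := Set.mem_iUnion₂.1 hx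
      obtain ⟨u, v, huv, rfl⟩ | ⟨f, w, hw, rfl⟩ := edge_cases e
      · rw [h.arc_eq u v huv] at hx
        exact D.arc_subset_occupied (Set.mem_univ _) hx
      · exact absurd he (spoke_notMem_baseEdges hw)
  · rintro x (⟨w, -, rfl⟩ | hx)
    · rw [← h.pos_eq]
      exact D'.pos_mem_occupied ⟨w, Set.mem_univ w, rfl⟩
    · obtain ⟨e, he, hx⟩ := Set.mem_iUnion₂.1 hx
      obtain ⟨u, v, huv, rfl⟩ := exists_isArc e
      rw [← h.arc_eq u v huv] at hx
      exact D'.arc_subset_occupied (by simp) hx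

lemma openArc_spoke_subset (f : Φ) {w : V} (hw : D.VertexOnBoundary w f) :
    D'.openArc (spoke f hw) ⊆ f.1.1 := by
  intro x hx
  rcases h.arc_subset w f hw hx.1 with hx' | hx'
  · exact absurd hx' fun hx' => (D'.mem_openArc.1 hx).2 _ ((h.pos_eq w).trans hx'.symm)
  · exact hx'

lemma disjoint_occupied_of_notMem {f : D.Face} (hf : f ∉ Φ) {P : Set (V ⊕ Φ)}
    {T : Set (D.facialGraph Φ).edgeSet} : Disjoint f.1 (D'.occupied P T) := by
  have hD := f.disjoint_occupied (P := Set.univ) (T := Set.univ)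
  rw [Set.disjoint_left] at hD ⊢
  rintro x hxf (⟨w | g, -, rfl⟩ | hx)
  · exact hD hxf (h.pos_eq w ▸ D.pos_mem_occupied (Set.mem_univ w))
  · exact hf (Face.eq_of_mem hxf (h.pos_mem g) ▸ g.2)
  · obtain ⟨e, he, hx⟩ := Set.mem_iUnion₂.1 hx
    obtain ⟨u, v, huv, rfl⟩ | ⟨g, w, hw, rfl⟩ := edge_cases e
    · rw [h.arc_eq u v huv] at hx
      exact hD hxf (D.arc_subset_occupied (Set.mem_univ _) hx)
    · rcases h.arc_subset w g hw hx with rfl | hx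
      · exact hD hxf (D.pos_mem_occupied (Set.mem_univ w))
      · exact hf (Face.eq_of_mem hxf hx ▸ g.2)

lemma disjoint_face (t : D'.Face) : Disjoint t.1 (D.occupied Set.univ Set.univ) := by
  rw [← h.occupied_eq]
  exact t.disjoint_occupied

lemma face_subset {t : D'.Face} {f : D.Face} (hne : (t.1 ∩ f.1).Nonempty) : t.1 ⊆ f.1 := by
  obtain ⟨x, hxt, hxf⟩ := hne
  rw [f.eq_region hxf]
  exact subset_region t.isPreconnected hxt (h.disjoint_face t)

lemma exists_face_supset (t : D'.Face) : ∃ f : D.Face, t.1 ⊆ f.1 := by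
  obtain ⟨x, hx⟩ := t.nonempty
  have hx' := (h.disjoint_face t).notMem_of_mem_left hx
  exact ⟨D.faceOf x hx', h.face_subset ⟨x, hx, mem_faceOf hx'⟩⟩

lemma eq_of_subset_of_notMem {t : D'.Face} {f : D.Face} (htf : t.1 ⊆ f.1) (hf : f ∉ Φ) :
    t.1 = f.1 := by
  obtain ⟨x, hx⟩ := t.nonempty
  refine htf.antisymm ?_
  rw [t.eq_region hx]
  exact subset_region f.isPreconnected (htf hx) (h.disjoint_occupied_of_notMem hf)

-- Properness at the position of the facial site gives it finite degree. This is the source of the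
-- boundedness of all faces.
omit h in
lemma finite_boundary (D' : PlaneDrawing (D.facialGraph Φ) X) (f : Φ) :
    {w | D.VertexOnBoundary w f.1}.Finite := by
  have h1 := D'.finite_incident (.inr f)
  have h2 : Set.InjOn (fun w : V => (s(.inl w, .inr f) : Sym2 (V ⊕ Φ)))
      {w | D.VertexOnBoundary w f.1} := by
    intro u _ v _ huv
    simpa using huv
  refine Set.Finite.of_injOn (f := fun w : V => (s(.inl w, .inr f) : Sym2 (V ⊕ Φ)))
    (fun w hw => ?_) h2 (h1.image Subtype.val)
  exact ⟨spoke f hw, Sym2.mem_mk_right _ _, rfl⟩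

omit h in
/-- In the drawing of a graph that remains connected when `w` is removed, two other vertices are
joined by an arc that consists of edges not incident with `w`. -/
lemma joinedIn_of_connected_induce {w : V} (h2 : (M.induce {w}ᶜ).Connected) {x y : V}
    (hx : x ≠ w) (hy : y ≠ w) {P : Set (V ⊕ Φ)} {T : Set (D.facialGraph Φ).edgeSet}
    (hP : Sum.inl '' {w}ᶜ ⊆ P) (hT : baseEdges D Φ {w}ᶜ ⊆ T) :
    JoinedIn (D'.occupied P T) (D'.pos (.inl x)) (D'.pos (.inl y)) := by
  obtain ⟨p⟩ := h2.preconnected ⟨x, hx⟩ ⟨y, hy⟩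
  suffices ∀ (x y : ({w}ᶜ : Set V)) (_ : (M.induce {w}ᶜ).Walk x y),
      JoinedIn (D'.occupied P T) (D'.pos (.inl x)) (D'.pos (.inl y)) from this _ _ p
  intro x y p
  induction p with
  | @nil x => exact JoinedIn.refl (D'.pos_mem_occupied (hP ⟨x, x.2, rfl⟩))
  | @cons x y z hxy p ih =>
    have hxy' : M.Adj x y := hxy
    have := (D'.isArc (u := .inl x.1) (v := .inl y.1) hxy').joinedIn
    exact (this.mono (D'.arc_subset_occupied (hT ((mem_baseEdges hxy').2 ⟨x.2, y.2⟩)))).trans ih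

omit h in
/-- The spokes of the face `f` at the vertices in `A`. -/
def spokes (f : Φ) (A : Set V) : Set (D.facialGraph Φ).edgeSet :=
  {e | ∃ w ∈ A, ∃ hw : D.VertexOnBoundary w f.1, e = spoke f hw}

omit h in
lemma spoke_mem_spokes {f : Φ} {A : Set V} {w : V} (hwA : w ∈ A) (hw : D.VertexOnBoundary w f.1) :
    spoke f hw ∈ spokes f A := ⟨w, hwA, hw, rfl⟩

omit h in
lemma spokes_mono {f : Φ} {A A' : Set V} (hA : A ⊆ A') : spokes f A ⊆ spokes f A' := by
  rintro _ ⟨w, hwA, hw, rfl⟩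
  exact ⟨w, hA hwA, hw, rfl⟩

omit h in
/-- The graph together with the spokes of the face `f` at the vertices in `A`. -/
abbrev spoked (D' : PlaneDrawing (D.facialGraph Φ) X) (f : Φ) (A : Set V) : Set X :=
  D'.occupied (Sum.inl '' Set.univ) (baseEdges D Φ Set.univ ∪ spokes f A)

omit h in
/-- The region of a point in the complement of the graph and the spokes at the vertices in `A`. -/
abbrev spokedRegion (D' : PlaneDrawing (D.facialGraph Φ) X) (f : Φ) (A : Set V) (a : X) : Set X :=
  D'.region (Sum.inl '' Set.univ) (baseEdges D Φ Set.univ ∪ spokes f A) a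

omit h in
lemma arc_subset_spoked {f : Φ} {A : Set V} {w : V} (hwA : w ∈ A)
    (hw : D.VertexOnBoundary w f.1) : D'.arc (spoke f hw) ⊆ spoked D' f A :=
  D'.arc_subset_occupied (Or.inr (spoke_mem_spokes hwA hw))

-- Passing from `A'` to `A` loses only interiors of spokes: vertices belong to the graph, and the
-- facial site is kept by the spoke at `u`.
omit h in
lemma mem_spoked_of_notMem_openArc {f : Φ} {A A' : Set V} {u : V} (huA : u ∈ A)
    (hu : D.VertexOnBoundary u f.1) {x : X} (hx : x ∈ spoked D' f A')
    (hxA : ∀ w, w ∈ A' → ∀ hw : D.VertexOnBoundary w f.1, x ∈ D'.openArc (spoke f hw) → w ∈ A) :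
    x ∈ spoked D' f A := by
  rcases hx with hx | hx
  · exact Or.inl hx
  · obtain ⟨e, he, hxe⟩ := Set.mem_iUnion₂.1 hx
    rcases he with he | ⟨w, hwA, hw, rfl⟩
    · exact D'.arc_subset_occupied (Or.inl he) hxe
    · by_cases hxo : x ∈ D'.openArc (spoke f hw)
      · exact arc_subset_spoked (hxA w hwA hw hxo) hw hxe
      · obtain ⟨w', hw', rfl⟩ : x ∈ D'.pos '' {w' | w' ∈ (spoke f hw : Sym2 (V ⊕ Φ))} := by
          by_contra hcon
          exact hxo ⟨hxe, hcon⟩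
        rcases Sym2.mem_iff.1 hw' with rfl | rfl
        · exact D'.pos_mem_occupied ⟨w, Set.mem_univ w, rfl⟩
        · exact arc_subset_spoked huA hu (D'.pos_mem_arc_iff.2 (Sym2.mem_mk_right _ _))

section Plane

variable [ProperSpace X] [IsPlane X]

-- Spokes that a region does not border can be erased without changing the region.
omit h in
lemma spokedRegion_eq {f : Φ} {A A' : Set V} (hA : A ⊆ A') {u : V} (huA : u ∈ A)
    (hu : D.VertexOnBoundary u f.1) {a : X} (ha : a ∉ spoked D' f A')
    (hb : ∀ w, w ∈ A' → ∀ hw : D.VertexOnBoundary w f.1,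
      D'.arc (spoke f hw) ⊆ closure (spokedRegion D' f A' a) → w ∈ A) :
    spokedRegion D' f A' a = spokedRegion D' f A a := by
  refine region_eq_of_closure_inter ha subset_rfl
    (Set.union_subset_union_right _ (spokes_mono hA)) ?_
  rintro x ⟨hxc, hx⟩
  refine mem_spoked_of_notMem_openArc huA hu hx fun w hwA hw hxo => hb w hwA hw ?_
  exact arc_subset_closure_region (Or.inr (spoke_mem_spokes hwA hw)) hxo hxc

omit [ProperSpace X] [IsPlane X] in
lemma connIn_face {f : D.Face} {a b : X} (ha : a ∈ f.1) (hb : b ∈ f.1) :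
    ConnIn (D'.occupied (Sum.inl '' Set.univ) (baseEdges D Φ Set.univ))ᶜ a b := by
  rw [h.occupied_eq]
  exact ⟨f.1, f.disjoint_occupied.subset_compl_right, f.isPreconnected, ha, hb⟩

lemma connIn_spoked_singleton {f : Φ} {u : V} (hu : D.VertexOnBoundary u f.1) {a b : X}
    (ha : a ∈ f.1.1) (hb : b ∈ f.1.1) (hau : a ∉ D'.arc (spoke f hu))
    (hbu : b ∉ D'.arc (spoke f hu)) : ConnIn (spoked D' f {u})ᶜ a b := by
  have he : spoke f hu = ⟨s(.inr f, .inl u), hu⟩ := Subtype.ext Sym2.eq_swap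
  have hs : spokes f {u} = {spoke f hu} := by
    ext e
    constructor
    · rintro ⟨w, rfl, hw, rfl⟩
      rfl
    · rintro rfl
      exact spoke_mem_spokes (Set.mem_singleton u) hu
  rw [spoked, hs, Set.union_singleton, he]
  refine connIn_insert_edge ?_ (h.connIn_face ha hb) (he ▸ hau) (he ▸ hbu)
  rw [h.occupied_eq]
  exact f.1.disjoint_occupied.notMem_of_mem_left (h.pos_mem f)

/-- A region inside the face `f` cut by two spokes borders both of them. -/
lemma arc_subset_closure_of_pair {f : Φ} {u v : V} (hu : D.VertexOnBoundary u f.1)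
    (hv : D.VertexOnBoundary v f.1) (huv : u ≠ v) {a : X} (ha : a ∈ f.1.1)
    (ha' : a ∉ spoked D' f {u, v}) :
    D'.arc (spoke f hv) ⊆ closure (spokedRegion D' f {u, v} a) := by
  by_contra hcon
  -- Without the spoke at `v` the region would be the whole face minus one pendant spoke, and would
  -- contain the interior of the erased spoke.
  have h1 : spokedRegion D' f {u, v} a = spokedRegion D' f {u} a := by
    refine spokedRegion_eq (by simp) (Set.mem_singleton u) hu ha' ?_
    rintro w (rfl | rfl) hw hwa
    exacts [rfl, absurd hwa hcon]
  obtain ⟨y, hy⟩ := (D'.isConnected_openArc (spoke f hv)).nonempty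
  have hne : spoke f hu ≠ spoke f hv := by
    intro h
    have := congrArg Subtype.val h
    simp only [spoke, Sym2.eq_iff] at this
    simp [huv] at this
  have hyu : y ∉ D'.arc (spoke f hu) := fun hyu => hne (D'.eq_of_mem_openArc hy hyu)
  have hau : a ∉ D'.arc (spoke f hu) := fun h => ha' (arc_subset_spoked (by simp) hu h)
  have hconn := h.connIn_spoked_singleton hu ha (h.openArc_spoke_subset f hv hy) hau hyu
  have h2 : y ∈ spokedRegion D' f {u, v} a := by
    rw [h1]
    exact (mem_region_iff hconn.left_mem).2 hconn
  exact region_subset a h2 (arc_subset_spoked (by simp) hv hy.1)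

-- The spoke at `u` closes up to a curve through the spoke at `v` and a path of the graph that
-- avoids `w`. The sets `P` and `T` are left general so that `w` itself may be deleted from the
-- drawing.
omit h in
lemma exists_regions_along_spoke {f : Φ} {u v w : V} (h2 : (M.induce {w}ᶜ).Connected)
    (hu : D.VertexOnBoundary u f.1) (hv : D.VertexOnBoundary v f.1) (huv : u ≠ v) (huw : u ≠ w)
    (hvw : v ≠ w) {P : Set (V ⊕ Φ)} {T : Set (D.facialGraph Φ).edgeSet}
    (hP : Sum.inl '' {w}ᶜ ⊆ P) (hT : baseEdges D Φ {w}ᶜ ⊆ T) (huT : spoke f hu ∈ T)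
    (hvT : spoke f hv ∈ T) :
    ∃ a ∉ D'.occupied P T, ∃ b ∉ D'.occupied P T,
      D'.arc (spoke f hu) ⊆ closure (D'.region P T a) ∧
      D'.arc (spoke f hu) ⊆ closure (D'.region P T b) ∧ ¬ ConnIn (D'.occupied P T)ᶜ a b := by
  refine exists_regions_along (D := D') (u := .inl u) (v := .inr f) huT ?_
  have hne : spoke f hv ≠ spoke f hu := by
    intro h
    have := congrArg Subtype.val h
    simp only [spoke, Sym2.eq_iff] at this
    simp [huv.symm] at this
  refine (joinedIn_of_connected_induce h2 huw hvw hP fun e he => Set.mem_sdiff_singleton.2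
    ⟨hT he, ?_⟩).trans ((D'.isArc (u := .inl v) (v := .inr f) hv).joinedIn.mono
      (D'.arc_subset_occupied ⟨hvT, hne⟩))
  rintro rfl
  exact spoke_notMem_baseEdges hu he

lemma mem_face_of_arc_subset_closure {f : Φ} {u : V} (hu : D.VertexOnBoundary u f.1) {A : Set V}
    {a : X} (ha : a ∉ spoked D' f A)
    (hua : D'.arc (spoke f hu) ⊆ closure (spokedRegion D' f A a)) : a ∈ f.1.1 := by
  obtain ⟨y, hy⟩ := (D'.isConnected_openArc (spoke f hu)).nonempty
  obtain ⟨z, hzf, hz⟩ := mem_closure_iff.1 (hua hy.1) _ f.1.isOpen (h.openArc_spoke_subset f hu hy)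
  have hsub : spokedRegion D' f A a ⊆ f.1.1 := by
    rw [f.1.eq_region hzf]
    refine subset_region_of_inter (isPreconnected_region a) hz
      (mem_region_self (f.1.disjoint_occupied.notMem_of_mem_left hzf)) ?_
    rw [← h.occupied_eq, Set.disjoint_left]
    exact fun x hx hx' => region_subset a hx (D'.occupied_mono subset_rfl Set.subset_union_left hx')
  exact hsub (mem_region_self ha)

/-- Of three spokes of a face, any two border a region that the third does not border. -/
lemma exists_region_between {f : Φ} {u v w : V} (h2 : (M.induce {w}ᶜ).Connected)
    (hu : D.VertexOnBoundary u f.1) (hv : D.VertexOnBoundary v f.1)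
    (hw : D.VertexOnBoundary w f.1) (huv : u ≠ v) (huw : u ≠ w) (hvw : v ≠ w) {A : Set V}
    (hA : A = {u, v, w}) :
    ∃ a ∉ spoked D' f A, D'.arc (spoke f hu) ⊆ closure (spokedRegion D' f A a) ∧
      D'.arc (spoke f hv) ⊆ closure (spokedRegion D' f A a) ∧
      ¬ D'.arc (spoke f hw) ⊆ closure (spokedRegion D' f A a) := by
  have hAs : ({u, v} : Set V) ⊆ A := by
    rw [hA]
    intro x hx
    simp only [Set.mem_insert_iff, Set.mem_singleton_iff] at hx ⊢
    tauto
  obtain ⟨y, hy⟩ := (D'.isConnected_openArc (spoke f hw)).nonempty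
  have hdisj : Disjoint (D'.openArc (spoke f hw)) (spoked D' f {u, v}) := by
    refine D'.openArc_disjoint_occupied ?_
    rintro (h | ⟨x, hx, hx', h⟩)
    · exact spoke_notMem_baseEdges hw h
    · have := congrArg Subtype.val h
      simp only [spoke, Sym2.eq_iff] at this
      rcases hx with rfl | rfl
      · simp [huw.symm] at this
      · simp [hvw.symm] at this
  -- The spoke at `w` lies in at most one of the two regions along the spoke at `u`; the other one
  -- is chosen, and adding the third spoke does not affect it.
  obtain ⟨a, ha, hua, hya⟩ : ∃ a ∉ spoked D' f {u, v},
      D'.arc (spoke f hu) ⊆ closure (spokedRegion D' f {u, v} a) ∧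
      y ∉ spokedRegion D' f {u, v} a := by
    obtain ⟨a, ha, b, hb, hua, hub, hab⟩ := exists_regions_along_spoke h2 hu hv huv huw hvw
      (P := Sum.inl '' Set.univ) (T := baseEdges D Φ Set.univ ∪ spokes f {u, v})
      (Set.image_mono (Set.subset_univ _))
      (fun e he => Or.inl fun x hx => Set.image_mono (Set.subset_univ _) (he x hx))
      (Or.inr (spoke_mem_spokes (by simp) hu)) (Or.inr (spoke_mem_spokes (by simp) hv))
    by_cases hya : y ∈ spokedRegion D' f {u, v} a
    · refine ⟨b, hb, hub, fun hyb => hab ?_⟩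
      exact ((mem_region_iff ha).1 hya).trans ((mem_region_iff hb).1 hyb).symm
    · exact ⟨a, ha, hua, hya⟩
  have hyc : ∀ z ∈ D'.openArc (spoke f hw), z ∉ closure (spokedRegion D' f {u, v} a) :=
    fun z hz hzc => hya (subset_region_of_closure
      (D'.isConnected_openArc (spoke f hw)).isPreconnected hz hzc hdisj hy)
  have haf := h.mem_face_of_arc_subset_closure hu ha hua
  have hao : a ∉ D'.openArc (spoke f hw) := fun hao => hyc a hao (subset_closure (mem_region_self ha))
  have haA : a ∉ spoked D' f A := by
    intro haA
    refine ha (mem_spoked_of_notMem_openArc (by simp) hu haA ?_)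
    intro x hx hxb hxo
    rw [hA] at hx
    rcases hx with rfl | rfl | rfl
    exacts [by simp, by simp, absurd hxo hao]
  have hsub : spokedRegion D' f A a ⊆ spokedRegion D' f {u, v} a :=
    region_mono subset_rfl (Set.union_subset_union_right _ (spokes_mono hAs)) a
  have hnw : ¬ D'.arc (spoke f hw) ⊆ closure (spokedRegion D' f A a) :=
    fun hcon => hyc y hy (closure_mono hsub (hcon hy.1))
  have heq : spokedRegion D' f A a = spokedRegion D' f {u, v} a := by
    refine spokedRegion_eq hAs (by simp) hu haA ?_
    intro x hx hxb hxc
    rw [hA] at hx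
    rcases hx with rfl | rfl | rfl
    exacts [by simp, by simp, absurd hxc hnw]
  refine ⟨a, haA, ?_, ?_, hnw⟩
  · rwa [heq]
  · rw [heq]
    exact h.arc_subset_closure_of_pair hu hv huv haf ha

/-- No region of a face cut by three spokes borders all of them. -/
lemma not_borders_three_spokes {f : Φ} {u v w : V} (h2 : ∀ w, (M.induce {w}ᶜ).Connected)
    (hu : D.VertexOnBoundary u f.1) (hv : D.VertexOnBoundary v f.1)
    (hw : D.VertexOnBoundary w f.1) (huv : u ≠ v) (huw : u ≠ w) (hvw : v ≠ w) {x : X}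
    (hx : x ∉ spoked D' f {u, v, w})
    (hux : D'.arc (spoke f hu) ⊆ closure (spokedRegion D' f {u, v, w} x))
    (hvx : D'.arc (spoke f hv) ⊆ closure (spokedRegion D' f {u, v, w} x)) :
    ¬ D'.arc (spoke f hw) ⊆ closure (spokedRegion D' f {u, v, w} x) := by
  intro hwx
  obtain ⟨a, ha, hua, hva, hwa⟩ := h.exists_region_between (h2 w) hu hv hw huv huw hvw rfl
  obtain ⟨b, hb, hub, hwb, hvb⟩ := h.exists_region_between (h2 v) hu hw hv huw huv hvw.symm
    (A := {u, v, w}) (by rw [Set.pair_comm])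
  have key : ∀ {y z : X}, y ∉ spoked D' f {u, v, w} → ConnIn (spoked D' f {u, v, w})ᶜ y z →
      spokedRegion D' f {u, v, w} y = spokedRegion D' f {u, v, w} z := fun hy hyz =>
    (region_eq_of_mem ((mem_region_iff hy).2 hyz)).symm
  -- Along the spoke at `u` there would be three regions: one bordering all spokes, one missing `w`,
  -- one missing `v`.
  rcases connIn_of_three_regions (Or.inr (spoke_mem_spokes (by simp) hu)) hx ha hb hux hua hub
    with hc | hc | hc
  · exact hwa (key hx hc ▸ hwx)
  · exact hvb (key hx hc ▸ hvx)
  · exact hvb (key ha hc ▸ hva)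

/-- A region of a face cut by three spokes that has a vertex on its boundary borders the spoke at
that vertex. -/
lemma arc_subset_closure_of_pos_mem {f : Φ} {u v w : V} (h2 : (M.induce {w}ᶜ).Connected)
    (hu : D.VertexOnBoundary u f.1) (hv : D.VertexOnBoundary v f.1)
    (hw : D.VertexOnBoundary w f.1) (huv : u ≠ v) (huw : u ≠ w) (hvw : v ≠ w) {A : Set V}
    (hA : A = {u, v, w}) {x : X} (hxf : x ∈ f.1.1)
    (hx : x ∉ spoked D' f A) (hwx : D'.pos (.inl w) ∈ closure (spokedRegion D' f A x)) :
    D'.arc (spoke f hw) ⊆ closure (spokedRegion D' f A x) := by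
  by_contra hcon
  have hAs : ({u, v} : Set V) ⊆ A := by
    rw [hA]
    intro x hx
    simp only [Set.mem_insert_iff, Set.mem_singleton_iff] at hx ⊢
    tauto
  have heq : spokedRegion D' f A x = spokedRegion D' f {u, v} x := by
    refine spokedRegion_eq hAs (by simp) hu hx ?_
    intro y hy hyb hyc
    rw [hA] at hy
    rcases hy with rfl | rfl | rfl
    exacts [by simp, by simp, absurd hyc hcon]
  have hx' : x ∉ spoked D' f {u, v} := fun h' =>
    hx (D'.occupied_mono subset_rfl (Set.union_subset_union_right _ (spokes_mono hAs)) h')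
  obtain ⟨y, hy⟩ := (D'.isConnected_openArc (spoke f hw)).nonempty
  have hdisj : Disjoint (D'.openArc (spoke f hw)) (spoked D' f {u, v}) := by
    refine D'.openArc_disjoint_occupied ?_
    rintro (h | ⟨x, hx, hx', h⟩)
    · exact spoke_notMem_baseEdges hw h
    · have := congrArg Subtype.val h
      simp only [spoke, Sym2.eq_iff] at this
      rcases hx with rfl | rfl
      · simp [huw.symm] at this
      · simp [hvw.symm] at this
  have hy' : y ∉ spoked D' f {u, v} := hdisj.notMem_of_mem_left hy
  -- The two spokes at `u` and `v` thus separate `x` from the interior of the spoke at `w`, although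
  -- `w` is on the boundary of both regions.
  have hxy : ¬ ConnIn (spoked D' f {u, v})ᶜ x y := by
    intro hxy
    have : y ∈ spokedRegion D' f A x := by
      rw [heq]
      exact (mem_region_iff hx').2 hxy
    exact region_subset x this (arc_subset_spoked (by simp [hA]) hw hy.1)
  have hyf := h.openArc_spoke_subset f hw hy
  have hux := h.arc_subset_closure_of_pair hv hu huv.symm hxf (by rwa [Set.pair_comm])
  have huy := h.arc_subset_closure_of_pair hv hu huv.symm hyf (by rwa [Set.pair_comm])
  rw [Set.pair_comm] at hux huy
  rw [heq] at hwx
  have hwy : D'.pos (.inl w) ∈ closure (spokedRegion D' f {u, v} y) := by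
    have h1 : D'.openArc (spoke f hw) ⊆ spokedRegion D' f {u, v} y :=
      subset_region (D'.isConnected_openArc _).isPreconnected hy hdisj
    exact closure_mono h1 (D'.arc_subset_closure_openArc _
      (D'.pos_mem_arc_iff.2 (Sym2.mem_mk_left _ _)))
  -- the drawing without the vertex `w`
  set P' : Set (V ⊕ Φ) := Sum.inl '' {w}ᶜ with hP'
  set T' : Set (D.facialGraph Φ).edgeSet := baseEdges D Φ {w}ᶜ ∪ spokes f {u, v} with hT'
  have hPP : P' ⊆ Sum.inl '' Set.univ := Set.image_mono (Set.subset_univ _)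
  have hTT : T' ⊆ baseEdges D Φ Set.univ ∪ spokes f {u, v} :=
    Set.union_subset_union_left _ fun e he x hx => hPP (he x hx)
  have hsub := D'.occupied_mono hPP hTT
  have hwT : D'.pos (.inl w) ∉ D'.occupied P' T' := by
    rintro (⟨_, ⟨v', hv', rfl⟩, hvw'⟩ | hw')
    · exact hv' (Sum.inl_injective (D'.pos_injective hvw'))
    · obtain ⟨e, he, hwe⟩ := Set.mem_iUnion₂.1 hw'
      have hwe' := D'.mem_of_pos_mem_arc _ _ hwe
      rcases he with he | ⟨z, hz, hzb, rfl⟩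
      · obtain ⟨z, hz, hzw⟩ := he _ hwe'
        exact hz (Sum.inl_injective hzw)
      · rcases Sym2.mem_iff.1 hwe' with h' | h'
        · have := Sum.inl_injective h'
          rcases hz with rfl | rfl
          exacts [huw this.symm, hvw this.symm]
        · exact Sum.inl_ne_inr h'
  -- With `w` and its edges deleted, a region that had `w` on its boundary extends across `w`; hence
  -- the regions of `x` and `y` merge.
  have hmem : ∀ {z : X}, z ∉ spoked D' f {u, v} →
      D'.pos (.inl w) ∈ closure (spokedRegion D' f {u, v} z) →
      ConnIn (D'.occupied P' T')ᶜ z (D'.pos (.inl w)) := by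
    intro z hz hzw
    refine (mem_region_iff fun h' => hz (hsub h')).1 ?_
    exact subset_region_of_closure isPreconnected_singleton rfl
      (closure_mono (region_mono hPP hTT z) hzw) (Set.disjoint_singleton_left.2 hwT) rfl
  have hxyT : ConnIn (D'.occupied P' T')ᶜ x y := (hmem hx' hwx).trans (hmem hy' hwy).symm
  obtain ⟨a, ha, b, hb, hua, hub, hab⟩ := exists_regions_along_spoke h2 hu hv huv huw hvw
    (P := P') (T := T') subset_rfl Set.subset_union_left
    (Or.inr (spoke_mem_spokes (by simp) hu)) (Or.inr (spoke_mem_spokes (by simp) hv))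
  -- Close to the spoke at `u` only the regions of `x` and `y` were present. After merging, a single
  -- region lies along it, which contradicts the choice of `a` and `b`.
  have hnear : ∀ {c : X}, c ∉ D'.occupied P' T' →
      D'.arc (spoke f hu) ⊆ closure (D'.region P' T' c) → ConnIn (D'.occupied P' T')ᶜ c x := by
    intro c hc huc
    obtain ⟨z, hz⟩ := (D'.isConnected_openArc (spoke f hu)).nonempty
    obtain ⟨B, -, hBo, hzB, hB, hBd, -⟩ := exists_disc_borders hz univ_mem
    obtain ⟨c', hc'B, hc'⟩ := mem_closure_iff.1 (huc hz.1) B hBo hzB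
    have hcc' : ConnIn (D'.occupied P' T')ᶜ c c' := (mem_region_iff hc).1 hc'
    have hc'u : c' ∉ spoked D' f {u, v} := by
      intro hcon
      rw [spoked, D'.occupied_eq_union (Or.inr (spoke_mem_spokes (by simp) hu))] at hcon
      rcases hcon with hcon | hcon
      · exact hBd.notMem_of_mem_left hc'B (D'.occupied_mono (Set.subset_univ _)
          (Set.sdiff_subset_sdiff_left (Set.subset_univ _)) hcon)
      · exact hcc'.right_mem (D'.arc_subset_occupied
          (Or.inr (spoke_mem_spokes (by simp) hu)) hcon)
    have huc' := arc_subset_closure_region_of_near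
      (T := baseEdges D Φ Set.univ ∪ spokes f {u, v}) (P := Sum.inl '' Set.univ)
      (Or.inr (spoke_mem_spokes (by simp) hu)) hz hB hzB
      (hBd.mono_right (D'.occupied_mono subset_rfl
        (Set.sdiff_subset_sdiff_left (Set.subset_univ _)))) hc'B (mem_region_self hc'u)
    have hmono : ∀ {p q : X}, ConnIn (spoked D' f {u, v})ᶜ p q →
        ConnIn (D'.occupied P' T')ᶜ p q := fun hpq => hpq.mono (Set.compl_subset_compl.2 hsub)
    rcases connIn_of_three_regions (Or.inr (spoke_mem_spokes (by simp) hu)) hx' hy' hc'u hux huy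
      huc' with hc | hc | hc
    · exact absurd hc hxy
    · exact hcc'.trans (hmono hc).symm
    · exact hcc'.trans ((hmono hc).symm.trans hxyT.symm)
  exact hab ((hnear ha hua).trans (hnear hb hub).symm)

/-- A face of the facial drawing inside `f ∈ Φ` has at most two vertices of the graph on its
boundary. -/
lemma not_three_vertices (h2 : ∀ w, (M.induce {w}ᶜ).Connected) {f : Φ} {t : D'.Face}
    (htf : t.1 ⊆ f.1.1) {u v w : V} (huv : u ≠ v) (huw : u ≠ w) (hvw : v ≠ w)
    (hu : D.pos u ∈ closure t.1) (hv : D.pos v ∈ closure t.1) : D.pos w ∉ closure t.1 := by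
  intro hw
  obtain ⟨x, hx⟩ := t.nonempty
  have hx' : x ∉ spoked D' f {u, v, w} := t.disjoint_occupied.notMem_of_mem_left hx
  have hsub : t.1 ⊆ spokedRegion D' f {u, v, w} x := t.subset_region hx (mem_region_self hx')
  have hmem : ∀ {z : V}, D.pos z ∈ closure t.1 → D.VertexOnBoundary z f.1 := fun hz =>
    vertexOnBoundary_iff.2 (closure_mono htf hz)
  have hmem' : ∀ {z : V}, D.pos z ∈ closure t.1 →
      D'.pos (.inl z) ∈ closure (spokedRegion D' f {u, v, w} x) := fun hz => by
    rw [h.pos_eq]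
    exact closure_mono hsub hz
  refine h.not_borders_three_spokes h2 (hmem hu) (hmem hv) (hmem hw) huv huw hvw hx' ?_ ?_ ?_
  · refine h.arc_subset_closure_of_pos_mem (h2 u) (hmem hv) (hmem hw) (hmem hu) hvw huv.symm
      huw.symm ?_ (htf hx) hx' (hmem' hu)
    ext; simp only [Set.mem_insert_iff, Set.mem_singleton_iff]; tauto
  · refine h.arc_subset_closure_of_pos_mem (h2 v) (hmem hu) (hmem hw) (hmem hv) huw huv
      hvw.symm ?_ (htf hx) hx' (hmem' hv)
    ext; simp only [Set.mem_insert_iff, Set.mem_singleton_iff]; tauto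
  · exact h.arc_subset_closure_of_pos_mem (h2 w) (hmem hu) (hmem hv) (hmem hw) huv huw
      hvw rfl (htf hx) hx' (hmem' hw)

end Plane

end IsFacialDrawing

end PlaneDrawing

end

/-! ### Faces of the facial drawing inside a face with a facial site -/

section

open Filter Topology

namespace PlaneDrawing

namespace IsFacialDrawing

variable {V : Type*} {M : SimpleGraph V} {X : Type*} [MetricSpace X] [ProperSpace X] [IsPlane X]
  {D : PlaneDrawing M X} {Φ : Set D.Face} {D' : PlaneDrawing (D.facialGraph Φ) X}
  (h : D.IsFacialDrawing Φ D')

-- A finite star does not separate: spokes are added one at a time, each pendant at its vertex of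
-- the graph.
omit [ProperSpace X] [IsPlane X] in
lemma connIn_compl_spokes (f : Φ) {A : Set V} (hA : A.Finite) {a b : X}
    (ha : a ∉ D'.occupied ∅ (spokes f A)) (hb : b ∉ D'.occupied ∅ (spokes f A))
    [ProperSpace X] [IsPlane X] : ConnIn (D'.occupied ∅ (spokes f A))ᶜ a b := by
  induction A, hA using Set.Finite.induction_on with
  | empty =>
    have : D'.occupied ∅ (spokes f ∅) = ∅ := by simp [occupied, spokes]
    rw [this, Set.compl_empty]
    exact ConnIn.of_isPreconnected isPreconnected_univ (Set.mem_univ a) (Set.mem_univ b)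
  | @insert w A hwA hA ih =>
    have hsub := D'.occupied_mono (P := ∅) subset_rfl (spokes_mono (f := f) (Set.subset_insert w A))
    have hab := ih (fun h => ha (hsub h)) (fun h => hb (hsub h))
    by_cases hw : D.VertexOnBoundary w f.1
    · have hs : spokes f (insert w A) = insert (spoke f hw) (spokes f A) := by
        ext e
        constructor
        · rintro ⟨x, rfl | hx, hxb, rfl⟩
          · exact Set.mem_insert _ _
          · exact Set.mem_insert_of_mem _ (spoke_mem_spokes hx hxb)
        · intro he
          rcases Set.mem_insert_iff.1 he with rfl | he
          · exact spoke_mem_spokes (Set.mem_insert w A) hw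
          · exact spokes_mono (Set.subset_insert w A) he
      rw [hs]
      refine connIn_insert_edge ?_ hab (fun h => ha (D'.arc_subset_occupied
        (spoke_mem_spokes (by simp) hw) h)) (fun h => hb (D'.arc_subset_occupied
        (spoke_mem_spokes (by simp) hw) h))
      rintro (⟨_, h', -⟩ | h')
      · exact h'
      · obtain ⟨_, ⟨x, hx, hxb, rfl⟩, h'⟩ := Set.mem_iUnion₂.1 h'
        rcases Sym2.mem_iff.1 (D'.mem_of_pos_mem_arc _ _ h') with h' | h'
        · exact hwA (Sum.inl_injective h' ▸ hx)
        · exact Sum.inl_ne_inr h'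
    · have hs : spokes f (insert w A) = spokes f A := by
        refine (spokes_mono (Set.subset_insert w A)).antisymm' ?_
        rintro _ ⟨x, rfl | hx, hxb, rfl⟩
        exacts [absurd hxb hw, spoke_mem_spokes hx hxb]
      rwa [hs]

include h

/-- A bounded face of the facial drawing inside `f ∈ Φ` borders an edge of the graph. -/
lemma exists_base_edge (hinc : ∀ w, ∃ w', (D.facialGraph Φ).Adj w w') {f : Φ} {t : D'.Face}
    (htf : t.1 ⊆ f.1.1) (htb : Bornology.IsBounded t.1) :
    ∃ (u v : V) (huv : M.Adj u v), D'.Borders ⟨s(.inl u, .inl v), huv⟩ t := by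
  by_contra! hcon
  have hfin := finite_boundary D' f
  set A : Set V := {w | D.VertexOnBoundary w f.1}
  have hspoke : ∀ e, D'.Borders e t → e ∈ spokes f A := by
    intro e he
    obtain ⟨u, v, huv, rfl⟩ | ⟨g, w, hw, rfl⟩ := edge_cases e
    · exact absurd he (hcon u v huv)
    · obtain ⟨y, hy⟩ := (D'.isConnected_openArc (spoke g hw)).nonempty
      have hyg := h.openArc_spoke_subset g hw hy
      obtain ⟨z, hzg, hzt⟩ := mem_closure_iff.1 (borders_iff.1 he hy.1) _ g.1.isOpen hyg
      have hgf : g = f := Subtype.ext (Face.eq_of_mem hzg (htf hzt))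
      subst hgf
      have hwA : w ∈ A := hw
      exact spoke_mem_spokes hwA hw
  obtain ⟨x, hx⟩ := t.nonempty
  have hx' : x ∉ D'.occupied ∅ (spokes f A) := t.disjoint_occupied.notMem_of_mem_left hx
  -- Without a base edge the boundary of `t` consists of spokes of `f`, so `t` is a component of the
  -- complement of a star.
  have heq : t.1 = D'.region ∅ (spokes f A) x := by
    rw [t.eq_region hx]
    refine region_eq_of_closure_inter (t.disjoint_occupied.notMem_of_mem_left hx)
      (Set.subset_univ _) (Set.subset_univ _) ?_
    rintro y ⟨hyc, hy⟩
    rcases pos_or_openArc_of_mem_occupied hy with ⟨w, rfl⟩ | ⟨e, -, he⟩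
    · obtain ⟨w', hw'⟩ := hinc w
      obtain ⟨e, -, hwe, he⟩ := exists_arc_subset_closure_of_pos
        (Set.mem_univ ⟨s(w, w'), hw'⟩) (Sym2.mem_mk_left w w') hyc
      refine D'.arc_subset_occupied (hspoke e ?_) (D'.pos_mem_arc_iff.2 hwe)
      rwa [borders_iff, t.eq_region hx]
    · refine D'.arc_subset_occupied (hspoke e (borders_of_mem_openArc he ?_)) he.1
      rwa [t.eq_region hx]
  have hsp : (spokes f A).Finite := by
    refine (D'.finite_incident (.inr f)).subset ?_
    rintro _ ⟨w, -, hw, rfl⟩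
    exact Sym2.mem_mk_right _ _
  have hocc : Bornology.IsBounded (D'.occupied ∅ (spokes f A)) := by
    rw [occupied, Set.image_empty, Set.empty_union, Bornology.isBounded_biUnion hsp]
    intro e _
    obtain ⟨u, v, huv, rfl⟩ := exists_isArc e
    exact (D'.isArc huv).isCompact.isBounded
  -- The complement of the star is connected, hence equal to `t`; the plane would be the union of
  -- two bounded sets.
  refine IsPlane.not_isBounded_univ (X := X) ((htb.union hocc).subset fun y _ => ?_)
  by_cases hy : y ∈ D'.occupied ∅ (spokes f A)
  · exact Or.inr hy
  · refine Or.inl ?_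
    rw [heq]
    exact (mem_region_iff hx').2 (connIn_compl_spokes f hfin hx' hy)

/-- Two vertices of the graph on the boundary of a face of the facial drawing inside `f ∈ Φ` are
adjacent. -/
lemma adj_of_mem_closure (h2 : ∀ w, (M.induce {w}ᶜ).Connected)
    (hinc : ∀ w, ∃ w', (D.facialGraph Φ).Adj w w') {f : Φ} {t : D'.Face}
    (htf : t.1 ⊆ f.1.1) (htb : Bornology.IsBounded t.1) {u v : V} (huv : u ≠ v)
    (hu : D.pos u ∈ closure t.1) (hv : D.pos v ∈ closure t.1) : M.Adj u v := by
  obtain ⟨a, b, hab, he⟩ := h.exists_base_edge hinc htf htb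
  have ha : D.pos a ∈ closure t.1 := by
    rw [← h.pos_eq]
    exact borders_iff.1 he (D'.pos_mem_arc_iff.2 (Sym2.mem_mk_left _ _))
  have hb : D.pos b ∈ closure t.1 := by
    rw [← h.pos_eq]
    exact borders_iff.1 he (D'.pos_mem_arc_iff.2 (Sym2.mem_mk_right _ _))
  -- The base edge already provides two boundary vertices, and there is no third.
  have key : ∀ w, D.pos w ∈ closure t.1 → w = a ∨ w = b := by
    intro w hw
    by_contra! hcon
    exact h.not_three_vertices h2 htf hab.ne hcon.1.symm hcon.2.symm ha hb hw
  rcases key u hu with rfl | rfl <;> rcases key v hv with rfl | rfl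
  exacts [absurd rfl huv, hab, hab.symm, absurd rfl huv]

end IsFacialDrawing

/-! ### A partition of the faces -/

section Partition

variable {V : Type*} {M : SimpleGraph V} {X : Type*} [MetricSpace X] [ProperSpace X] [IsPlane X]
  {D : PlaneDrawing M X} {Φ₁ Φ₂ : Set D.Face} (hΦ : IsCompl Φ₁ Φ₂)
  {D₁ : PlaneDrawing (D.facialGraph Φ₁) X} (h₁ : D.IsFacialDrawing Φ₁ D₁)
  {D₂ : PlaneDrawing (D.facialGraph Φ₂) X} (h₂ : D.IsFacialDrawing Φ₂ D₂)

include hΦ in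
omit [ProperSpace X] [IsPlane X] in
lemma mem_or_mem_of_isCompl (f : D.Face) : f ∈ Φ₁ ∨ f ∈ Φ₂ := by
  have := hΦ.sup_eq_top.ge (Set.mem_univ f)
  exact this

include hΦ in
omit [ProperSpace X] [IsPlane X] in
lemma notMem_of_isCompl {f : D.Face} (hf : f ∈ Φ₂) : f ∉ Φ₁ := fun hf' =>
  hΦ.disjoint.le_bot ⟨hf', hf⟩

include hΦ in
/-- All faces are bounded. -/
lemma isBounded_face_of_facial [Infinite V] (D₁ : PlaneDrawing (D.facialGraph Φ₁) X)
    (D₂ : PlaneDrawing (D.facialGraph Φ₂) X) (f : D.Face) : Bornology.IsBounded f.1 := by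
  refine f.isBounded ?_
  rcases mem_or_mem_of_isCompl hΦ f with hf | hf
  · exact IsFacialDrawing.finite_boundary D₁ ⟨f, hf⟩
  · exact IsFacialDrawing.finite_boundary D₂ ⟨f, hf⟩

/-- No vertex of the facial graph is isolated. -/
lemma facialGraph_exists_adj {Φ : Set D.Face} (hinc : ∀ w, ∃ w', M.Adj w w')
    (hb : ∀ f : D.Face, Bornology.IsBounded f.1) (w : V ⊕ Φ) :
    ∃ w', (D.facialGraph Φ).Adj w w' := by
  rcases w with w | f
  · obtain ⟨w', hw'⟩ := hinc w
    exact ⟨.inl w', hw'⟩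
  · obtain ⟨e, he⟩ := exists_borders_of_isBounded hinc (hb f.1)
    obtain ⟨u, v, huv, rfl⟩ := exists_isArc e
    exact ⟨.inl u, vertexOnBoundary_iff.2 (borders_iff.1 he (D.isArc huv).left_mem)⟩

variable (ω : V → Bool)

/-- The open sites of the first facial graph. -/
abbrev openSites (Φ : Set D.Face) (ω : V → Bool) : Set (V ⊕ Φ) :=
  {x | extendSites ω true x = true}

/-- The closed sites of the second facial graph. -/
abbrev closedSites (Φ : Set D.Face) (ω : V → Bool) : Set (V ⊕ Φ) :=
  {x | extendSites ω false x = false}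

variable {ω} {F : Set X} (hF : F ∈ D₁.facesOf (openSites Φ₁ ω))

include hF in
omit [ProperSpace X] [IsPlane X] in
lemma facesOf.disjoint : Disjoint F (D₁.occupied (openSites Φ₁ ω)
    (inducedEdges _ (openSites Φ₁ ω))) := by
  obtain ⟨x, hx⟩ := facesOf.nonempty hF
  rw [(facesOf.eq_region hF hx).1]
  exact Set.disjoint_left.2 (region_subset x)

include hF h₁ h₂ in
omit [ProperSpace X] [IsPlane X] in
lemma mem_closedSites_of_mem_face {x : V ⊕ Φ₂} (hx : D₂.pos x ∈ F) : x ∈ closedSites Φ₂ ω := by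
  rcases x with v | f
  · by_contra hcon
    rw [h₂.pos_eq, ← h₁.pos_eq] at hx
    have hv : (.inl v : V ⊕ Φ₁) ∈ openSites Φ₁ ω := by
      simpa [extendSites] using hcon
    exact (facesOf.disjoint hF).le_bot ⟨hx, D₁.pos_mem_occupied hv⟩
  · rfl

omit [ProperSpace X] [IsPlane X] in
lemma pos_notMem_openSites {v : V} (hv : ω v = false) :
    D₁.pos (.inl v) ∉ D₁.occupied (openSites Φ₁ ω) (inducedEdges _ (openSites Φ₁ ω)) := by
  have hv' : (.inl v : V ⊕ Φ₁) ∉ openSites Φ₁ ω := by simp [extendSites, hv]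
  rintro (⟨x, hx, hxv⟩ | hx)
  · exact hv' (D₁.pos_injective hxv ▸ hx)
  · obtain ⟨e, he, hx⟩ := Set.mem_iUnion₂.1 hx
    exact hv' (he _ (D₁.mem_of_pos_mem_arc _ _ hx))

include hF h₁ h₂ hΦ in
omit [ProperSpace X] [IsPlane X] in
/-- Adjacent closed sites of the second facial graph lie in the same face. -/
lemma pos_mem_face_of_adj {x y : V ⊕ Φ₂} (hxy : (D.facialGraph Φ₂).Adj x y)
    (hx : x ∈ closedSites Φ₂ ω) (hy : y ∈ closedSites Φ₂ ω) (hxF : D₂.pos x ∈ F) :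
    D₂.pos y ∈ F := by
  set e : (D.facialGraph Φ₂).edgeSet := ⟨s(x, y), hxy⟩ with he
  have hxe : D₂.pos x ∈ D₂.arc e := (D₂.isArc hxy).left_mem
  have hye : D₂.pos y ∈ D₂.arc e := (D₂.isArc hxy).right_mem
  have hc : IsPreconnected (D₂.arc e) := by
    obtain ⟨γ, hγ, -, -, -, hr⟩ := D₂.isArc hxy
    rw [← hr]
    exact isPreconnected_range hγ
  refine facesOf.subset_of_inter hF hc ⟨_, hxe, hxF⟩ ?_ hye
  obtain ⟨u, v, huv, he'⟩ | ⟨f, w, hw, he'⟩ := IsFacialDrawing.edge_cases e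
  · have hu : ω u = false := by
      have : .inl u ∈ (e : Sym2 (V ⊕ Φ₂)) := he' ▸ Sym2.mem_mk_left _ _
      rcases Sym2.mem_iff.1 this with rfl | rfl
      exacts [hx, hy]
    have hv : ω v = false := by
      have : .inl v ∈ (e : Sym2 (V ⊕ Φ₂)) := he' ▸ Sym2.mem_mk_right _ _
      rcases Sym2.mem_iff.1 this with rfl | rfl
      exacts [hx, hy]
    rw [he', h₂.arc_eq u v huv, ← h₁.arc_eq u v huv, Set.disjoint_left]
    intro z hz hz'
    by_cases hzo : z ∈ D₁.openArc ⟨s(.inl u, .inl v), huv⟩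
    · refine (D₁.openArc_disjoint_occupied ?_).notMem_of_mem_left hzo hz'
      intro hmem
      have : (.inl u : V ⊕ Φ₁) ∈ openSites Φ₁ ω := hmem _ (Sym2.mem_mk_left _ _)
      simp [extendSites, hu] at this
    · obtain ⟨w, hw, rfl⟩ : z ∈ D₁.pos '' {w | w ∈ s(.inl u, .inl v)} := by
        by_contra hcon
        exact hzo ⟨hz, hcon⟩
      rcases Sym2.mem_iff.1 hw with rfl | rfl
      exacts [pos_notMem_openSites hu hz', pos_notMem_openSites hv hz']
  · have hwω : ω w = false := by
      have : .inl w ∈ (e : Sym2 (V ⊕ Φ₂)) := he' ▸ Sym2.mem_mk_left _ _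
      rcases Sym2.mem_iff.1 this with rfl | rfl
      exacts [hx, hy]
    rw [he']
    refine Set.disjoint_of_subset_left (h₂.arc_subset w f hw) ?_
    rw [Set.disjoint_insert_left, ← h₁.pos_eq]
    exact ⟨pos_notMem_openSites hwω,
      h₁.disjoint_occupied_of_notMem (notMem_of_isCompl hΦ f.2)⟩

/-- The closed sites of the second facial graph that are seen from a face of the first one. -/
def anchors (ω : V → Bool) (Φ₂ : Set D.Face) (t : D₁.Face) : Set (V ⊕ Φ₂) :=
  {x | x.elim (fun v => ω v = false ∧ D.pos v ∈ closure t.1) (fun f => t.1 ⊆ f.1.1)}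

variable (h2 : ∀ w, (M.induce {w}ᶜ).Connected) (hinc : ∀ w, ∃ w', M.Adj w w') [Infinite V]

include hΦ h₁ in
lemma isBounded_facialFace (D₂ : PlaneDrawing (D.facialGraph Φ₂) X) (t : D₁.Face) :
    Bornology.IsBounded t.1 := by
  obtain ⟨f, hf⟩ := h₁.exists_face_supset t
  exact (isBounded_face_of_facial hΦ D₁ D₂ f).subset hf

-- Let `t` lie in the face `f`. If `f` is in `Φ₂`, its facial site is closed and adjacent to every
-- other anchor. If `f` is in `Φ₁`, all anchors are vertices on the boundary of `t`, and distinct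
-- ones are adjacent.
include hΦ h₁ h2 hinc in
lemma anchors_reachable (D₂ : PlaneDrawing (D.facialGraph Φ₂) X) {t : D₁.Face}
    {x y : closedSites Φ₂ ω} (hx : x.1 ∈ anchors ω Φ₂ t) (hy : y.1 ∈ anchors ω Φ₂ t) :
    ((D.facialGraph Φ₂).induce (closedSites Φ₂ ω)).Reachable x y := by
  obtain ⟨f, hf⟩ := h₁.exists_face_supset t
  have hmem : ∀ {v : V}, D.pos v ∈ closure t.1 → D.VertexOnBoundary v f := fun hv =>
    vertexOnBoundary_iff.2 (closure_mono hf hv)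
  have huniq : ∀ {g : D.Face}, t.1 ⊆ g.1 → g = f := by
    intro g hg
    obtain ⟨z, hz⟩ := t.nonempty
    exact Face.eq_of_mem (hg hz) (hf hz)
  by_cases hxy : x = y
  · rw [hxy]
  obtain ⟨x, hxc⟩ := x
  obtain ⟨y, hyc⟩ := y
  have hxy' : x ≠ y := fun h => hxy (Subtype.ext h)
  have hadj : ∀ {x y : V ⊕ Φ₂} (hxc : x ∈ closedSites Φ₂ ω) (hyc : y ∈ closedSites Φ₂ ω),
      (D.facialGraph Φ₂).Adj x y →
      ((D.facialGraph Φ₂).induce (closedSites Φ₂ ω)).Reachable ⟨x, hxc⟩ ⟨y, hyc⟩ :=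
    fun hxc hyc h => SimpleGraph.Adj.reachable h
  rcases mem_or_mem_of_isCompl hΦ f with hfΦ | hfΦ
  · rcases x with u | g
    · rcases y with v | g
      · have huv : u ≠ v := fun h => hxy' (congrArg _ h)
        refine hadj hxc hyc (show M.Adj u v from h₁.adj_of_mem_closure h2 ?_ (f := ⟨f, hfΦ⟩) hf
          (isBounded_facialFace hΦ h₁ D₂ t) huv hx.2 hy.2)
        exact facialGraph_exists_adj hinc (isBounded_face_of_facial hΦ D₁ D₂)
      · exact absurd (huniq hy ▸ hfΦ) (notMem_of_isCompl hΦ g.2)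
    · exact absurd (huniq hx ▸ hfΦ) (notMem_of_isCompl hΦ g.2)
  · have key : ∀ {z : V ⊕ Φ₂} (hzc : z ∈ closedSites Φ₂ ω), z ∈ anchors ω Φ₂ t →
        ((D.facialGraph Φ₂).induce (closedSites Φ₂ ω)).Reachable ⟨z, hzc⟩
          ⟨.inr ⟨f, hfΦ⟩, rfl⟩ := by
      rintro (v | g) hzc hz
      · exact hadj hzc rfl (show D.VertexOnBoundary v f from hmem hz.2)
      · have hg : g = ⟨f, hfΦ⟩ := Subtype.ext (huniq hz)
        subst hg
        rfl
    exact (key hxc hx).trans (key hyc hy).symm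

include hF hΦ h₁ h2 hinc in
/-- Closed sites seen from faces in the same face of the open subgraph are connected. -/
lemma anchors_reachable_of_subset (D₂ : PlaneDrawing (D.facialGraph Φ₂) X) {t t' : D₁.Face}
    (ht : t.1 ⊆ F) (ht' : t'.1 ⊆ F) {x y : closedSites Φ₂ ω} (hx : x.1 ∈ anchors ω Φ₂ t)
    (hy : y.1 ∈ anchors ω Φ₂ t') :
    ((D.facialGraph Φ₂).induce (closedSites Φ₂ ω)).Reachable x y := by
  obtain ⟨p⟩ := facesOf.reachable hF ht ht'
  clear ht ht'
  induction p generalizing x with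
  | nil => exact anchors_reachable hΦ h₁ h2 hinc D₂ hx hy
  | @cons t s t' hts p ih =>
    obtain ⟨-, e, he, het, hes⟩ := hts
    -- The crossed edge is not in the open subgraph, so it has a closed endpoint. Facial sites of
    -- the first graph are open, so this is a vertex, and it is an anchor of both faces.
    obtain ⟨z, hze, hz⟩ : ∃ z ∈ (e : Sym2 (V ⊕ Φ₁)), z ∉ openSites Φ₁ ω := by
      by_contra! hcon
      exact he hcon
    rcases z with v | g
    · have hv : ω v = false := by simpa [extendSites] using hz
      have hz' : (.inl v : V ⊕ Φ₂) ∈ closedSites Φ₂ ω := hv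
      have hpos := D₁.pos_mem_arc_iff.2 hze
      rw [h₁.pos_eq] at hpos
      exact (anchors_reachable hΦ h₁ h2 hinc D₂ (y := ⟨_, hz'⟩) hx
        ⟨hv, borders_iff.1 het hpos⟩).trans (ih (x := ⟨_, hz'⟩) ⟨hv, borders_iff.1 hes hpos⟩ hy)
    · exact absurd rfl hz

include hF h₁ h₂ hinc in
omit [Infinite V] in
/-- Each site of the second facial graph inside `F` is seen from a face inside `F`. -/
lemma exists_anchor {x : V ⊕ Φ₂} (hx : D₂.pos x ∈ F) :
    ∃ t : D₁.Face, t.1 ⊆ F ∧ x ∈ anchors ω Φ₂ t := by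
  have hxc := mem_closedSites_of_mem_face h₁ h₂ hF hx
  rcases x with v | f
  · obtain ⟨w, hw⟩ := hinc v
    rw [h₂.pos_eq] at hx
    set e : (D.facialGraph Φ₁).edgeSet := ⟨s(.inl v, .inl w), hw⟩
    obtain ⟨t, ht⟩ := exists_borders (D := D₁) e
    have hvt : D.pos v ∈ closure t.1 := by
      rw [← h₁.pos_eq]
      exact borders_iff.1 ht (D₁.pos_mem_arc_iff.2 (Sym2.mem_mk_left _ _))
    obtain ⟨y, hyF, hyt⟩ := mem_closure_iff.1 hvt F (facesOf.isOpen hF) hx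
    exact ⟨t, facesOf.face_subset hF ⟨y, hyt, hyF⟩, hxc, hvt⟩
  · obtain ⟨t, y, hyt, hyf, hyF⟩ := exists_face_inter (D := D₁)
      (f.1.isOpen.inter (facesOf.isOpen hF)) ⟨_, h₂.pos_mem f, hx⟩
    exact ⟨t, facesOf.face_subset hF ⟨y, hyt, hyF⟩, h₁.face_subset ⟨y, hyt, hyf⟩⟩

include hF hΦ h₁ h₂ h2 hinc in
/-- The sites of the second facial graph inside a face of the open subgraph of the first one form
a closed cluster, unless there are none. -/
lemma exists_closed_component :
    {x : V ⊕ Φ₂ | D₂.pos x ∈ F} = ∅ ∨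
      ∃ c : ((D.facialGraph Φ₂).induce (closedSites Φ₂ ω)).ConnectedComponent,
        {x : V ⊕ Φ₂ | D₂.pos x ∈ F} = Subtype.val '' c.supp := by
  rw [or_iff_not_imp_left, ← Ne, ← Set.nonempty_iff_ne_empty]
  rintro ⟨x₀, hx₀⟩
  have hx₀c := mem_closedSites_of_mem_face h₁ h₂ hF hx₀
  refine ⟨SimpleGraph.connectedComponentMk _ ⟨x₀, hx₀c⟩, ?_⟩
  ext y
  constructor
  · intro hy
    refine ⟨⟨y, mem_closedSites_of_mem_face h₁ h₂ hF hy⟩, ?_, rfl⟩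
    rw [SimpleGraph.ConnectedComponent.mem_supp_iff, SimpleGraph.ConnectedComponent.eq]
    obtain ⟨t, htF, hyt⟩ := exists_anchor h₁ h₂ hF hinc hy
    obtain ⟨t₀, ht₀F, hx₀t⟩ := exists_anchor h₁ h₂ hF hinc hx₀
    exact anchors_reachable_of_subset hΦ h₁ hF h2 hinc D₂ htF ht₀F hyt hx₀t
  · rintro ⟨⟨y, hyc⟩, hy, rfl⟩
    rw [SimpleGraph.ConnectedComponent.mem_supp_iff, SimpleGraph.ConnectedComponent.eq] at hy
    obtain ⟨p⟩ := hy.symm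
    suffices ∀ (x y : closedSites Φ₂ ω)
        (_ : ((D.facialGraph Φ₂).induce (closedSites Φ₂ ω)).Walk x y),
        D₂.pos x ∈ F → D₂.pos y ∈ F from this _ _ p hx₀
    intro x y p
    induction p with
    | nil => exact id
    | cons hxy p ih => exact fun hx => ih (pos_mem_face_of_adj hΦ h₁ h₂ hF hxy (Subtype.prop _)
        (Subtype.prop _) hx)

include hF hΦ h₁ h₂ hinc in
/-- An unbounded face of the open subgraph of the first facial graph contains infinitely many
sites of the second one. -/
lemma infinite_sites (hb : ¬ Bornology.IsBounded F) : {x : V ⊕ Φ₂ | D₂.pos x ∈ F}.Infinite := by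
  intro hfin
  have hfb := isBounded_facialFace hΦ h₁ D₂
  have hinc₁ := facialGraph_exists_adj (Φ := Φ₁) hinc (isBounded_face_of_facial hΦ D₁ D₂)
  refine facesOf.infinite_faces hF hfb hb ?_
  -- Each site is an anchor of finitely many faces, so it suffices that every face inside `F` has an
  -- anchor in `F`.
  refine (hfin.biUnion (t := fun x => {t : D₁.Face | x ∈ anchors ω Φ₂ t}) ?_).subset ?_
  · rintro (v | f) -
    · refine (finite_faces_at hinc₁ (.inl v)).subset fun t ht => ?_
      change D₁.pos (.inl v) ∈ closure t.1
      rw [h₁.pos_eq]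
      exact ht.2
    · refine Set.Subsingleton.finite fun t ht t' ht' => Subtype.ext ?_
      have hf := notMem_of_isCompl hΦ f.2
      exact (h₁.eq_of_subset_of_notMem ht hf).trans (h₁.eq_of_subset_of_notMem ht' hf).symm
  · intro t ht
    by_contra hcon
    simp only [Set.mem_iUnion, not_exists] at hcon
    obtain ⟨f, hf⟩ := h₁.exists_face_supset t
    -- A face without an anchor in `F` has only open sites on its boundary. It is then all of `F`,
    -- which would be bounded.
    refine hb (facesOf.eq_face hF ht ?_ ▸ hfb t)
    rintro (v | g) hv
    · by_contra hv'
      have hvω : ω v = false := by simpa [extendSites] using hv'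
      refine hcon (.inl v) ?_ ⟨hvω, by rwa [h₁.pos_eq] at hv⟩
      change D₂.pos (.inl v) ∈ F
      rw [h₂.pos_eq, ← h₁.pos_eq]
      exact facesOf.subset_of_closure_inter hF isPreconnected_singleton
        ⟨_, rfl, closure_mono ht hv⟩ (Set.disjoint_singleton_left.2 (pos_notMem_openSites hvω)) rfl
    · rfl

end Partition

end PlaneDrawing

end

/-! ### Numbers of infinite components -/

/-- The injection induces an injection on components that matches the infinite ones. The last
hypothesis guards against infinite components met in only finitely many points. -/
lemma numInfComponents_eq_of_reachable_iff {A B : Type*} {H : SimpleGraph A} {H' : SimpleGraph B}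
    {i : A → B} (hi : Function.Injective i)
    (hr : ∀ a a', H.Reachable a a' ↔ H'.Reachable (i a) (i a'))
    (hinf : ∀ c : H'.ConnectedComponent, c.supp.Infinite → (i ⁻¹' c.supp).Infinite) :
    numInfComponents H = numInfComponents H' := by
  let f : H.ConnectedComponent → H'.ConnectedComponent :=
    SimpleGraph.ConnectedComponent.lift (fun a => H'.connectedComponentMk (i a))
      (fun a a' p _ => SimpleGraph.ConnectedComponent.eq.2 ((hr a a').1 ⟨p⟩))
  have hf : ∀ a, f (H.connectedComponentMk a) = H'.connectedComponentMk (i a) := fun a => rfl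
  have hfi : Function.Injective f := by
    intro c c' h
    induction c using SimpleGraph.ConnectedComponent.ind with | _ a =>
    induction c' using SimpleGraph.ConnectedComponent.ind with | _ a' =>
    rw [hf, hf, SimpleGraph.ConnectedComponent.eq] at h
    exact SimpleGraph.ConnectedComponent.eq.2 ((hr a a').2 h)
  have hsupp : ∀ c, c.supp = i ⁻¹' (f c).supp := by
    intro c
    induction c using SimpleGraph.ConnectedComponent.ind with | _ a =>
    ext a'
    rw [Set.mem_preimage, hf]
    simp only [SimpleGraph.ConnectedComponent.mem_supp_iff, SimpleGraph.ConnectedComponent.eq]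
    exact hr a' a
  unfold numInfComponents
  rw [← hfi.encard_image]
  congr 1
  ext c'
  constructor
  · rintro ⟨c, hc, rfl⟩ hfin
    refine hc ?_
    rw [hsupp]
    exact hfin.preimage hi.injOn
  · intro hc'
    have := hinf c' hc'
    obtain ⟨a, ha⟩ := this.nonempty
    have hfa : f (H.connectedComponentMk a) = c' := ha
    refine ⟨_, ?_, hfa⟩
    rw [← hfa, ← hsupp] at this
    exact this

/-- The sets `g F` partition the vertices and no edge joins two of them. Being a component is
required only of the infinite ones, since `g F` may be empty. -/
lemma numInfComponents_eq_encard {W ι : Type*} {H : SimpleGraph W} (𝓕 : Set ι) (g : ι → Set W)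
    (hc : ∀ F ∈ 𝓕, (g F).Infinite → ∃ c : H.ConnectedComponent, c.supp = g F)
    (hcov : ∀ w, ∃ F ∈ 𝓕, w ∈ g F)
    (hcon : ∀ F ∈ 𝓕, ∀ w w', H.Adj w w' → w ∈ g F → w' ∈ g F)
    (hdisj : ∀ F ∈ 𝓕, ∀ F' ∈ 𝓕, ∀ w, w ∈ g F → w ∈ g F' → F = F') :
    numInfComponents H = {F ∈ 𝓕 | (g F).Infinite}.encard := by
  have h1 : Set.InjOn g {F ∈ 𝓕 | (g F).Infinite} := by
    intro F hF F' hF' h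
    obtain ⟨w, hw⟩ := hF.2.nonempty
    exact hdisj F hF.1 F' hF'.1 w hw (h ▸ hw)
  have h2 : Function.Injective (SimpleGraph.ConnectedComponent.supp (G := H)) :=
    SimpleGraph.ConnectedComponent.supp_injective
  rw [numInfComponents, ← h1.encard_image, ← h2.encard_image]
  congr 1
  ext A
  constructor
  · rintro ⟨c, hcinf, rfl⟩
    obtain ⟨w, hw⟩ := Set.Infinite.nonempty hcinf
    obtain ⟨F, hF, hwF⟩ := hcov w
    have hsub : c.supp ⊆ g F := by
      intro w' hw'
      have : H.Reachable w w' := SimpleGraph.ConnectedComponent.eq.1 (hw.trans hw'.symm)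
      obtain ⟨p⟩ := this
      clear hw hw'
      induction p with
      | nil => exact hwF
      | cons h p ih => exact ih (hcon F hF _ _ h hwF)
    have hinf : (g F).Infinite := Set.Infinite.mono hsub hcinf
    obtain ⟨c', hc'⟩ := hc F hF hinf
    refine ⟨F, ⟨hF, hinf⟩, ?_⟩
    rw [← hc'] at hwF ⊢
    have hw' : H.connectedComponentMk w = c' := hwF
    have hw'' : H.connectedComponentMk w = c := hw
    rw [← hw', hw'']
  · rintro ⟨F, ⟨hF, hinf⟩, rfl⟩
    obtain ⟨c, hcF⟩ := hc F hF hinf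
    refine ⟨c, ?_, hcF⟩
    change c.supp.Infinite
    rwa [hcF]

lemma siteToBond_mk {W : Type*} {H : SimpleGraph W} {ω : W → Bool} {u v : W} (h : H.Adj u v) :
    siteToBond H ω ⟨s(u, v), h⟩ = (ω u && ω v) := rfl

lemma siteToBond_eq_true_iff {W : Type*} {H : SimpleGraph W} {ω : W → Bool} (e : H.edgeSet) :
    siteToBond H ω e = true ↔ ∀ w ∈ (e : Sym2 W), ω w = true := by
  obtain ⟨e, he⟩ := e
  induction e with
  | h u v => rw [siteToBond_mk he]; simp

/-- The two graphs differ by the closed vertices, which are isolated in the bond graph and so belong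
to no infinite component. -/
lemma numInfComponents_induce_eq_bondGraph {W : Type*} (H : SimpleGraph W) (ω : W → Bool) :
    numInfComponents (H.induce {w | ω w = true}) =
      numInfComponents (bondGraph H (siteToBond H ω)) := by
  have hadj : ∀ {u v}, (bondGraph H (siteToBond H ω)).Adj u v →
      H.Adj u v ∧ ω u = true ∧ ω v = true := by
    rintro u v ⟨h, h'⟩
    rw [siteToBond_mk, Bool.and_eq_true] at h'
    exact ⟨h, h'⟩
  refine numInfComponents_eq_of_reachable_iff (i := Subtype.val) Subtype.val_injective ?_ ?_
  · intro a a'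
    constructor
    · rintro ⟨p⟩
      induction p with
      | nil => rfl
      | @cons x y z h p ih =>
        refine SimpleGraph.Reachable.trans (SimpleGraph.Adj.reachable ?_) ih
        have h' : H.Adj x y := h
        refine ⟨h', ?_⟩
        rw [siteToBond_mk, Bool.and_eq_true]
        exact ⟨x.2, y.2⟩
    · rintro ⟨p⟩
      suffices ∀ {x y : W} (_ : (bondGraph H (siteToBond H ω)).Walk x y)
          (hx : ω x = true) (hy : ω y = true),
          (H.induce {w | ω w = true}).Reachable ⟨x, hx⟩ ⟨y, hy⟩ from this p a.2 a'.2
      intro x y p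
      induction p with
      | nil => exact fun _ _ => SimpleGraph.Reachable.refl _
      | @cons x y z h p ih =>
        intro hx hz
        have hadj' : (H.induce {w | ω w = true}).Adj ⟨x, hx⟩ ⟨y, (hadj h).2.2⟩ := (hadj h).1
        exact hadj'.reachable.trans (ih (hadj h).2.2 hz)
  · intro c hc
    have hsub : c.supp ⊆ {w | ω w = true} := by
      intro w hw
      obtain ⟨w', hw', hne⟩ := hc.exists_notMem_finset {w}
      simp only [Finset.mem_singleton] at hne
      obtain ⟨p⟩ : (bondGraph H (siteToBond H ω)).Reachable w w' :=
        SimpleGraph.ConnectedComponent.eq.1 (Eq.trans hw hw'.symm)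
      cases p with
      | nil => exact absurd rfl hne
      | cons h p => exact (hadj h).2.1
    refine Set.Infinite.preimage hc ?_
    rwa [Subtype.range_coe]

namespace PlaneDrawing

/-- A step along a diagonal is a detour through a facial site, and conversely. Infinite components
keep infinitely many vertices of `V`, because each vertex has finitely many adjacent facial sites.
-/
lemma numInfComponents_addDiagonals {V : Type*} {M : SimpleGraph V} {X : Type*} [MetricSpace X]
    {D : PlaneDrawing M X} {Φ : Set D.Face} (D' : PlaneDrawing (D.facialGraph Φ) X)
    {S : Set V} {S' : Set (V ⊕ Φ)} (hl : ∀ v, .inl v ∈ S' ↔ v ∈ S) (hr : ∀ f, .inr f ∈ S') :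
    numInfComponents ((D.addDiagonals Φ).induce S) =
      numInfComponents ((D.facialGraph Φ).induce S') := by
  have hadj : ∀ {x y : V ⊕ Φ} (hx : x ∈ S') (hy : y ∈ S'), (D.facialGraph Φ).Adj x y →
      ((D.facialGraph Φ).induce S').Reachable ⟨x, hx⟩ ⟨y, hy⟩ :=
    fun hx hy h => SimpleGraph.Adj.reachable h
  have hadj' : ∀ {u v : V} (hu : u ∈ S) (hv : v ∈ S), (D.addDiagonals Φ).Adj u v →
      ((D.addDiagonals Φ).induce S).Reachable ⟨u, hu⟩ ⟨v, hv⟩ :=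
    fun hx hy h => SimpleGraph.Adj.reachable h
  -- A walk may stop at a facial site, so positions are compared through the vertices around the
  -- site, which are pairwise adjacent or equal.
  let near : V ⊕ Φ → Set V := fun x => x.elim (fun v => {v}) (fun f => {v | D.VertexOnBoundary v f.1})
  have hnear : ∀ (x : V ⊕ Φ) (u v : S), u.1 ∈ near x → v.1 ∈ near x →
      ((D.addDiagonals Φ).induce S).Reachable u v := by
    rintro (w | f) u v hu hv
    · have : u = v := Subtype.ext (hu.trans hv.symm)
      rw [this]
    · by_cases huv : u = v
      · rw [huv]
      · exact hadj' u.2 v.2 (Or.inr ⟨fun h => huv (Subtype.ext h), f, f.2, hu, hv⟩)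
  refine numInfComponents_eq_of_reachable_iff (i := fun v : S => ⟨.inl v.1, (hl v.1).2 v.2⟩)
    (fun u v h => Subtype.ext (Sum.inl_injective (congrArg Subtype.val h))) ?_ ?_
  · intro a a'
    constructor
    · rintro ⟨p⟩
      induction p with
      | nil => rfl
      | @cons x y z h p ih =>
        refine SimpleGraph.Reachable.trans ?_ ih
        obtain h | ⟨-, f, hf, hxf, hyf⟩ := (show (D.addDiagonals Φ).Adj x y from h)
        · exact hadj _ _ h
        · exact (hadj _ (hr ⟨f, hf⟩) (show (D.facialGraph Φ).Adj (.inl x.1) (.inr ⟨f, hf⟩) from hxf)).trans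
            (hadj (hr ⟨f, hf⟩) _ (show (D.facialGraph Φ).Adj (.inr ⟨f, hf⟩) (.inl y.1) from hyf))
    · rintro ⟨p⟩
      suffices ∀ {x y : S'} (_ : ((D.facialGraph Φ).induce S').Walk x y) (u v : S),
          u.1 ∈ near x.1 → v.1 ∈ near y.1 → ((D.addDiagonals Φ).induce S).Reachable u v from
        this p a a' rfl rfl
      intro x y p
      induction p with
      | @nil x => exact hnear x.1
      | @cons x y z h p ih =>
        intro u v hu hv
        obtain ⟨x, hx⟩ := x
        obtain ⟨y, hy⟩ := y
        have hxy : (D.facialGraph Φ).Adj x y := h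
        rcases x with w | f
        · obtain rfl : u = ⟨w, (hl w).1 hx⟩ := Subtype.ext hu
          rcases y with w' | g
          · exact (hadj' ((hl w).1 hx) ((hl w').1 hy) (Or.inl hxy)).trans
              (ih ⟨w', (hl w').1 hy⟩ v rfl hv)
          · exact ih _ v hxy hv
        · rcases y with w' | g
          · exact (hnear (.inr f) u ⟨w', (hl w').1 hy⟩ hu hxy).trans
              (ih ⟨w', (hl w').1 hy⟩ v rfl hv)
          · exact hxy.elim
  · intro c hc hfin
    refine hc ?_
    have hfinE : ∀ v : V, {f : Φ | D.VertexOnBoundary v f.1}.Finite := by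
      intro v
      refine Set.Finite.of_injOn (f := fun f : Φ => (s(.inl v, .inr f) : Sym2 (V ⊕ Φ)))
        (fun f hf => ?_) (fun f _ g _ hfg => by simpa using hfg)
        ((D'.finite_incident (.inl v)).image Subtype.val)
      exact ⟨IsFacialDrawing.spoke f hf, Sym2.mem_mk_left _ _, rfl⟩
    have h1 : (Subtype.val '' c.supp).Finite := by
      refine ((hfin.image fun v : S => (.inl v.1 : V ⊕ Φ)).union
        (hfin.biUnion fun v _ => (hfinE v.1).image (Sum.inr : Φ → V ⊕ Φ))).subset ?_
      rintro _ ⟨⟨v | f, hx⟩, hxc, rfl⟩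
      · exact Or.inl ⟨⟨v, (hl v).1 hx⟩, hxc, rfl⟩
      · obtain ⟨y, hy, hne⟩ := hc.exists_notMem_finset {⟨.inr f, hx⟩}
        simp only [Finset.mem_singleton] at hne
        obtain ⟨p⟩ : ((D.facialGraph Φ).induce S').Reachable ⟨.inr f, hx⟩ y :=
          SimpleGraph.ConnectedComponent.eq.1 (Eq.trans hxc hy.symm)
        cases p with
        | nil => exact absurd rfl hne
        | @cons _ z _ h p =>
          obtain ⟨z, hz⟩ := z
          have hfz : (D.facialGraph Φ).Adj (.inr f) z := h
          rcases z with v | g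
          · have hfv : (.inr f : V ⊕ Φ) ∈ Sum.inr '' {f : Φ | D.VertexOnBoundary v f.1} :=
              ⟨f, hfz, rfl⟩
            refine Or.inr (Set.mem_biUnion (x := ⟨v, (hl v).1 hz⟩) ?_ hfv)
            exact (SimpleGraph.ConnectedComponent.eq.2 h.reachable.symm).trans hxc
          · exact hfz.elim
    exact h1.of_finite_image Subtype.val_injective.injOn

end PlaneDrawing

/-! ### One-dependence -/

section OneDependence

variable {V Φ : Type*} {H : SimpleGraph (V ⊕ Φ)}

lemma measurable_siteToBond_of_endpoints {m : MeasurableSpace (V → Bool)} (b : Bool)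
    (e : H.edgeSet) (hm : ∀ v, .inl v ∈ (e : Sym2 (V ⊕ Φ)) → Measurable[m] fun ω : V → Bool => ω v) :
    Measurable[m] fun ω : V → Bool => siteToBond H (extendSites ω b) e := by
  obtain ⟨e, he⟩ := e
  induction e with
  | h x y =>
    have key : ∀ z, z ∈ s(x, y) → Measurable[m] fun ω : V → Bool => (extendSites ω b z : Bool) := by
      rintro (v | f) hz
      · exact hm v hz
      · exact measurable_const
    have h := (Measurable.of_discrete (f := fun p : Bool × Bool => p.1 && p.2)).comp
      ((key x (Sym2.mem_mk_left x y)).prodMk (key y (Sym2.mem_mk_right x y)))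
    exact h

lemma measurable_siteToBond (b : Bool) :
    Measurable fun ω : V → Bool => siteToBond H (extendSites ω b) :=
  measurable_pi_iff.2 fun e => measurable_siteToBond_of_endpoints b e fun v _ =>
    measurable_pi_apply v

/-- The states of the edges in `A` are measurable for the σ-algebra of their endpoints in `V`;
facial sites are deterministic and contribute nothing. -/
lemma measurable_siteToBond_restrict (b : Bool) (A : Set H.edgeSet) :
    Measurable[⨆ v ∈ {v | ∃ e ∈ A, .inl v ∈ (e : Sym2 (V ⊕ Φ))},
      MeasurableSpace.comap (fun ω : V → Bool => ω v) ⊤]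
      fun ω (e : A) => siteToBond H (extendSites ω b) e := by
  let m := ⨆ v ∈ {v | ∃ e ∈ A, .inl v ∈ (e : Sym2 (V ⊕ Φ))},
    MeasurableSpace.comap (fun ω : V → Bool => ω v) ⊤
  refine @measurable_pi_lambda _ _ _ m _ _ fun e => ?_
  apply measurable_siteToBond_of_endpoints b e.1
  intro v hv
  refine Measurable.mono (comap_measurable (m := ⊤) fun ω : V → Bool => ω v) ?_ le_top
  exact le_iSup₂_of_le v ⟨e.1, e.2, hv⟩ le_rfl

/-- Edge sets without common endpoints have disjoint sets of endpoints in `V`, and disjoint families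
of independent coordinates generate independent σ-algebras. -/
lemma isOneDependent_siteToBond (b : Bool) (p : I) :
    IsOneDependent H ((sitePercolation V p).map
      (fun ω : V → Bool => siteToBond H (extendSites ω b))) := by
  intro A B hAB
  set g : (V → Bool) → H.edgeSet → Bool := fun ω => siteToBond H (extendSites ω b)
  have hg : Measurable g := measurable_siteToBond b
  let m : V → MeasurableSpace (V → Bool) := fun v => MeasurableSpace.comap (fun ω => ω v) ⊤
  let ends (A : Set H.edgeSet) : Set V := {v | ∃ e ∈ A, .inl v ∈ (e : Sym2 (V ⊕ Φ))}
  have hdisj : Disjoint (ends A) (ends B) := by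
    rw [Set.disjoint_left]
    rintro v ⟨e, he, hve⟩ ⟨e', he', hve'⟩
    exact hAB e he e' he' _ hve hve'
  have hind : iIndep m (sitePercolation V p) :=
    (iIndepFun_infinitePi (P := fun _ : V => bernoulliMeasure true false p)
      (X := fun _ => id) (fun _ => measurable_id)).iIndep
  have hle : ∀ v, m v ≤ MeasurableSpace.pi := fun v => (measurable_pi_apply v).comap_le
  have hI : Indep (⨆ v ∈ ends A, m v) (⨆ v ∈ ends B, m v) (sitePercolation V p) :=
    indep_iSup_of_disjoint hle hind hdisj
  have hres : ∀ A : Set H.edgeSet, Measurable fun (β : H.edgeSet → Bool) (e : A) => β e :=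
    fun A => measurable_pi_iff.2 fun e => measurable_pi_apply e.1
  rw [IndepFun_iff]
  rintro _ _ ⟨s, hs, rfl⟩ ⟨t, ht, rfl⟩
  rw [Measure.map_apply hg ((hres A hs).inter (hres B ht)), Measure.map_apply hg (hres A hs),
    Measure.map_apply hg (hres B ht)]
  exact (Indep_iff _ _ _).1 hI _ _ (measurable_siteToBond_restrict b A hs)
    (measurable_siteToBond_restrict b B ht)

end OneDependence

/-! ### Infinite clusters counted by unbounded faces -/

namespace PlaneDrawing

section Counting

variable {V : Type*} {M : SimpleGraph V} {X : Type*} [MetricSpace X] [ProperSpace X] [IsPlane X]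
  {D : PlaneDrawing M X} {Φ₁ Φ₂ : Set D.Face} (hΦ : IsCompl Φ₁ Φ₂)
  {D₁ : PlaneDrawing (D.facialGraph Φ₁) X} (h₁ : D.IsFacialDrawing Φ₁ D₁)
  {D₂ : PlaneDrawing (D.facialGraph Φ₂) X} (h₂ : D.IsFacialDrawing Φ₂ D₂)
  (h2 : ∀ w, (M.induce {w}ᶜ).Connected) (hinc : ∀ w, ∃ w', M.Adj w w') [Infinite V] (ω : V → Bool)

omit [ProperSpace X] [IsPlane X] in
lemma facesOf.eq_of_mem {W : Type*} {G : SimpleGraph W} {D : PlaneDrawing G X} {S : Set W}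
    {F F' : Set X} (hF : F ∈ D.facesOf S) (hF' : F' ∈ D.facesOf S) {x : X} (hx : x ∈ F)
    (hx' : x ∈ F') : F = F' :=
  (facesOf.eq_region hF hx).1.trans (facesOf.eq_region hF' hx').1.symm

omit [ProperSpace X] [IsPlane X] in
lemma exists_facesOf_mem {W : Type*} {G : SimpleGraph W} {D : PlaneDrawing G X} {S : Set W}
    {x : X} (hx : x ∉ D.occupied S (inducedEdges G S)) : ∃ F ∈ D.facesOf S, x ∈ F :=
  ⟨_, ⟨x, hx, rfl⟩, mem_connectedComponentIn hx⟩

include hΦ h₁ hinc in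
/-- The open dual has as many infinite components as the open subgraph has unbounded faces. -/
lemma numInfComponents_dualGraph (D₂ : PlaneDrawing (D.facialGraph Φ₂) X) :
    numInfComponents (D₁.dualGraph (inducedEdges _ (openSites Φ₁ ω))ᶜ) =
      {F ∈ D₁.facesOf (openSites Φ₁ ω) | ¬ Bornology.IsBounded F}.encard := by
  have hfb := isBounded_facialFace hΦ h₁ D₂
  have hinc₁ := facialGraph_exists_adj (Φ := Φ₁) hinc (isBounded_face_of_facial hΦ D₁ D₂)
  rw [numInfComponents_eq_encard (D₁.facesOf (openSites Φ₁ ω)) fun F => {t : D₁.Face | t.1 ⊆ F}]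
  · congr 1
    ext F
    refine and_congr_right fun hF => ⟨fun h hb => h (facesOf.finite_faces hinc₁ hb),
      facesOf.infinite_faces hF hfb⟩
  · intro F hF _
    obtain ⟨c, hc, -⟩ := facesOf.exists_component hF
    exact ⟨c, hc⟩
  · intro t
    obtain ⟨x, hx⟩ := t.nonempty
    obtain ⟨F, hF, hxF⟩ := exists_facesOf_mem (D := D₁) (S := openSites Φ₁ ω)
      (t.disjoint_occupied.notMem_of_mem_left hx)
    exact ⟨F, hF, facesOf.face_subset hF ⟨x, hx, hxF⟩⟩
  · intro F hF t t' h ht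
    obtain ⟨x, hx⟩ := t.nonempty
    have hFx := (facesOf.eq_region hF (ht hx)).1
    have := subset_region_of_dualGraph_adj (P := openSites Φ₁ ω) h (x := x)
      (show t.1 ⊆ _ by rw [← hFx]; exact ht)
    rwa [← hFx] at this
  · intro F hF F' hF' t ht ht'
    obtain ⟨x, hx⟩ := t.nonempty
    exact facesOf.eq_of_mem hF hF' (ht hx) (ht' hx)

include hΦ h₁ h₂ hinc h2 in
/-- The closed subgraph of the second facial graph has as many infinite components as the open
subgraph of the first one has unbounded faces. -/
lemma numInfComponents_closedSites :
    numInfComponents ((D.facialGraph Φ₂).induce (closedSites Φ₂ ω)) =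
      {F ∈ D₁.facesOf (openSites Φ₁ ω) | ¬ Bornology.IsBounded F}.encard := by
  rw [numInfComponents_eq_encard (D₁.facesOf (openSites Φ₁ ω))
    fun F => {x : closedSites Φ₂ ω | D₂.pos x.1 ∈ F}]
  · congr 1
    ext F
    refine and_congr_right fun hF => ⟨fun h hb => h ?_, fun hb hfin => ?_⟩
    · have hfin : {x : V ⊕ Φ₂ | D₂.pos x ∈ F}.Finite :=
        (D₂.proper _ hb.isCompact_closure).1.subset fun x hx => subset_closure hx
      exact hfin.preimage (f := Subtype.val) Subtype.val_injective.injOn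
    · refine infinite_sites hΦ h₁ h₂ hF hinc hb ((hfin.image Subtype.val).subset fun x hx => ?_)
      exact ⟨⟨x, mem_closedSites_of_mem_face h₁ h₂ hF hx⟩, hx, rfl⟩
  · intro F hF hinf
    obtain ⟨⟨x, hxc⟩, hx⟩ := hinf.nonempty
    rcases exists_closed_component hΦ h₁ h₂ hF h2 hinc with h | ⟨c, hc⟩
    · have hx' : x ∈ {x : V ⊕ Φ₂ | D₂.pos x ∈ F} := hx
      rw [h] at hx'
      exact hx'.elim
    · refine ⟨c, ?_⟩
      ext ⟨y, hyc⟩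
      have := Set.ext_iff.1 hc y
      simp only [Set.mem_ofPred_eq, Set.mem_image] at this
      rw [Set.mem_ofPred_eq, this]
      constructor
      · exact fun h => ⟨_, h, rfl⟩
      · rintro ⟨z, hz, rfl⟩
        exact hz
  · rintro ⟨v | f, hx⟩
    · obtain ⟨F, hF, hxF⟩ := exists_facesOf_mem (pos_notMem_openSites (D₁ := D₁) hx)
      refine ⟨F, hF, ?_⟩
      rw [h₁.pos_eq, ← h₂.pos_eq] at hxF
      exact hxF
    · obtain ⟨F, hF, hxF⟩ := exists_facesOf_mem (D := D₁) (S := openSites Φ₁ ω)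
        ((h₁.disjoint_occupied_of_notMem (notMem_of_isCompl hΦ f.2)).notMem_of_mem_left
          (h₂.pos_mem f))
      exact ⟨F, hF, hxF⟩
  · intro F hF x y h hx
    exact pos_mem_face_of_adj hΦ h₁ h₂ hF h x.2 y.2 hx
  · intro F hF F' hF' x hx hx'
    exact facesOf.eq_of_mem hF hF' hx hx'

end Counting

end PlaneDrawing
theorem mainTheorem8 {V X : Type*} [MetricSpace X]
    -- the plane `X` is the Euclidean or the hyperbolic plane
    (hX : Nonempty (X ≃ᵢ EuclideanSpace ℝ (Fin 2)) ∨ Nonempty (X ≃ᵢ UpperHalfPlane))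
    (M : SimpleGraph V) (hM : IsQuasiTransitiveTwoConnected M) (hends : numEnds M = 1)
    (D : PlaneDrawing M X) (hD : D.IsCanonical)
    (Φ₁ Φ₂ : Set D.Face) (hΦ : D.IsMatchingPair Φ₁ Φ₂) :
    -- the bond configuration is one-dependent under `ℙ_p`
    (∀ p : I,
      Measurable (fun ω : V → Bool => siteToBond (D.facialGraph Φ₁) (extendSites ω true)) ∧
      IsOneDependent (D.facialGraph Φ₁) ((sitePercolation V p).map
        (fun ω : V → Bool => siteToBond (D.facialGraph Φ₁) (extendSites ω true)))) ∧
    ∀ (D₁ : PlaneDrawing (D.facialGraph Φ₁) X) (_ : D.IsFacialDrawing Φ₁ D₁)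
      (D₂ : PlaneDrawing (D.facialGraph Φ₂) X) (_ : D.IsFacialDrawing Φ₂ D₂)
      (ω : V → Bool)
      (S₁ : Set (V ⊕ Φ₁)) (_ : S₁ = {x | extendSites ω true x = true})
      (S₂ : Set (V ⊕ Φ₂)) (_ : S₂ = {x | extendSites ω false x = false})
      (β : (D.facialGraph Φ₁).edgeSet → Bool)
      (_ : β = siteToBond (D.facialGraph Φ₁) (extendSites ω true)),
    -- (a) cycles and doubly-infinite paths of open sites give cutsets of the dual
    (∀ (x : V ⊕ Φ₁) (C : (D.facialGraph Φ₁).Walk x x), C.IsCycle → (∀ y ∈ C.support, y ∈ S₁) →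
      {e : (D.facialGraph Φ₁).edgeSet | (e : Sym2 (V ⊕ Φ₁)) ∈ C.edges}.Finite ∧
      D₁.IsDualCutset {e | (e : Sym2 (V ⊕ Φ₁)) ∈ C.edges}) ∧
    (∀ c : ℤ → V ⊕ Φ₁, Function.Injective c → (∀ i, c i ∈ S₁) →
      (∀ i, (D.facialGraph Φ₁).Adj (c i) (c (i + 1))) →
      {e : (D.facialGraph Φ₁).edgeSet | ∃ i, (e : Sym2 (V ⊕ Φ₁)) = s(c i, c (i + 1))}.Infinite ∧
      D₁.IsDualCutset {e | ∃ i, (e : Sym2 (V ⊕ Φ₁)) = s(c i, c (i + 1))}) ∧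
    (∀ F ∈ D₁.facesOf S₁,
      -- (b) dual vertices and open dual edges inside `F` form a component of the open dual
      {f : D₁.Face | (f : Set X) ⊆ F}.Nonempty ∧
      (∃ c : (D₁.dualGraph {e | dualConfig β e = true}).ConnectedComponent,
        c.supp = {f : D₁.Face | (f : Set X) ⊆ F} ∧
        ∀ e, dualConfig β e = true → ((∃ f ∈ c.supp, D₁.Borders e f) ↔ D₁.openArc e ⊆ F)) ∧
      -- (c) the sites of the second graph inside `F` form a possibly empty closed cluster
      ({x : V ⊕ Φ₂ | D₂.pos x ∈ F} = ∅ ∨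
        ∃ c : ((D.facialGraph Φ₂).induce S₂).ConnectedComponent,
          {x : V ⊕ Φ₂ | D₂.pos x ∈ F} = Subtype.val '' c.supp) ∧
      -- (d) the face and the two clusters are all bounded or all unbounded
      ((Bornology.IsBounded F ∧ {f : D₁.Face | (f : Set X) ⊆ F}.Finite ∧
          {x : V ⊕ Φ₂ | D₂.pos x ∈ F}.Finite) ∨
        (¬ Bornology.IsBounded F ∧ {f : D₁.Face | (f : Set X) ⊆ F}.Infinite ∧
          {x : V ⊕ Φ₂ | D₂.pos x ∈ F}.Infinite))) ∧
    -- numbers of infinite clusters on the graphs with facial sites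
    numInfComponents ((D.facialGraph Φ₁).induce S₁)
      = numInfComponents (bondGraph (D.facialGraph Φ₁) β) ∧
    numInfComponents ((D.facialGraph Φ₂).induce S₂)
      = numInfComponents (D₁.dualGraph {e | dualConfig β e = true}) ∧
    -- numbers of infinite clusters on the matching pair
    numInfComponents ((D.addDiagonals Φ₁).induce {v | ω v = true})
      = numInfComponents (bondGraph (D.facialGraph Φ₁) β) ∧
    numInfComponents ((D.addDiagonals Φ₁).induce {v | ω v = true})
      = numInfComponents (bondGraph (D.addDiagonals Φ₁) (siteToBond (D.addDiagonals Φ₁) ω)) ∧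
    numInfComponents ((D.addDiagonals Φ₂).induce {v | ω v = false})
      = numInfComponents (D₁.dualGraph {e | dualConfig β e = true}) := by
  obtain ⟨hp, hpl⟩ := isPlane_of_isometryEquiv hX
  have := hM.infinite
  have hinc : ∀ w, ∃ w', M.Adj w w' := fun w =>
    hM.connected.preconnected.exists_adj_of_nontrivial w
  refine ⟨fun p => ⟨measurable_siteToBond true, isOneDependent_siteToBond true p⟩, ?_⟩
  rintro D₁ h₁ D₂ h₂ ω S₁ rfl S₂ rfl β rfl
  have hdual : {e | dualConfig (siteToBond (D.facialGraph Φ₁) (extendSites ω true)) e = true} =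
      (PlaneDrawing.inducedEdges _ (PlaneDrawing.openSites Φ₁ ω))ᶜ := by
    ext e
    rw [Set.mem_compl_iff, Set.mem_ofPred_eq, dualConfig, Bool.not_eq_true', ← Bool.not_eq_true,
      siteToBond_eq_true_iff]
    rfl
  -- Both numbers are evaluated as the number of unbounded faces of the open subgraph, which is how
  -- they are compared.
  have hcl := PlaneDrawing.numInfComponents_closedSites hΦ.1 h₁ h₂ hM.twoConnected hinc ω
  have hdu := PlaneDrawing.numInfComponents_dualGraph hΦ.1 h₁ hinc ω D₂
  have hop := numInfComponents_induce_eq_bondGraph (D.facialGraph Φ₁) (extendSites ω true)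
  have had₁ := PlaneDrawing.numInfComponents_addDiagonals D₁ (S := {v | ω v = true})
    (S' := PlaneDrawing.openSites Φ₁ ω) (fun _ => Iff.rfl) (fun _ => rfl)
  have had₂ := PlaneDrawing.numInfComponents_addDiagonals D₂ (S := {v | ω v = false})
    (S' := PlaneDrawing.closedSites Φ₂ ω) (fun _ => Iff.rfl) (fun _ => rfl)
  rw [hdual]
  refine ⟨fun x C hC _ => ⟨?_, PlaneDrawing.isDualCutset_of_isCycle hC⟩, fun c hc _ hadj => ?_,
    fun F hF => ⟨PlaneDrawing.facesOf.exists_face hF, ?_, ?_, ?_⟩, hop, hcl.trans hdu.symm,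
    had₁.trans hop, numInfComponents_induce_eq_bondGraph _ ω, had₂.trans (hcl.trans hdu.symm)⟩
  · exact Set.Finite.preimage Subtype.val_injective.injOn (List.finite_toSet C.edges)
  · have hr : {e : (D.facialGraph Φ₁).edgeSet | ∃ i, (e : Sym2 (V ⊕ Φ₁)) = s(c i, c (i + 1))} =
        Set.range (PlaneDrawing.lineEdge hadj) := by
      ext e
      exact exists_congr fun i => ⟨fun h => Subtype.ext h.symm, fun h => h ▸ rfl⟩
    rw [hr]
    exact ⟨Set.infinite_range_of_injective (PlaneDrawing.lineEdge_injective hc hadj),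
      PlaneDrawing.isDualCutset_line hc hadj⟩
  · obtain ⟨c, hc, he⟩ := PlaneDrawing.facesOf.exists_component hF
    exact ⟨c, hc, fun e hee => he e (hdual.le hee)⟩
  · exact PlaneDrawing.exists_closed_component hΦ.1 h₁ h₂ hF hM.twoConnected hinc
  · by_cases hb : Bornology.IsBounded F
    · refine Or.inl ⟨hb, PlaneDrawing.facesOf.finite_faces ?_ hb, ?_⟩
      · exact PlaneDrawing.facialGraph_exists_adj hinc
          (PlaneDrawing.isBounded_face_of_facial hΦ.1 D₁ D₂)
      · exact (D₂.proper _ hb.isCompact_closure).1.subset fun x hx => subset_closure hx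
    · exact Or.inr ⟨hb, PlaneDrawing.facesOf.infinite_faces hF
        (PlaneDrawing.isBounded_facialFace hΦ.1 h₁ D₂) hb,
        PlaneDrawing.infinite_sites hΦ.1 h₁ h₂ hF hinc hb⟩
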